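/- \textbf{Setting.} All systems are finite-dimensional. A quantum channel $\Phi$ from $\mathcal H_A$ to $\mathcal H_B$ is a completely positive trace-preserving linear map from the operators on $\mathcal H_A$ to those on $\mathcal H_B$. Its noncommutative graph $\mathcal G(\Phi)$ is the linear span of the operators $V_k^*V_l$, where $\Phi(\rho)=\sum_k V_k\rho V_k^*$, $\sum_k V_k^*V_k=I$, is any Kraus representation of $\Phi$ (the span does not depend on its choice). A subspace $\mathcal H_0\subseteq\mathcal H_A$ is an error-correcting code for $\Phi$ if there is a channel $\Theta$ such that $\Theta(\Phi(\rho))=\rho$ for all states $\rho$ supported by $\mathcal H_0$. The 1-shot quantum zero-error capacity is $\bar Q_0(\Phi)=\sup\log_2\dim\mathcal H_0$, the supremum over all nonzero error-correcting codes $\mathcal H_0$ for $\Phi$. For $\theta\in(-\pi,\pi]$ and $\gamma=e^{i\theta}$ let $$\mathfrak N_\theta=\left\{\begin{pmatrix} a&b&e&f\\ c&d&f&\bar\gamma e\\ g&h&a&b\\ h&\gamma g&c&d\end{pmatrix} : a,b,c,d,e,f,g,h\in\mathbb C\right\}.$$ \textbf{Theorem 1.} Let $n\in\mathbb N$ and $\theta,\theta_1,\dots,\theta_n\in(-\pi,\pi]$,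 and let $\Phi_\theta$, $\Phi_{\theta_1},\dots,\Phi_{\theta_n}$ be arbitrary channels with input space $\mathbb C^4$ and noncommutative graphs $\mathcal G(\Phi_\theta)=\mathfrak N_\theta$, $\mathcal G(\Phi_{\theta_i})=\mathfrak N_{\theta_i}$. (A) $\bar Q_0(\Phi_\theta)>0$ if and only if $\theta=\pi$, and $\bar Q_0(\Phi_\pi)=1$. (B) If $\theta_1+\dots+\theta_n\equiv\pi \pmod{2\pi}$, then $\bar Q_0(\Phi_{\theta_1}\otimes\dots\otimes\Phi_{\theta_n})>0$, and the vectors $$|\varphi\rangle=\tfrac1{\sqrt2}\left(|1\dots1\rangle+i|2\dots2\rangle\right),\qquad |\psi\rangle=\tfrac1{\sqrt2}\left(|3\dots3\rangle+i|4\dots4\rangle\right),$$ where $|1\rangle,\dots,|4\rangle$ is the canonical basis of $\mathbb C^4$, span a two-dimensional error-correcting code for $\Phi_{\theta_1}\otimes\dots\otimes\Phi_{\theta_n}$. (C$_2$) If $n=2$ and $|\theta_1|+|\theta_2|<\pi$, then $\bar Q_0(\Phi_{\theta_1}\otimes\Phi_{\theta_2})=0$. (C$_n$) If $|\theta_1|+\dots+|\theta_n|\le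 2\ln(3/2)$, then $\bar Q_0(\Phi_{\theta_1}\otimes\dots\otimes\Phi_{\theta_n})=0$. -/

import Mathlib

universe u

namespace ZeroError

section Channels

open scoped Matrix.Norms.L2Operator MatrixOrder ComplexOrder

variable {a b : Type*} [Fintype a] [DecidableEq a] [Fintype b] [DecidableEq b]

/-- A quantum channel between the finite-dimensional systems `ℂ^a` and `ℂ^b`: a completely
positive trace-preserving linear map. The order on matrices is the Loewner order. -/
def IsChannel (Φ : Matrix a a ℂ →ₗ[ℂ] Matrix b b ℂ) : Prop :=
  (∃ F : CompletelyPositiveMap (Matrix a a ℂ) (Matrix b b ℂ), F.toLinearMap = Φ) ∧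
    ∀ X : Matrix a a ℂ, (Φ X).trace = X.trace

/-- `V` is a Kraus representation of `Φ`. -/
def IsKraus (Φ : Matrix a a ℂ →ₗ[ℂ] Matrix b b ℂ) {r : ℕ} (V : Fin r → Matrix b a ℂ) : Prop :=
  (∀ X : Matrix a a ℂ, Φ X = ∑ k, V k * X * (V k).conjTranspose) ∧
    ∑ k, (V k).conjTranspose * V k = 1

/-- The noncommutative graph of a channel: the span of the operators `V_k^* V_l`, where `V` is a
Kraus representation of the channel. For a channel this span is the same for all Kraus
representations, so that all of them may be taken together. -/
def ncGraph (Φ : Matrix a a ℂ →ₗ[ℂ] Matrix b b ℂ) : Submodule ℂ (Matrix a a ℂ) :=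
  Submodule.span ℂ {A | ∃ (r : ℕ) (V : Fin r → Matrix b a ℂ) (k l : Fin r),
    IsKraus Φ V ∧ A = (V k).conjTranspose * V l}

/-- `H₀` is an error-correcting code for `Φ`: the map `Φ` is perfectly reversible on `H₀`, i.e. some
channel `Θ` satisfies `Θ (Φ ρ) = ρ` for all states `ρ` supported by `H₀`. -/
def IsCode (Φ : Matrix a a ℂ →ₗ[ℂ] Matrix b b ℂ) (H₀ : Submodule ℂ (a → ℂ)) : Prop :=
  ∃ Θ : Matrix b b ℂ →ₗ[ℂ] Matrix a a ℂ, IsChannel Θ ∧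
    ∀ ρ : Matrix a a ℂ, ρ.PosSemidef → ρ.trace = 1 → (∀ v : a → ℂ, ρ.mulVec v ∈ H₀) →
      Θ (Φ ρ) = ρ

/-- The 1-shot quantum zero-error capacity: the supremum of `log₂ dim H₀` over the
error-correcting codes `H₀`. The zero subspace is left out since its `log₂ dim` is `-∞`. -/
noncomputable def capacity (Φ : Matrix a a ℂ →ₗ[ℂ] Matrix b b ℂ) : EReal :=
  ⨆ (H₀ : Submodule ℂ (a → ℂ)) (_ : IsCode Φ H₀ ∧ H₀ ≠ ⊥),
    ((Real.logb 2 (Module.finrank ℂ H₀ : ℝ) : ℝ) : EReal)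

end Channels

section Tensor

variable {n : ℕ} {a b : Fin n → Type*} [∀ i, Fintype (a i)] [∀ i, DecidableEq (a i)]

/-- The tensor product `Φ₁ ⊗ … ⊗ Φₙ`, acting on `⊗ᵢ ℂ^(a i) = ℂ^(∏ᵢ a i)`. -/
noncomputable def tensor (Φ : ∀ i, Matrix (a i) (a i) ℂ →ₗ[ℂ] Matrix (b i) (b i) ℂ) :
    Matrix (∀ i, a i) (∀ i, a i) ℂ →ₗ[ℂ] Matrix (∀ i, b i) (∀ i, b i) ℂ where
  toFun X := Matrix.of fun r s =>
    ∑ p, ∑ q, X p q * ∏ i, Φ i (Matrix.single (p i) (q i) 1) (r i) (s i)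
  map_add' X Y := by
    ext r s
    simp [add_mul, Finset.sum_add_distrib]
  map_smul' c X := by
    ext r s
    simp [mul_assoc, Finset.mul_sum]

/-- The tensor product of maps acts factor by factor on tensor products of matrices. -/
theorem tensor_apply_prod (Φ : ∀ i, Matrix (a i) (a i) ℂ →ₗ[ℂ] Matrix (b i) (b i) ℂ)
    (X : ∀ i, Matrix (a i) (a i) ℂ) :
    tensor Φ (Matrix.of fun p q => ∏ i, X i (p i) (q i)) =
      Matrix.of fun r s => ∏ i, Φ i (X i) (r i) (s i) := by
  have key : ∀ i r s, Φ i (X i) r s =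
      ∑ p, ∑ q, X i p q * Φ i (Matrix.single p q 1) r s := by
    intro i r s
    conv_lhs => rw [Matrix.matrix_eq_sum_single (X i)]
    have h : ∀ p q, Matrix.single p q (X i p q) = X i p q • Matrix.single p q (1 : ℂ) := by
      intro p q
      simp [Matrix.smul_single]
    simp only [h, map_sum, map_smul, Matrix.sum_apply, Matrix.smul_apply, smul_eq_mul]
  ext r s
  simp only [tensor, LinearMap.coe_mk, AddHom.coe_mk, Matrix.of_apply, key,
    Finset.prod_univ_sum, Fintype.piFinset_univ, ← Finset.prod_mul_distrib]

end Tensor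

/-- The 8-dimensional space `𝔑_θ` of 4 × 4 matrices, with `γ = exp(iθ)`. -/
noncomputable def graphN (θ : ℝ) : Submodule ℂ (Matrix (Fin 4) (Fin 4) ℂ) where
  carrier := {M | ∃ a b c d e f g h : ℂ, M =
    !![a, b, e, f;
       c, d, f, star (Complex.exp (θ * Complex.I)) * e;
       g, h, a, b;
       h, Complex.exp (θ * Complex.I) * g, c, d]}
  add_mem' := by
    rintro _ _ ⟨a, b, c, d, e, f, g, h, rfl⟩ ⟨a', b', c', d', e', f', g', h', rfl⟩
    refine ⟨a + a', b + b', c + c', d + d', e + e', f + f', g + g', h + h', ?_⟩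
    ext i j
    fin_cases i <;> fin_cases j <;> simp [mul_add]
  zero_mem' := by
    refine ⟨0, 0, 0, 0, 0, 0, 0, 0, ?_⟩
    ext i j
    fin_cases i <;> fin_cases j <;> simp
  smul_mem' := by
    rintro t _ ⟨a, b, c, d, e, f, g, h, rfl⟩
    refine ⟨t * a, t * b, t * c, t * d, t * e, t * f, t * g, t * h, ?_⟩
    ext i j
    fin_cases i <;> fin_cases j <;> simp [mul_left_comm]

/-- The vector `(|j…j⟩ + i |k…k⟩) / √2` of `(ℂ⁴)^{⊗n}`, with the canonical basis of `ℂ⁴` indexed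
by `0, 1, 2, 3`. -/
noncomputable def codeVec (n : ℕ) (j k : Fin 4) : (Fin n → Fin 4) → ℂ :=
  (1 / (Real.sqrt 2 : ℂ)) •
    (Pi.single (fun _ => j) (1 : ℂ) + Complex.I • Pi.single (fun _ => k) (1 : ℂ))

end ZeroError

open ZeroError

/-! Codes are governed by the Knill–Laflamme conditions: every operator of the graph must compress
to a scalar on the code (`IsCode.mem_klSpace`, `IsKrausFamily.isCode`). For a tensor product of
channels it suffices to test tensor products of graph elements (`IsCode.tens_mem_klSpace`,
`isCode_tensor_of_isometry`).

Let δ = exp(iθ/2), D = diag(δ, δ̄), and let X be the flip. On ℂ² ⊗ ℂ² the graph is 1 ⊗ M₂ + e₀₁ ⊗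
span(D, X) + e₁₀ ⊗ span(D̄, X).

Existence of codes: the coefficient i in the two vectors cancels the contributions of X, and what is
left of the off-diagonal element is a multiple of 1 + ∏ γ̄ᵢ or of its conjugate, which vanishes when
the phases multiply to -1 (`tens_graphN_conj`).

One channel: the part 1 ⊗ M₂ forces an orthonormal code pair into the form (p, q) ⊗ u, (-q̄, p̄) ⊗
ωu (`exists_product_form`). For |θ| < π the form of D has real part cos(θ/2)‖u‖², hence no isotropic
vectors, and the blocks D and D̄ give p = q = 0. A third code vector never fits, because the
complement of (p, q) in ℂ² is a line.

Two channels: split the space into T ⊗ S, where S holds the two block qubits and T the other two.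
All C ⊗ 1 are available, so φ and ψ have the same support in T, and its dimension r satisfies 2r ≤
4. If r = 1, positivity of the real parts of products of phases yields the conditions for a whole
operator system on S, which annihilates φ (`eq_zero_of_sig_mem`). If r = 2, the operators on S with
unrestricted partner are closed under multiplication (`pairSpaceLeft_mul`). Either a full M₂ arises
on one block qubit, and the one-channel argument applies to the other, or a normal form of the
support leaves one rigid configuration, which is excluded by signs (`flip_form`).

Many channels: at θ = 0 the graph contains the projections onto an orthonormal basis, and a code
pair would have to be both disjointly supported and equally distributed in the product basis. Small
angles perturb the weighted sums of these projections by less than 1/2 in norm (`norm_weighted_le`),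
which still excludes a pair (`tens_graphN_no_pair`). -/

namespace ZeroError

/-! ### Kraus operators and complete positivity -/

section Kraus

open Matrix
open scoped Matrix.Norms.L2Operator MatrixOrder ComplexOrder

variable {a b : Type*} [Fintype a] [DecidableEq a] [Fintype b] [DecidableEq b]

/-- A Kraus representation indexed by an arbitrary finite type. -/
def IsKrausFamily (Φ : Matrix a a ℂ →ₗ[ℂ] Matrix b b ℂ) {ι : Type*} [Fintype ι]
    (V : ι → Matrix b a ℂ) : Prop :=
  (∀ X : Matrix a a ℂ, Φ X = ∑ k, V k * X * (V k)ᴴ) ∧ ∑ k, (V k)ᴴ * V k = 1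

theorem exists_star_mul_self_of_nonneg {A : Type*} [NonUnitalCStarAlgebra A] [PartialOrder A]
    [StarOrderedRing A] {x : A} (h : 0 ≤ x) : ∃ y, x = star y * y :=
  CStarAlgebra.nonneg_iff_eq_star_mul_self.mp h

theorem cstarMatrix_sum_apply {A m : Type*} [AddCommMonoid A] {κ : Type*} (s : Finset κ)
    (f : κ → CStarMatrix m m A) (i j : m) : (∑ x ∈ s, f x) i j = ∑ x ∈ s, f x i j :=
  Matrix.sum_apply i j s f

/-- A map with Kraus operators is completely positive and trace-preserving. -/
theorem IsKrausFamily.isChannel {Φ : Matrix a a ℂ →ₗ[ℂ] Matrix b b ℂ} {ι : Type*} [Fintype ι]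
    {V : ι → Matrix b a ℂ} (h : IsKrausFamily Φ V) : IsChannel Φ := by
  refine ⟨⟨⟨Φ, ?_⟩, rfl⟩, ?_⟩
  · intro m M hM
    rcases isEmpty_or_nonempty b with hb | ⟨⟨p₀⟩⟩
    · have : M.map Φ = 0 := by
        ext i j p
        exact hb.elim p
      rw [this]
    obtain ⟨N, rfl⟩ := exists_star_mul_self_of_nonneg hM
    -- The factors `N l i * (V k)ᴴ` are `a × b` matrices and so not elements of the algebra of `b ×
    -- b` matrices. Each row `s` is placed alone in row `p₀` of a square matrix, which leaves the
    -- sum of the products unchanged.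
    let Z : Fin m → ι → a → CStarMatrix (Fin m) (Fin m) (Matrix b b ℂ) := fun l k s =>
      CStarMatrix.ofMatrix fun l' i => if l' = l then
        Matrix.of fun p q => if p = p₀ then (N l i * (V k)ᴴ) s q else 0 else 0
    have hZ : (star N * N).map Φ = ∑ l, ∑ k, ∑ s, star (Z l k s) * Z l k s := by
      have key : ∀ i j, Φ ((star N * N) i j) = ∑ l, ∑ k, (N l i * (V k)ᴴ)ᴴ * (N l j * (V k)ᴴ) := by
        intro i j
        rw [CStarMatrix.mul_apply, map_sum]
        refine Finset.sum_congr rfl fun l _ => ?_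
        rw [h.1]
        refine Finset.sum_congr rfl fun k _ => ?_
        simp only [CStarMatrix.star_apply, star_eq_conjTranspose, conjTranspose_mul,
          conjTranspose_conjTranspose, Matrix.mul_assoc]
      ext i j p q
      have hZ : ∀ l k s l' i, Z l k s l' i = if l' = l then
        Matrix.of fun p q => if p = p₀ then (N l i * (V k)ᴴ) s q else 0 else 0 :=
        fun _ _ _ _ _ => rfl
      rw [CStarMatrix.map_apply, key]
      simp only [cstarMatrix_sum_apply, CStarMatrix.mul_apply, CStarMatrix.star_apply,
        star_eq_conjTranspose, Matrix.sum_apply, hZ]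
      refine Finset.sum_congr rfl fun l _ => Finset.sum_congr rfl fun k _ => ?_
      generalize hY : (fun i => N l i * (V k)ᴴ) = Y
      have hY : ∀ i, N l i * (V k)ᴴ = Y i := fun i => congrFun hY i
      simp only [hY]
      rw [Matrix.mul_apply]
      refine Finset.sum_congr rfl fun s _ => ?_
      rw [Finset.sum_eq_single l (by intro l' _ hl'; simp [hl']) (by simp), if_pos rfl, if_pos rfl,
        Matrix.mul_apply, Finset.sum_eq_single p₀ (by intro p' _ hp'; simp [hp']) (by simp)]
      simp only [conjTranspose_apply, of_apply, if_true]
    rw [hZ]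
    exact Finset.sum_nonneg fun l _ => Finset.sum_nonneg fun k _ => Finset.sum_nonneg fun s _ =>
      star_mul_self_nonneg _
  · intro X
    rw [h.1, trace_sum]
    simp_rw [Matrix.trace_mul_comm _ (V _)ᴴ, ← Matrix.mul_assoc]
    rw [← trace_sum, ← Finset.sum_mul, h.2, Matrix.one_mul]

/-- Choi's theorem: every channel has a Kraus representation. -/
theorem IsChannel.exists_isKrausFamily [Nonempty a] {Φ : Matrix a a ℂ →ₗ[ℂ] Matrix b b ℂ}
    (h : IsChannel Φ) : ∃ W : a × b → Matrix b a ℂ, IsKrausFamily Φ W := by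
  obtain ⟨⟨F, hF⟩, htr⟩ := h
  obtain ⟨p₀⟩ := ‹Nonempty a›
  -- `star N * N` is the block matrix of all matrix units, whose image under `Φ` is the Choi matrix.
  -- A factorisation `star R * R` of that image supplies the Kraus operators, one for each row of
  -- `R`.
  let N : CStarMatrix a a (Matrix a a ℂ) := CStarMatrix.ofMatrix fun k i =>
    if k = p₀ then single p₀ i 1 else 0
  have hNa : ∀ k i, N k i = if k = p₀ then single p₀ i 1 else 0 := fun _ _ => rfl
  have h1 : (0 : CStarMatrix a a (Matrix b b ℂ)) ≤ (star N * N).map F :=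
    F.map_cstarMatrix_nonneg _ (star_mul_self_nonneg N)
  obtain ⟨R, hR⟩ := exists_star_mul_self_of_nonneg h1
  have hN : ∀ i j, (star N * N) i j = single i j 1 := by
    intro i j
    rw [CStarMatrix.mul_apply, Finset.sum_eq_single p₀]
    · simp [hNa, CStarMatrix.star_apply, star_eq_conjTranspose]
    · intro k _ hk
      simp [hNa, hk]
    · simp
  have hΦ : ∀ i j, Φ (single i j 1) = ∑ k, (R k i)ᴴ * R k j := by
    intro i j
    have := congrArg (fun M : CStarMatrix a a (Matrix b b ℂ) => M i j) hR
    simp only [CStarMatrix.map_apply, hN] at this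
    rw [← hF]
    refine Eq.trans this ?_
    rw [CStarMatrix.mul_apply]
    rfl
  let W : a × b → Matrix b a ℂ := fun ks => of fun p i => star (R ks.1 i ks.2 p)
  have hK : ∀ X : Matrix a a ℂ, Φ X = ∑ k, W k * X * (W k)ᴴ := by
    intro X
    conv_lhs => rw [Matrix.matrix_eq_sum_single X]
    have hs : ∀ p q, Matrix.single p q (X p q) = X p q • Matrix.single p q (1 : ℂ) := by
      intro p q
      simp [Matrix.smul_single]
    simp only [hs, map_sum, map_smul, hΦ]
    ext p q
    simp only [Matrix.sum_apply, Matrix.smul_apply, smul_eq_mul, Matrix.mul_apply,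
      conjTranspose_apply, Fintype.sum_prod_type, Finset.mul_sum, Finset.sum_mul, W, of_apply,
      star_star]
    calc _ = ∑ i, ∑ j, ∑ k, ∑ s, X i j * (star (R k i s p) * R k j s q) := rfl
      _ = ∑ x : a × a, ∑ y : a × b,
            X x.1 x.2 * (star (R y.1 x.1 y.2 p) * R y.1 x.2 y.2 q) := by
        simp only [Fintype.sum_prod_type]
      _ = ∑ y : a × b, ∑ x : a × a,
            X x.1 x.2 * (star (R y.1 x.1 y.2 p) * R y.1 x.2 y.2 q) := Finset.sum_comm
      _ = ∑ k, ∑ s, ∑ i, ∑ j, X i j * (star (R k i s p) * R k j s q) := by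
        simp only [Fintype.sum_prod_type]
      _ = ∑ k, ∑ s, ∑ j, ∑ i, X i j * (star (R k i s p) * R k j s q) :=
        Finset.sum_congr rfl fun k _ => Finset.sum_congr rfl fun s _ => Finset.sum_comm
      _ = _ := by
        refine Finset.sum_congr rfl fun k _ => Finset.sum_congr rfl fun s _ =>
          Finset.sum_congr rfl fun j _ => Finset.sum_congr rfl fun i _ => by ring
  refine ⟨W, hK, ?_⟩
  ext i j
  have h2 : ∀ X : Matrix a a ℂ, ((∑ k, (W k)ᴴ * W k) * X).trace = X.trace := by
    intro X
    rw [← htr X, hK, trace_sum, Finset.sum_mul, trace_sum]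
    refine Finset.sum_congr rfl fun k _ => ?_
    rw [Matrix.trace_mul_comm (W k * X), Matrix.mul_assoc]
  have := h2 (single j i 1)
  rw [Matrix.trace_mul_comm, trace_single_mul, one_smul, ← Matrix.mul_one (single j i 1),
    trace_single_mul, one_smul] at this
  exact this

end Kraus
-- The Knill–Laflamme conditions
section KnillLaflamme

open Matrix
open scoped ComplexOrder

variable {a b : Type*} [Fintype a] [DecidableEq a] [Fintype b] [DecidableEq b]

theorem star_dotProduct_swap {m : Type*} [Fintype m] (x y : m → ℂ) :
    star (star x ⬝ᵥ y) = star y ⬝ᵥ x := by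
  simp [dotProduct, mul_comm]

theorem eq_zero_of_star_dotProduct_self {m : Type*} [Fintype m] {x : m → ℂ}
    (h : star x ⬝ᵥ x = 0) : x = 0 := by
  simpa using h

/-- The matrices whose compression to `H₀` is a multiple of the identity. -/
def klSpace (H₀ : Submodule ℂ (a → ℂ)) : Submodule ℂ (Matrix a a ℂ) where
  carrier := {A | ∃ c : ℂ, ∀ φ ∈ H₀, ∀ ψ ∈ H₀, star φ ⬝ᵥ A *ᵥ ψ = c * (star φ ⬝ᵥ ψ)}
  add_mem' := by
    rintro A B ⟨c, hc⟩ ⟨d, hd⟩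
    refine ⟨c + d, fun φ hφ ψ hψ => ?_⟩
    rw [add_mulVec, dotProduct_add, hc φ hφ ψ hψ, hd φ hφ ψ hψ, add_mul]
  zero_mem' := ⟨0, by simp⟩
  smul_mem' := by
    rintro t A ⟨c, hc⟩
    refine ⟨t * c, fun φ hφ ψ hψ => ?_⟩
    rw [smul_mulVec, dotProduct_smul, hc φ hφ ψ hψ, smul_eq_mul, mul_assoc]

theorem mem_klSpace {H₀ : Submodule ℂ (a → ℂ)} {A : Matrix a a ℂ} : A ∈ klSpace H₀ ↔
    ∃ c : ℂ, ∀ φ ∈ H₀, ∀ ψ ∈ H₀, star φ ⬝ᵥ A *ᵥ ψ = c * (star φ ⬝ᵥ ψ) := Iff.rfl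

/-- A matrix that maps each vector of a subspace into its orthogonal bicomplement acts on the
subspace as a scalar. -/
theorem exists_scalar_of_orthogonal {H₀ : Submodule ℂ (a → ℂ)} {M : Matrix a a ℂ}
    (h : ∀ χ ∈ H₀, ∀ η : a → ℂ, star η ⬝ᵥ χ = 0 → star η ⬝ᵥ M *ᵥ χ = 0) :
    ∃ c : ℂ, ∀ χ ∈ H₀, M *ᵥ χ = c • χ := by
  have h1 : ∀ χ ∈ H₀, ∃ c : ℂ, M *ᵥ χ = c • χ := by
    intro χ hχ
    by_cases h0 : χ = 0
    · exact ⟨0, by simp [h0]⟩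
    have hn : star χ ⬝ᵥ χ ≠ 0 := by simpa using h0
    refine ⟨(star χ ⬝ᵥ M *ᵥ χ) / (star χ ⬝ᵥ χ), ?_⟩
    set c := (star χ ⬝ᵥ M *ᵥ χ) / (star χ ⬝ᵥ χ) with hc
    have e1 : star χ ⬝ᵥ (M *ᵥ χ - c • χ) = 0 := by
      rw [dotProduct_sub, dotProduct_smul, hc, smul_eq_mul, div_mul_cancel₀ _ hn, sub_self]
    have e2 : star (M *ᵥ χ - c • χ) ⬝ᵥ χ = 0 := by
      rw [← star_dotProduct_swap, e1, star_zero]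
    have e3 := h χ hχ _ e2
    have e4 : star (M *ᵥ χ - c • χ) ⬝ᵥ (M *ᵥ χ - c • χ) = 0 := by
      rw [dotProduct_sub, e3, dotProduct_smul, e2, smul_zero, sub_zero]
    exact sub_eq_zero.mp (eq_zero_of_star_dotProduct_self e4)
  by_cases hbot : ∀ χ ∈ H₀, χ = 0
  · exact ⟨0, fun χ hχ => by simp [hbot χ hχ]⟩
  push Not at hbot
  obtain ⟨χ₀, hχ₀, hne⟩ := hbot
  obtain ⟨c₀, hc₀⟩ := h1 χ₀ hχ₀
  refine ⟨c₀, fun χ hχ => ?_⟩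
  obtain ⟨c, hc⟩ := h1 χ hχ
  obtain ⟨d, hd⟩ := h1 _ (H₀.add_mem hχ hχ₀)
  rw [mulVec_add, hc, hc₀, smul_add] at hd
  have hd' : (c - d) • χ = (d - c₀) • χ₀ := by
    rw [sub_smul, sub_smul, sub_eq_sub_iff_add_eq_add, hd, add_comm]
  by_cases hcd : c = d
  · rw [hcd, sub_self, zero_smul] at hd'
    have := (smul_eq_zero.mp hd'.symm).resolve_right hne
    rw [hc, hcd, sub_eq_zero.mp this]
  · have hx : χ = ((c - d)⁻¹ * (d - c₀)) • χ₀ := by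
      rw [mul_smul, ← hd', smul_smul, inv_mul_cancel₀ (sub_ne_zero.mpr hcd), one_smul]
    rw [hx, mulVec_smul, hc₀, smul_comm]

/-- The necessity of the Knill–Laflamme conditions. -/
theorem IsCode.mem_klSpace {Φ : Matrix a a ℂ →ₗ[ℂ] Matrix b b ℂ} {ι : Type*} [Fintype ι]
    {V : ι → Matrix b a ℂ} (hV : IsKrausFamily Φ V) {H₀ : Submodule ℂ (a → ℂ)}
    (h : IsCode Φ H₀) (k l : ι) : (V k)ᴴ * V l ∈ klSpace H₀ := by
  rcases isEmpty_or_nonempty b with hb | hb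
  · have : (V k)ᴴ * V l = 0 := by
      ext i j
      simp [Matrix.mul_apply]
    rw [this]
    exact Submodule.zero_mem _
  obtain ⟨Θ, hΘ, hrec⟩ := h
  obtain ⟨W, hW⟩ := hΘ.exists_isKrausFamily
  -- The products `W j * V k` are Kraus operators of the recovered map, which fixes the pure state
  -- of χ. For η orthogonal to χ the expectation in η is a vanishing sum of squared moduli, so each
  -- `W j * V k` maps χ to a multiple of χ.
  have hsc : ∀ j k, ∃ c : ℂ, ∀ χ ∈ H₀, (W j * V k) *ᵥ χ = c • χ := by
    intro j k
    refine exists_scalar_of_orthogonal fun χ hχ η hη => ?_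
    by_cases h0 : χ = 0
    · simp [h0]
    have hn : star χ ⬝ᵥ χ ≠ 0 := by simpa using h0
    have hρ := hrec ((star χ ⬝ᵥ χ)⁻¹ • vecMulVec χ (star χ)) ?_ ?_ ?_
    · rw [map_smul, map_smul] at hρ
      have hρ' := smul_right_injective _ (inv_ne_zero hn) hρ
      rw [hV.1, map_sum] at hρ'
      simp_rw [hW.1] at hρ'
      have e : star η ⬝ᵥ (∑ k, ∑ j, W j * (V k * vecMulVec χ (star χ) * (V k)ᴴ) * (W j)ᴴ) *ᵥ η
          = ∑ k, ∑ j, (star η ⬝ᵥ (W j * V k) *ᵥ χ) * star (star η ⬝ᵥ (W j * V k) *ᵥ χ) := by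
        simp only [sum_mulVec, dotProduct_sum]
        refine Finset.sum_congr rfl fun k _ => Finset.sum_congr rfl fun j _ => ?_
        have : W j * (V k * vecMulVec χ (star χ) * (V k)ᴴ) * (W j)ᴴ =
            vecMulVec ((W j * V k) *ᵥ χ) (star ((W j * V k) *ᵥ χ)) := by
          rw [star_mulVec, ← vecMulVec_mul, ← mul_vecMulVec, conjTranspose_mul]
          simp only [Matrix.mul_assoc]
        rw [this, vecMulVec_mulVec, op_smul_eq_smul, dotProduct_smul, smul_eq_mul, mul_comm]
        rw [star_dotProduct_swap]
      rw [hρ', vecMulVec_mulVec, op_smul_eq_smul, dotProduct_smul, hη, smul_zero] at e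
      have e1 := (Finset.sum_eq_zero_iff_of_nonneg
        (fun k _ => Finset.sum_nonneg fun j _ => mul_star_self_nonneg _)).mp e.symm k
        (Finset.mem_univ k)
      have e2 := (Finset.sum_eq_zero_iff_of_nonneg
        (fun j _ => mul_star_self_nonneg _)).mp e1 j (Finset.mem_univ j)
      simpa using e2
    · refine (posSemidef_vecMulVec_self_star χ).smul ?_
      rw [inv_nonneg]
      exact dotProduct_star_self_nonneg χ
    · rw [trace_smul, trace_vecMulVec, smul_eq_mul, dotProduct_comm χ, inv_mul_cancel₀ hn]
    · intro v
      rw [smul_mulVec, vecMulVec_mulVec, op_smul_eq_smul]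
      exact H₀.smul_mem _ (H₀.smul_mem _ hχ)
  choose c hc using hsc
  refine ⟨∑ j, star (c j k) * c j l, fun φ hφ ψ hψ => ?_⟩
  have : (V k)ᴴ * V l = ∑ j, (W j * V k)ᴴ * (W j * V l) := by
    conv_lhs => rw [← Matrix.one_mul (V l), ← hW.2, Matrix.sum_mul, Matrix.mul_sum]
    refine Finset.sum_congr rfl fun j _ => ?_
    simp only [conjTranspose_mul, Matrix.mul_assoc]
  rw [this, sum_mulVec, dotProduct_sum, Finset.sum_mul]
  refine Finset.sum_congr rfl fun j _ => ?_
  rw [← mulVec_mulVec, dotProduct_mulVec, ← star_mulVec, hc j k φ hφ, hc j l ψ hψ, star_smul,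
    smul_dotProduct, dotProduct_smul, smul_eq_mul, smul_eq_mul, mul_assoc]

/-- The sufficiency of the Knill–Laflamme conditions, for the code spanned by the columns of an
isometry. -/
theorem IsKrausFamily.isCode {Φ : Matrix a a ℂ →ₗ[ℂ] Matrix b b ℂ} {ι : Type*} [Fintype ι]
    {V : ι → Matrix b a ℂ} (hV : IsKrausFamily Φ V) {d : Type*} [Fintype d] [DecidableEq d]
    [Nonempty d] {E : Matrix a d ℂ} (hE : Eᴴ * E = 1) {H₀ : Submodule ℂ (a → ℂ)}
    (hH : ∀ v ∈ H₀, ∃ w, v = E *ᵥ w)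
    (hKL : ∀ k l, ∃ c : ℂ, Eᴴ * ((V k)ᴴ * V l) * E = c • 1) : IsCode Φ H₀ := by
  classical
  choose Λ hΛ using hKL
  obtain ⟨i₀⟩ := ‹Nonempty d›
  let G : ι → Matrix b d ℂ := fun k => V k * E
  have hG : ∀ k l, (G k)ᴴ * G l = Λ k l • 1 := by
    intro k l
    rw [← hΛ, conjTranspose_mul]
    simp only [Matrix.mul_assoc]
    rfl
  have hherm : (Matrix.of Λ).IsHermitian := by
    ext k l
    have := congrArg (fun M : Matrix d d ℂ => M i₀ i₀) (congrArg conjTranspose (hG l k))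
    rw [conjTranspose_mul, conjTranspose_conjTranspose] at this
    simp only [hG, conjTranspose_smul, conjTranspose_one] at this
    simpa using this.symm
  have htr : ∑ k, Λ k k = 1 := by
    have : ∑ k, (G k)ᴴ * G k = 1 := by
      have : ∀ k, (G k)ᴴ * G k = Eᴴ * ((V k)ᴴ * V k) * E := by
        intro k
        rw [hΛ, hG]
      simp_rw [this]
      rw [← Matrix.sum_mul, ← Matrix.mul_sum, hV.2, Matrix.mul_one, hE]
    have := congrArg (fun M : Matrix d d ℂ => M i₀ i₀) this
    simpa [Matrix.sum_apply, hG] using this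
  -- Diagonalising the Hermitian matrix Λ replaces the restricted Kraus operators `G k` by operators
  -- `F m` with pairwise orthogonal ranges, each a multiple of an isometry.
  let U : Matrix ι ι ℂ := hherm.eigenvectorUnitary
  let D : ι → ℝ := hherm.eigenvalues
  have hUU : U * Uᴴ = 1 := Unitary.coe_mul_star_self hherm.eigenvectorUnitary
  have hUU' : Uᴴ * U = 1 := Unitary.coe_star_mul_self hherm.eigenvectorUnitary
  have hUΛ : Uᴴ * Matrix.of Λ * U = diagonal fun m => (D m : ℂ) := by
    have := hherm.spectral_theorem
    rw [Unitary.conjStarAlgAut_apply] at this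
    have e : Matrix.of Λ = U * (diagonal fun m => (D m : ℂ)) * Uᴴ := this
    rw [e, ← Matrix.mul_assoc, ← Matrix.mul_assoc, hUU', Matrix.one_mul, Matrix.mul_assoc, hUU',
      Matrix.mul_one]
  have hDsum : ∑ m, (D m : ℂ) = 1 := by
    have := congrArg Matrix.trace hUΛ
    rw [Matrix.trace_mul_comm, ← Matrix.mul_assoc, hUU, Matrix.one_mul, trace_diagonal] at this
    rw [← this, ← htr]
    rfl
  let F : ι → Matrix b d ℂ := fun m => ∑ l, U l m • G l
  have hF : ∀ m m', (F m)ᴴ * F m' = if m = m' then (D m : ℂ) • 1 else 0 := by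
    intro m m'
    have h1 : (F m)ᴴ * F m' = (Uᴴ * Matrix.of Λ * U) m m' • 1 := by
      simp only [F, conjTranspose_sum, Matrix.sum_mul, Matrix.mul_sum, conjTranspose_smul,
        Matrix.smul_mul, Matrix.mul_smul, hG, smul_smul]
      rw [Matrix.mul_apply, Finset.sum_smul]
      refine Finset.sum_congr rfl fun l _ => ?_
      rw [Matrix.mul_apply, Finset.sum_mul, Finset.sum_smul, Finset.smul_sum]
      refine Finset.sum_congr rfl fun k _ => ?_
      rw [conjTranspose_apply, of_apply, smul_smul]
      congr 1
      ring
    rw [h1, hUΛ, diagonal_apply]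
    split_ifs <;> simp
  have hGF : ∀ k, G k = ∑ m, star (U k m) • F m := by
    intro k
    simp only [F, Finset.smul_sum, smul_smul]
    rw [Finset.sum_comm]
    have : ∀ l, ∑ m, (star (U k m) * U l m) • G l = (U * Uᴴ) l k • G l := by
      intro l
      rw [Matrix.mul_apply, ← Finset.sum_smul]
      simp only [conjTranspose_apply, mul_comm]
    simp_rw [this, hUU, one_apply]
    simp
  have hD0 : ∀ m, 0 ≤ D m := by
    intro m
    have h1 := posSemidef_conjTranspose_mul_self (F m)
    rw [hF, if_pos rfl] at h1
    have := h1.diag_nonneg (i := i₀)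
    simpa using this
  have hF0 : ∀ m, D m = 0 → F m = 0 := by
    intro m hm
    have := hF m m
    rw [if_pos rfl, hm, Complex.ofReal_zero, zero_smul] at this
    exact conjTranspose_mul_self_eq_zero.mp this
  -- For `D m = 0` the inverse is 0 by convention, which is harmless since `F m = 0` as well.
  let c : ι → ℝ := fun m => (Real.sqrt (D m))⁻¹
  have hc : ∀ m, ((c m : ℂ) * c m * D m) • F m = F m := by
    intro m
    by_cases h0 : D m = 0
    · simp [hF0 m h0]
    have h1 : c m * c m * D m = 1 := by
      simp only [c]
      rw [← mul_inv, Real.mul_self_sqrt (hD0 m), inv_mul_cancel₀ h0]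
    have h2 : (c m : ℂ) * c m * D m = 1 := by exact_mod_cast h1
    rw [h2, one_smul]
  -- The projection onto the sum of the ranges of the `F m`.
  let Q : Matrix b b ℂ := ∑ m, ((c m : ℂ) * c m) • (F m * (F m)ᴴ)
  have hQF : ∀ m, Q * F m = F m := by
    intro m
    simp only [Q, Matrix.sum_mul, Matrix.smul_mul, Matrix.mul_assoc, hF]
    rw [Finset.sum_eq_single m (by intro k _ hk; simp [hk]) (by simp), if_pos rfl,
      Matrix.mul_smul, Matrix.mul_one, smul_smul, hc]
  have hQQ : Q * Q = Q := by
    conv_lhs => enter [2]; simp only [Q]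
    simp only [Matrix.mul_sum, Matrix.mul_smul, ← Matrix.mul_assoc, hQF]
    rfl
  have hQh : Qᴴ = Q := by
    simp [Q, conjTranspose_sum]
  -- The recovery undoes the isometry on the range of each `F m`. The second family sends the
  -- complement of these ranges to a fixed column of `E`; it only serves to preserve the trace.
  let R : ι ⊕ b → Matrix a b ℂ := Sum.elim (fun m => (c m : ℂ) • (E * (F m)ᴴ))
    fun s => Matrix.of fun p q => E p i₀ * (1 - Q) s q
  let Θ : Matrix b b ℂ →ₗ[ℂ] Matrix a a ℂ :=
    { toFun := fun X => ∑ k, R k * X * (R k)ᴴ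
      map_add' := by
        intro X Y
        simp [Matrix.mul_add, Matrix.add_mul, Finset.sum_add_distrib]
      map_smul' := by
        intro t X
        simp [Finset.smul_sum] }
  have hΘ : IsKrausFamily Θ R := by
    refine ⟨fun X => rfl, ?_⟩
    rw [Fintype.sum_sum_type]
    have h1 : ∑ m, (R (Sum.inl m))ᴴ * R (Sum.inl m) = Q := by
      refine Finset.sum_congr rfl fun m _ => ?_
      simp only [R, Sum.elim_inl, conjTranspose_smul, conjTranspose_mul,
        conjTranspose_conjTranspose, Matrix.smul_mul, Matrix.mul_smul, smul_smul]
      rw [Matrix.mul_assoc, ← Matrix.mul_assoc Eᴴ, hE, Matrix.one_mul]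
      simp
    have h2 : ∑ s, (R (Sum.inr s))ᴴ * R (Sum.inr s) = (1 - Q)ᴴ * (1 - Q) := by
      ext p q
      rw [Matrix.sum_apply, Matrix.mul_apply]
      refine Finset.sum_congr rfl fun s _ => ?_
      have h3 := congrArg (fun M : Matrix d d ℂ => M i₀ i₀) hE
      simp only [Matrix.mul_apply, conjTranspose_apply, one_apply_eq] at h3
      simp only [R, Sum.elim_inr, Matrix.mul_apply, conjTranspose_apply, of_apply]
      rw [← one_mul (star ((1 - Q) s p) * (1 - Q) s q), ← h3, Finset.sum_mul]
      refine Finset.sum_congr rfl fun x _ => ?_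
      rw [star_mul]
      ring
    rw [h1, h2, conjTranspose_sub, hQh, conjTranspose_one, Matrix.sub_mul, Matrix.mul_sub,
      Matrix.mul_sub, hQQ]
    simp
  refine ⟨Θ, hΘ.isChannel, fun ρ hρ htrρ hsupp => ?_⟩
  obtain ⟨σ, rfl⟩ : ∃ σ : Matrix d d ℂ, ρ = E * σ * Eᴴ := by
    have h1 : E * Eᴴ * ρ = ρ := by
      refine Matrix.ext_of_mulVec_single fun i => ?_
      obtain ⟨w, hw⟩ := hH _ (hsupp (Pi.single i 1))
      rw [← mulVec_mulVec, hw, mulVec_mulVec, Matrix.mul_assoc, hE, Matrix.mul_one]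
    have h2 : ρ * (E * Eᴴ) = ρ := by
      have := congrArg conjTranspose h1
      simpa [conjTranspose_mul, hρ.1.eq] using this
    refine ⟨Eᴴ * ρ * E, ?_⟩
    calc ρ = E * Eᴴ * ρ * (E * Eᴴ) := by rw [h1, h2]
      _ = _ := by simp only [Matrix.mul_assoc]
  have hΦ : Φ (E * σ * Eᴴ) = ∑ m, F m * σ * (F m)ᴴ := by
    rw [hV.1]
    have h1 : ∀ k, V k * (E * σ * Eᴴ) * (V k)ᴴ = G k * σ * (G k)ᴴ := by
      intro k
      simp only [G, conjTranspose_mul, Matrix.mul_assoc]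
    have h2 : ∀ k, V k * (E * σ * Eᴴ) * (V k)ᴴ =
        ∑ m, ∑ m', (star (U k m) * U k m') • (F m * σ * (F m')ᴴ) := by
      intro k
      rw [h1, hGF]
      simp only [conjTranspose_sum, Matrix.sum_mul, Matrix.mul_sum, conjTranspose_smul,
        Matrix.smul_mul, Matrix.mul_smul, star_star, Finset.smul_sum, smul_smul]
      rw [Finset.sum_comm]
      refine Finset.sum_congr rfl fun m _ => Finset.sum_congr rfl fun m' _ => ?_
      rw [mul_comm]
    simp_rw [h2]
    rw [Finset.sum_comm]
    refine Finset.sum_congr rfl fun m _ => ?_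
    rw [Finset.sum_comm]
    have h3 : ∀ m', ∑ k, (star (U k m) * U k m') • (F m * σ * (F m')ᴴ) =
        (Uᴴ * U) m m' • (F m * σ * (F m')ᴴ) := by
      intro m'
      rw [Matrix.mul_apply, Finset.sum_smul]
      rfl
    simp_rw [h3, hUU', one_apply]
    simp
  rw [hΦ, map_sum]
  have hterm : ∀ m, Θ (F m * σ * (F m)ᴴ) = (D m : ℂ) • (E * σ * Eᴴ) := by
    intro m
    have h1 : ∀ k, R k * (F m * σ * (F m)ᴴ) * (R k)ᴴ = (R k * F m) * σ * (R k * F m)ᴴ := by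
      intro k
      simp only [conjTranspose_mul, Matrix.mul_assoc]
    have h2 : ∀ s, R (Sum.inr s) * F m = 0 := by
      intro s
      have h3 : (1 - Q) * F m = 0 := by rw [Matrix.sub_mul, hQF, Matrix.one_mul, sub_self]
      ext p q
      have h4 := congrArg (fun M : Matrix b d ℂ => M s q) h3
      simp only [Matrix.mul_apply, Matrix.zero_apply] at h4
      simp only [R, Sum.elim_inr, Matrix.mul_apply, of_apply, mul_assoc, Matrix.zero_apply]
      rw [← Finset.mul_sum, h4, mul_zero]
    have h3 : ∀ m', R (Sum.inl m') * F m = if m' = m then ((c m : ℂ) * D m) • E else 0 := by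
      intro m'
      simp only [R, Sum.elim_inl, Matrix.smul_mul, Matrix.mul_assoc, hF]
      split_ifs with h
      · rw [h, Matrix.mul_smul, Matrix.mul_one, smul_smul]
      · simp
    change ∑ k, R k * (F m * σ * (F m)ᴴ) * (R k)ᴴ = _
    simp_rw [h1]
    rw [Fintype.sum_sum_type]
    simp only [h2, h3]
    rw [Finset.sum_eq_single m (by intro k _ hk; simp [hk]) (by simp), if_pos rfl]
    simp only [Matrix.zero_mul, Finset.sum_const_zero, add_zero, conjTranspose_smul,
      Matrix.smul_mul, Matrix.mul_smul, smul_smul]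
    congr 1
    simp only [star_mul', Complex.star_def, Complex.conj_ofReal]
    by_cases h0 : D m = 0
    · simp [h0]
    have h5 : c m * c m * D m = 1 := by
      simp only [c]
      rw [← mul_inv, Real.mul_self_sqrt (hD0 m), inv_mul_cancel₀ h0]
    have h6 : (c m : ℂ) * c m * D m = 1 := by exact_mod_cast h5
    linear_combination (D m : ℂ) * h6
  rw [Finset.sum_congr rfl fun m _ => hterm m, ← Finset.sum_smul, hDsum, one_smul]

end KnillLaflamme
-- Tensor products of matrices and of Kraus operators
section Tens

open Matrix

variable {n : ℕ} {a b c : Fin n → Type*}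

/-- The tensor product of matrices. -/
def tens (X : ∀ i, Matrix (b i) (a i) ℂ) : Matrix (∀ i, b i) (∀ i, a i) ℂ :=
  Matrix.of fun p q => ∏ i, X i (p i) (q i)

theorem tens_apply (X : ∀ i, Matrix (b i) (a i) ℂ) (p q) :
    tens X p q = ∏ i, X i (p i) (q i) := rfl

theorem tens_mul [∀ i, Fintype (b i)] (X : ∀ i, Matrix (c i) (b i) ℂ)
    (Y : ∀ i, Matrix (b i) (a i) ℂ) : tens X * tens Y = tens fun i => X i * Y i := by
  classical
  ext p q
  simp only [Matrix.mul_apply, tens_apply, Finset.prod_univ_sum, Fintype.piFinset_univ,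
    Finset.prod_mul_distrib]

theorem tens_conjTranspose (X : ∀ i, Matrix (b i) (a i) ℂ) :
    (tens X)ᴴ = tens fun i => (X i)ᴴ := by
  ext p q
  simp [tens_apply]

theorem tens_one [∀ i, DecidableEq (a i)] :
    tens (fun i => (1 : Matrix (a i) (a i) ℂ)) = 1 := by
  ext p q
  rw [tens_apply, one_apply]
  split_ifs with h
  · subst h
    simp
  · obtain ⟨i, hi⟩ := Function.ne_iff.mp h
    exact Finset.prod_eq_zero (Finset.mem_univ i) (one_apply_ne hi)

theorem sum_tens {κ : Fin n → Type*} [∀ i, Fintype (κ i)]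
    (X : ∀ i, κ i → Matrix (b i) (a i) ℂ) :
    ∑ k : ∀ i, κ i, tens (fun i => X i (k i)) = tens fun i => ∑ k, X i k := by
  classical
  ext p q
  simp only [Matrix.sum_apply, tens_apply, Finset.prod_univ_sum, Fintype.piFinset_univ]

theorem tens_update_apply (X : ∀ i, Matrix (b i) (a i) ℂ) (j : Fin n) (A : Matrix (b j) (a j) ℂ)
    (p q) : tens (Function.update X j A) p q =
      A (p j) (q j) * ∏ i ∈ Finset.univ.erase j, X i (p i) (q i) := by
  rw [tens_apply, ← Finset.mul_prod_erase _ _ (Finset.mem_univ j), Function.update_self]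
  congr 1
  refine Finset.prod_congr rfl fun i hi => ?_
  rw [Function.update_of_ne (Finset.ne_of_mem_erase hi)]

theorem tens_update_add (X : ∀ i, Matrix (b i) (a i) ℂ) (j : Fin n)
    (A B : Matrix (b j) (a j) ℂ) : tens (Function.update X j (A + B)) =
      tens (Function.update X j A) + tens (Function.update X j B) := by
  ext p q
  simp only [tens_update_apply, Matrix.add_apply, add_mul]

theorem tens_update_smul (X : ∀ i, Matrix (b i) (a i) ℂ) (j : Fin n) (t : ℂ)
    (A : Matrix (b j) (a j) ℂ) : tens (Function.update X j (t • A)) =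
      t • tens (Function.update X j A) := by
  ext p q
  simp only [tens_update_apply, Matrix.smul_apply, smul_eq_mul, mul_assoc]

theorem tens_update_zero (X : ∀ i, Matrix (b i) (a i) ℂ) (j : Fin n) :
    tens (Function.update X j 0) = 0 := by
  ext p q
  simp only [tens_update_apply, Matrix.zero_apply, zero_mul]

/-- A subspace that contains the tensor products of generators contains the tensor products of
elements of their spans. -/
theorem tens_mem_of_mem_span {S : ∀ i, Set (Matrix (b i) (a i) ℂ)}
    {W : Submodule ℂ (Matrix (∀ i, b i) (∀ i, a i) ℂ)}
    (h : ∀ A : ∀ i, Matrix (b i) (a i) ℂ, (∀ i, A i ∈ S i) → tens A ∈ W)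
    {A : ∀ i, Matrix (b i) (a i) ℂ} (hA : ∀ i, A i ∈ Submodule.span ℂ (S i)) : tens A ∈ W := by
  -- Induction on the set of positions at which the factor is only known to lie in the span; the
  -- other factors are generators.
  have key : ∀ T : Finset (Fin n), ∀ A : ∀ i, Matrix (b i) (a i) ℂ,
      (∀ i ∈ T, A i ∈ Submodule.span ℂ (S i)) → (∀ i ∉ T, A i ∈ S i) → tens A ∈ W := by
    intro T
    induction T using Finset.induction_on with
    | empty => exact fun A _ hA => h A fun i => hA i (by simp)
    | insert j T hj ih =>
      intro A h1 h2
      have key : ∀ x ∈ Submodule.span ℂ (S j), tens (Function.update A j x) ∈ W := by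
        intro x hx
        induction hx using Submodule.span_induction with
        | mem x hx =>
          refine ih _ (fun i hi => ?_) fun i hi => ?_
          · rw [Function.update_of_ne (by rintro rfl; exact hj hi)]
            exact h1 i (Finset.mem_insert_of_mem hi)
          · by_cases hij : i = j
            · subst hij
              rwa [Function.update_self]
            · rw [Function.update_of_ne hij]
              exact h2 i (by simp [hij, hi])
        | zero => rw [tens_update_zero]; exact W.zero_mem
        | add x y _ _ hx hy => rw [tens_update_add]; exact W.add_mem hx hy
        | smul t x _ hx => rw [tens_update_smul]; exact W.smul_mem t hx
      simpa using key (A j) (h1 j (Finset.mem_insert_self j T))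
  exact key Finset.univ A (fun i _ => hA i) (by simp)

variable [∀ i, Fintype (a i)] [∀ i, DecidableEq (a i)] [∀ i, Fintype (b i)]
  [∀ i, DecidableEq (b i)]

/-- Tensor products of Kraus operators are Kraus operators of the tensor product. -/
theorem isKrausFamily_tensor {Φ : ∀ i, Matrix (a i) (a i) ℂ →ₗ[ℂ] Matrix (b i) (b i) ℂ}
    {κ : Fin n → Type*} [∀ i, Fintype (κ i)] {V : ∀ i, κ i → Matrix (b i) (a i) ℂ}
    (hV : ∀ i, IsKrausFamily (Φ i) (V i)) :
    IsKrausFamily (tensor Φ) fun k : ∀ i, κ i => tens fun i => V i (k i) := by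
  constructor
  · intro X
    have h1 : ∀ i p q r s, Φ i (single p q 1) r s = ∑ k, V i k r p * star (V i k s q) := by
      intro i p q r s
      rw [(hV i).1, Matrix.sum_apply]
      refine Finset.sum_congr rfl fun k _ => ?_
      rw [Matrix.mul_apply, Finset.sum_eq_single q]
      · simp
      · intro x _ hx
        rw [Matrix.mul_single_apply_of_ne _ _ _ _ _ hx, zero_mul]
      · simp
    ext r s
    simp only [tensor, LinearMap.coe_mk, AddHom.coe_mk, Matrix.of_apply, h1,
      Finset.prod_univ_sum, Fintype.piFinset_univ, Matrix.sum_apply, Matrix.mul_apply,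
      tens_conjTranspose, tens_apply, conjTranspose_apply, Finset.mul_sum, Finset.sum_mul,
      Finset.prod_mul_distrib]
    calc _ = ∑ p, ∑ k : ∀ i, κ i, ∑ q,
          X p q * ((∏ i, V i (k i) (r i) (p i)) * ∏ i, star (V i (k i) (s i) (q i))) :=
          Finset.sum_congr rfl fun p _ => Finset.sum_comm
      _ = ∑ k : ∀ i, κ i, ∑ p, ∑ q,
          X p q * ((∏ i, V i (k i) (r i) (p i)) * ∏ i, star (V i (k i) (s i) (q i))) :=
          Finset.sum_comm
      _ = ∑ k : ∀ i, κ i, ∑ q, ∑ p,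
          X p q * ((∏ i, V i (k i) (r i) (p i)) * ∏ i, star (V i (k i) (s i) (q i))) :=
          Finset.sum_congr rfl fun k _ => Finset.sum_comm
      _ = _ := Finset.sum_congr rfl fun k _ => Finset.sum_congr rfl fun q _ =>
          Finset.sum_congr rfl fun p _ => by ring
  · simp only [tens_conjTranspose, tens_mul]
    rw [sum_tens fun i k => (V i k)ᴴ * V i k]
    simp only [(hV _).2, tens_one]

end Tens

/-! ### Noncommutative graphs and codes of tensor products -/

section Graph

open Matrix

theorem IsKraus.isKrausFamily {a b : Type*} [Fintype a] [DecidableEq a] [Fintype b]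
    [DecidableEq b] {Φ : Matrix a a ℂ →ₗ[ℂ] Matrix b b ℂ} {r : ℕ} {V : Fin r → Matrix b a ℂ}
    (h : IsKraus Φ V) : IsKrausFamily Φ V := h

/-- The graph is spanned by products over all Kraus representations; without any representation the
span of the empty set would be zero. -/
theorem exists_isKraus_of_ncGraph_ne_bot {a b : Type*} [Fintype a] [DecidableEq a] [Fintype b]
    [DecidableEq b] {Φ : Matrix a a ℂ →ₗ[ℂ] Matrix b b ℂ} (h : ncGraph Φ ≠ ⊥) :
    ∃ (r : ℕ) (V : Fin r → Matrix b a ℂ), IsKraus Φ V := by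
  by_contra hno
  push Not at hno
  refine h (Submodule.span_eq_bot.mpr ?_)
  rintro A ⟨r, V, k, l, hV, -⟩
  exact absurd hV (hno r V)

theorem mem_ncGraph {a b : Type*} [Fintype a] [DecidableEq a] [Fintype b]
    [DecidableEq b] {Φ : Matrix a a ℂ →ₗ[ℂ] Matrix b b ℂ} {r : ℕ} {V : Fin r → Matrix b a ℂ}
    (h : IsKraus Φ V) (k l : Fin r) : (V k)ᴴ * V l ∈ ncGraph Φ :=
  Submodule.subset_span ⟨r, V, k, l, h, rfl⟩

theorem IsCode.ncGraph_le {a b : Type*} [Fintype a] [DecidableEq a] [Fintype b]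
    [DecidableEq b] {Φ : Matrix a a ℂ →ₗ[ℂ] Matrix b b ℂ} {H₀ : Submodule ℂ (a → ℂ)}
    (h : IsCode Φ H₀) : ncGraph Φ ≤ klSpace H₀ := by
  refine Submodule.span_le.mpr ?_
  rintro A ⟨r, V, k, l, hV, rfl⟩
  exact h.mem_klSpace hV.isKrausFamily k l

variable {n : ℕ} {a b : Fin n → Type*} [∀ i, Fintype (a i)] [∀ i, DecidableEq (a i)]
  [∀ i, Fintype (b i)] [∀ i, DecidableEq (b i)]
  {Φ : ∀ i, Matrix (a i) (a i) ℂ →ₗ[ℂ] Matrix (b i) (b i) ℂ}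

/-- By multilinearity it is enough to treat generators `(V k)ᴴ * V l`. Their tensor product is again
of this form for the product Kraus family, and the representation may be chosen anew for each
generator. -/
theorem IsCode.tens_mem_klSpace {H₀ : Submodule ℂ ((∀ i, a i) → ℂ)} (h : IsCode (tensor Φ) H₀)
    {A : ∀ i, Matrix (a i) (a i) ℂ} (hA : ∀ i, A i ∈ ncGraph (Φ i)) :
    tens A ∈ klSpace H₀ := by
  refine tens_mem_of_mem_span (fun B hB => ?_) hA
  choose r V k l hV hB using hB
  have := h.mem_klSpace (isKrausFamily_tensor fun i => (hV i).isKrausFamily) k l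
  rw [tens_conjTranspose, tens_mul] at this
  convert this using 2
  exact funext hB

theorem isCode_tensor_of_isometry (hΦ : ∀ i, ncGraph (Φ i) ≠ ⊥) {d : Type*} [Fintype d]
    [DecidableEq d] [Nonempty d] {E : Matrix (∀ i, a i) d ℂ} (hE : Eᴴ * E = 1)
    {H₀ : Submodule ℂ ((∀ i, a i) → ℂ)} (hH : ∀ v ∈ H₀, ∃ w, v = E *ᵥ w)
    (hKL : ∀ A : ∀ i, Matrix (a i) (a i) ℂ, (∀ i, A i ∈ ncGraph (Φ i)) →
      ∃ c : ℂ, Eᴴ * tens A * E = c • 1) : IsCode (tensor Φ) H₀ := by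
  choose r V hV using fun i => exists_isKraus_of_ncGraph_ne_bot (hΦ i)
  refine (isKrausFamily_tensor fun i => (hV i).isKrausFamily).isCode hE hH fun k l => ?_
  rw [tens_conjTranspose, tens_mul]
  exact hKL _ fun i => mem_ncGraph (hV i) _ _

end Graph

/-! ### Capacity and orthonormal code pairs -/

section Capacity

open Matrix

variable {a b : Type*} [Fintype a] [DecidableEq a] [Fintype b] [DecidableEq b]
  {Φ : Matrix a a ℂ →ₗ[ℂ] Matrix b b ℂ}

theorem exists_orthonormal_of_le_finrank {H₀ : Submodule ℂ (a → ℂ)} {m : ℕ}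
    (h : m ≤ Module.finrank ℂ H₀) : ∃ v : Fin m → a → ℂ, (∀ i, v i ∈ H₀) ∧
      ∀ i j, star (v i) ⬝ᵥ v j = if i = j then 1 else 0 := by
  let e := (WithLp.linearEquiv 2 ℂ (a → ℂ))
  let H := H₀.comap (e : EuclideanSpace ℂ a →ₗ[ℂ] a → ℂ)
  have hH : Module.finrank ℂ H = Module.finrank ℂ H₀ := by
    have : H = H₀.map (e.symm : (a → ℂ) →ₗ[ℂ] EuclideanSpace ℂ a) :=
      Submodule.comap_equiv_eq_map_symm e H₀
    rw [this]
    exact LinearEquiv.finrank_map_eq e.symm H₀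
  let v := stdOrthonormalBasis ℂ H
  let g : Fin m → Fin (Module.finrank ℂ H) := Fin.castLE (by rw [hH]; exact h)
  refine ⟨fun i => e (v (g i)), fun i => (v (g i)).2, fun i j => ?_⟩
  have h1 := orthonormal_iff_ite.mp v.orthonormal (g i) (g j)
  have h2 : inner ℂ (v (g i)) (v (g j)) = star (e (v (g i))) ⬝ᵥ e (v (g j)) := by
    rw [Submodule.coe_inner, EuclideanSpace.inner_eq_star_dotProduct, dotProduct_comm]
    rfl
  rw [← h2, h1]
  simp [g]

theorem le_capacity {H₀ : Submodule ℂ (a → ℂ)} (h : IsCode Φ H₀) (hne : H₀ ≠ ⊥) :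
    ((Real.logb 2 (Module.finrank ℂ H₀ : ℝ) : ℝ) : EReal) ≤ capacity Φ :=
  le_iSup₂_of_le H₀ ⟨h, hne⟩ le_rfl

theorem capacity_le {m : ℕ} (h : ∀ H₀, IsCode Φ H₀ → Module.finrank ℂ H₀ ≤ m) :
    capacity Φ ≤ ((Real.logb 2 m : ℝ) : EReal) := by
  refine iSup₂_le fun H₀ hH => ?_
  rw [EReal.coe_le_coe_iff]
  have h1 : 0 < Module.finrank ℂ H₀ := by
    rw [Nat.pos_iff_ne_zero, Ne, Submodule.finrank_eq_zero]
    exact hH.2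
  exact Real.logb_le_logb_of_le (by norm_num) (by exact_mod_cast h1) (by exact_mod_cast h H₀ hH.1)

theorem capacity_pos {H₀ : Submodule ℂ (a → ℂ)} (h : IsCode Φ H₀)
    (hd : 1 < Module.finrank ℂ H₀) : 0 < capacity Φ := by
  refine lt_of_lt_of_le ?_ (le_capacity h ?_)
  · exact_mod_cast Real.logb_pos (by norm_num) (by exact_mod_cast hd)
  · rintro rfl
    simp at hd

theorem capacity_nonpos (h : ∀ H₀, IsCode Φ H₀ → Module.finrank ℂ H₀ ≤ 1) :
    capacity Φ ≤ 0 := by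
  simpa using capacity_le h

/-- One-dimensional subspaces are codes. -/
theorem capacity_nonneg [Nonempty a] {ι : Type*} [Fintype ι] {V : ι → Matrix b a ℂ}
    (hV : IsKrausFamily Φ V) : 0 ≤ capacity Φ := by
  obtain ⟨p⟩ := ‹Nonempty a›
  let E : Matrix a Unit ℂ := Matrix.of fun q _ => if q = p then 1 else 0
  have h1 : IsCode Φ (Submodule.span ℂ {Pi.single p (1 : ℂ)}) := by
    refine hV.isCode (E := E) ?_ ?_ ?_
    · ext i j
      simp [E, Matrix.mul_apply]
    · intro v hv
      obtain ⟨t, rfl⟩ := Submodule.mem_span_singleton.mp hv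
      refine ⟨fun _ => t, ?_⟩
      ext q
      simp [E, mulVec, dotProduct, Pi.single_apply]
    · intro k l
      refine ⟨(Eᴴ * ((V k)ᴴ * V l) * E) () (), ?_⟩
      ext i j
      simp
  have h2 : Module.finrank ℂ (Submodule.span ℂ {(Pi.single p (1 : ℂ) : a → ℂ)}) = 1 :=
    finrank_span_singleton (by simp)
  have h3 := le_capacity h1 (by simp)
  rw [h2] at h3
  simpa using h3

theorem capacity_eq_zero [Nonempty a] {ι : Type*} [Fintype ι] {V : ι → Matrix b a ℂ}
    (hV : IsKrausFamily Φ V) (h : ∀ H₀, IsCode Φ H₀ → Module.finrank ℂ H₀ ≤ 1) :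
    capacity Φ = 0 :=
  le_antisymm (capacity_nonpos h) (capacity_nonneg hV)

/-- Matrix elements in an orthonormal pair of a subspace with scalar compression. -/
theorem klSpace_pair {H₀ : Submodule ℂ (a → ℂ)} {A : Matrix a a ℂ} (hA : A ∈ klSpace H₀)
    {φ ψ : a → ℂ} (hφ : φ ∈ H₀) (hψ : ψ ∈ H₀) (h1 : star φ ⬝ᵥ φ = 1) (h2 : star ψ ⬝ᵥ ψ = 1)
    (h3 : star φ ⬝ᵥ ψ = 0) : star φ ⬝ᵥ A *ᵥ ψ = 0 ∧ star ψ ⬝ᵥ A *ᵥ φ = 0 ∧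
      star φ ⬝ᵥ A *ᵥ φ = star ψ ⬝ᵥ A *ᵥ ψ := by
  obtain ⟨c, hc⟩ := hA
  have h4 : star ψ ⬝ᵥ φ = 0 := by rw [← star_dotProduct_swap, h3, star_zero]
  exact ⟨by rw [hc φ hφ ψ hψ, h3, mul_zero], by rw [hc ψ hψ φ hφ, h4, mul_zero],
    by rw [hc φ hφ φ hφ, hc ψ hψ ψ hψ, h1, h2]⟩

/-- The matrix with two given columns. -/
def pairMatrix (φ ψ : a → ℂ) : Matrix a (Fin 2) ℂ := Matrix.of fun p i => ![φ, ψ] i p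

theorem pairMatrix_conj (φ ψ : a → ℂ) (A : Matrix a a ℂ) (i j : Fin 2) :
    ((pairMatrix φ ψ)ᴴ * A * pairMatrix φ ψ) i j = star (![φ, ψ] i) ⬝ᵥ A *ᵥ (![φ, ψ] j) := by
  rw [Matrix.mul_assoc, Matrix.mul_apply]
  rfl

theorem pairMatrix_conj_eq {φ ψ : a → ℂ} {A : Matrix a a ℂ} (h1 : star φ ⬝ᵥ A *ᵥ ψ = 0)
    (h2 : star ψ ⬝ᵥ A *ᵥ φ = 0) (h3 : star φ ⬝ᵥ A *ᵥ φ = star ψ ⬝ᵥ A *ᵥ ψ) :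
    (pairMatrix φ ψ)ᴴ * A * pairMatrix φ ψ = (star φ ⬝ᵥ A *ᵥ φ) • 1 := by
  ext i j
  rw [pairMatrix_conj]
  fin_cases i <;> fin_cases j <;> simp [h1, h2, h3]

theorem pairMatrix_isometry {φ ψ : a → ℂ} (h1 : star φ ⬝ᵥ φ = 1) (h2 : star ψ ⬝ᵥ ψ = 1)
    (h3 : star φ ⬝ᵥ ψ = 0) : (pairMatrix φ ψ)ᴴ * pairMatrix φ ψ = 1 := by
  have h4 : star ψ ⬝ᵥ φ = 0 := by rw [← star_dotProduct_swap, h3, star_zero]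
  have := pairMatrix_conj_eq (A := 1) (φ := φ) (ψ := ψ) (by simpa using h3) (by simpa using h4)
    (by simp [h1, h2])
  simpa [h1] using this

theorem exists_mulVec_pairMatrix {φ ψ v : a → ℂ} (hv : v ∈ Submodule.span ℂ {φ, ψ}) :
    ∃ w, v = pairMatrix φ ψ *ᵥ w := by
  obtain ⟨s, t, rfl⟩ := Submodule.mem_span_pair.mp hv
  refine ⟨![s, t], ?_⟩
  ext p
  simp [pairMatrix, mulVec, dotProduct, Fin.sum_univ_two, mul_comm]

theorem finrank_span_pair {φ ψ : a → ℂ} (h1 : star φ ⬝ᵥ φ = 1) (h2 : star ψ ⬝ᵥ ψ = 1)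
    (h3 : star φ ⬝ᵥ ψ = 0) : Module.finrank ℂ (Submodule.span ℂ {φ, ψ}) = 2 := by
  have h4 : star ψ ⬝ᵥ φ = 0 := by rw [← star_dotProduct_swap, h3, star_zero]
  have hli : LinearIndependent ℂ ![φ, ψ] := by
    rw [LinearIndependent.pair_iff]
    intro s t hst
    have e1 := congrArg (fun x => star φ ⬝ᵥ x) hst
    have e2 := congrArg (fun x => star ψ ⬝ᵥ x) hst
    simp only [dotProduct_add, dotProduct_smul, h1, h2, h3, h4, smul_eq_mul, dotProduct_zero,
      mul_one, mul_zero, add_zero, zero_add] at e1 e2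
    exact ⟨e1, e2⟩
  have := finrank_span_eq_card hli
  rwa [Matrix.range_cons_cons_empty, Fintype.card_fin] at this

end Capacity

/-! ### Code pairs in ℂ² ⊗ ℂ^E -/

section Blocks

open Matrix ComplexConjugate

theorem mul_star_add_mul_star_ne_zero {s t : ℂ} (hst : s ≠ 0 ∨ t ≠ 0) :
    s * star s + t * star t ≠ 0 := by
  have e : s * star s + t * star t = ((Complex.normSq s + Complex.normSq t : ℝ) : ℂ) := by
    push_cast
    rw [← Complex.mul_conj, ← Complex.mul_conj]
    rfl
  rw [e, Complex.ofReal_ne_zero]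
  have := Complex.normSq_nonneg s
  have := Complex.normSq_nonneg t
  rcases hst with h | h
  · have := Complex.normSq_pos.mpr h
    positivity
  · have := Complex.normSq_pos.mpr h
    positivity

/-- Two vectors of `ℂ² ⊗ ℂ^E` that satisfy the Knill–Laflamme conditions for all `1 ⊗ A` span a
subspace of the form `ℂ² ⊗ u`. -/
theorem exists_product_form {E : Type*} {x y z w : E → ℂ}
    (h1 : ∀ i j, z i * star (x j) + w i * star (y j) = 0)
    (h2 : ∀ i j, x i * star (x j) + y i * star (y j) = z i * star (z j) + w i * star (w j))
    (h3 : x ≠ 0 ∨ y ≠ 0) : ∃ (p q ω : ℂ) (u : E → ℂ), (p ≠ 0 ∨ q ≠ 0) ∧ u ≠ 0 ∧ ω ≠ 0 ∧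
      x = p • u ∧ y = q • u ∧ z = (-star q * ω) • u ∧ w = (star p * ω) • u := by
  obtain ⟨j, hj⟩ : ∃ j, x j ≠ 0 ∨ y j ≠ 0 := by
    rcases h3 with h | h
    · exact (Function.ne_iff.mp h).imp fun j hj => Or.inl hj
    · exact (Function.ne_iff.mp h).imp fun j hj => Or.inr hj
  obtain ⟨p, hp⟩ : ∃ p, p = x j := ⟨_, rfl⟩
  obtain ⟨q, hq⟩ : ∃ q, q = y j := ⟨_, rfl⟩
  rw [← hp, ← hq] at hj
  have hN := mul_star_add_mul_star_ne_zero hj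
  set N := p * star p + q * star q with hNdef
  -- With `j` fixed, `h1` says that `(z i, w i)` is orthogonal to `(p, q)` for every `i`, hence a
  -- multiple `v i` of `(-star q, star p)`.
  let v : E → ℂ := fun i => (p * w i - q * z i) / N
  have hj1 : ∀ i, z i * star p + w i * star q = 0 := fun i => by rw [hp, hq]; exact h1 i j
  have hz : ∀ i, z i = -star q * v i := by
    intro i
    simp only [v]
    field_simp
    rw [hNdef]
    linear_combination (p) * hj1 i
  have hw : ∀ i, w i = star p * v i := by
    intro i
    simp only [v]
    field_simp
    rw [hNdef]
    linear_combination (q) * hj1 i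
  obtain ⟨k, hk⟩ : ∃ k, v k ≠ 0 := by
    by_contra! hv
    have := h2 j j
    simp only [hz, hw, hv, mul_zero, star_zero, add_zero, ← hp, ← hq] at this
    exact hN this
  -- Since v does not vanish, `h1` read in the other index makes every `(x i, y i)` proportional to
  -- `(p, q)`.
  have hxy : ∀ i, q * x i = p * y i := by
    intro i
    have h4 := h1 k i
    rw [hz, hw] at h4
    have h5 : star (q * x i) = star (p * y i) := by
      rw [star_mul', star_mul']
      have : v k * (star p * star (y i) - star q * star (x i)) = 0 := by linear_combination h4
      have := (mul_eq_zero.mp this).resolve_left hk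
      linear_combination -this
    exact star_injective h5
  let u : E → ℂ := fun i => (star p * x i + star q * y i) / N
  have hx : ∀ i, x i = p * u i := by
    intro i
    simp only [u]
    field_simp
    rw [hNdef]
    linear_combination (star q) * hxy i
  have hy : ∀ i, y i = q * u i := by
    intro i
    simp only [u]
    field_simp
    rw [hNdef]
    linear_combination -(star p) * hxy i
  -- `h2` equates the rank-one matrices of u and v, so v is a scalar multiple of u; that scalar is
  -- ω.
  have huv : ∀ i j, u i * star (u j) = v i * star (v j) := by
    intro i l
    have := h2 i l
    rw [hx, hy, hz, hw, hx, hy, hz, hw] at this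
    simp only [star_mul', star_neg, star_star] at this
    have h6 : N * (u i * star (u l) - v i * star (v l)) = 0 := by
      rw [hNdef]
      linear_combination this
    exact sub_eq_zero.mp ((mul_eq_zero.mp h6).resolve_left hN)
  have huk : u k ≠ 0 := by
    intro h0
    have := huv k k
    rw [h0, zero_mul] at this
    exact hk (by simpa using this.symm)
  have hvk : star (v k) ≠ 0 := by simpa using hk
  refine ⟨p, q, star (u k) / star (v k), u, hj, fun h => huk (congrFun h k),
    div_ne_zero (by simpa using huk) hvk, funext hx, funext hy, ?_, ?_⟩
  · ext i
    have e : star (u k) / star (v k) * u i = v i := by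
      rw [div_mul_eq_mul_div, mul_comm, huv, mul_div_cancel_right₀ _ hvk]
    rw [Pi.smul_apply, smul_eq_mul, mul_assoc, e, hz]
  · ext i
    have e : star (u k) / star (v k) * u i = v i := by
      rw [div_mul_eq_mul_div, mul_comm, huv, mul_div_cancel_right₀ _ hvk]
    rw [Pi.smul_apply, smul_eq_mul, mul_assoc, e, hw]

/-- Vectors as in `exists_product_form` cannot satisfy the orthogonality conditions for
off-diagonal blocks without isotropic vectors. -/
theorem no_code_of_offDiag {E : Type*} [Fintype E] {x y z w : E → ℂ}
    (h1 : ∀ i j, z i * star (x j) + w i * star (y j) = 0)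
    (h2 : ∀ i j, x i * star (x j) + y i * star (y j) = z i * star (z j) + w i * star (w j))
    (h3 : x ≠ 0 ∨ y ≠ 0) {B C : Matrix E E ℂ} (hB : ∀ u, u ≠ 0 → star u ⬝ᵥ B *ᵥ u ≠ 0)
    (hC : ∀ u, u ≠ 0 → star u ⬝ᵥ C *ᵥ u ≠ 0)
    (hxw : star x ⬝ᵥ B *ᵥ w = 0) (hyz : star y ⬝ᵥ C *ᵥ z = 0) : False := by
  obtain ⟨p, q, ω, u, hpq, hu, hω, rfl, rfl, rfl, rfl⟩ := exists_product_form h1 h2 h3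
  -- The two conditions become `(star p)² ω ⟨u, B u⟩ = 0` and `-(star q)² ω ⟨u, C u⟩ = 0`, so p and
  -- q both vanish.
  simp only [star_smul, mulVec_smul, smul_dotProduct, dotProduct_smul, smul_eq_mul,
    mul_eq_zero, hB u hu, hC u hu, hω, neg_eq_zero, star_eq_zero, or_false, or_self] at hxw hyz
  tauto

end Blocks

/-! ### The space 𝔑_θ and a single channel -/

section GraphN

open Matrix

/-- The phase `exp(iθ/2)`. -/
noncomputable def halfPhase (θ : ℝ) : ℂ := Complex.exp ((θ / 2 : ℝ) * Complex.I)

theorem star_halfPhase (θ : ℝ) :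
    star (halfPhase θ) = Complex.exp (-((θ / 2 : ℝ) * Complex.I)) := by
  rw [halfPhase, Complex.star_def, ← Complex.exp_conj, map_mul, Complex.conj_ofReal,
    Complex.conj_I, mul_neg]

theorem halfPhase_mul_star (θ : ℝ) : halfPhase θ * star (halfPhase θ) = 1 := by
  rw [star_halfPhase, halfPhase, ← Complex.exp_add]
  simp

theorem halfPhase_mul_self (θ : ℝ) : halfPhase θ * halfPhase θ = Complex.exp (θ * Complex.I) := by
  rw [halfPhase, ← Complex.exp_add]
  congr 1
  push_cast
  ring

theorem halfPhase_re (θ : ℝ) : (halfPhase θ).re = Real.cos (θ / 2) := by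
  rw [halfPhase, Complex.exp_ofReal_mul_I_re]

/-- Rescaling the parameters `e` and `g` by a half phase replaces the phases 1, γ̄ and 1, γ by
conjugate pairs δ, δ̄ of equal real part, which makes positivity arguments available. -/
theorem mem_graphN_of_halfPhase (θ : ℝ) (a b c d e f g h : ℂ) :
    !![a, b, halfPhase θ * e, f;
       c, d, f, star (halfPhase θ) * e;
       star (halfPhase θ) * g, h, a, b;
       h, halfPhase θ * g, c, d] ∈ graphN θ := by
  refine ⟨a, b, c, d, halfPhase θ * e, f, star (halfPhase θ) * g, h, ?_⟩
  have h1 := halfPhase_mul_star θ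
  rw [← halfPhase_mul_self, star_mul']
  have e1 : star (halfPhase θ) * e =
      star (halfPhase θ) * star (halfPhase θ) * (halfPhase θ * e) := by
    linear_combination (-(star (halfPhase θ) * e)) * h1
  have e2 : halfPhase θ * g = halfPhase θ * halfPhase θ * (star (halfPhase θ) * g) := by
    linear_combination (-(halfPhase θ * g)) * h1
  rw [e1, e2]

theorem graphN_ne_bot (θ : ℝ) : graphN θ ≠ ⊥ := by
  intro h
  have := mem_graphN_of_halfPhase θ 1 0 0 0 0 0 0 0
  rw [h, Submodule.mem_bot] at this
  have := congrFun (congrFun this 0) 0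
  simp at this

/-- The real part is cos(θ/2)(|u₀|² + |u₁|²), and cos(θ/2) > 0 for |θ| < π. -/
theorem star_dotProduct_diag_ne_zero {θ : ℝ} (hθ : |θ| < Real.pi) {u : Fin 2 → ℂ} (hu : u ≠ 0) :
    halfPhase θ * (star (u 0) * u 0) + star (halfPhase θ) * (star (u 1) * u 1) ≠ 0 := by
  intro h
  have hc : 0 < Real.cos (θ / 2) := by
    have := abs_lt.mp hθ
    exact Real.cos_pos_of_mem_Ioo ⟨by linarith, by linarith⟩
  have h1 := congrArg Complex.re h
  have h2 : ∀ z : ℂ, star z * z = (Complex.normSq z : ℂ) := fun z => by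
    rw [mul_comm]
    exact Complex.mul_conj z
  rw [h2, h2, Complex.add_re, Complex.re_mul_ofReal, Complex.re_mul_ofReal, Complex.star_def,
    Complex.conj_re, halfPhase_re, ← mul_add, Complex.zero_re] at h1
  have h3 := (mul_eq_zero.mp h1).resolve_left hc.ne'
  have h4 := Complex.normSq_nonneg (u 0)
  have h5 := Complex.normSq_nonneg (u 1)
  refine hu (funext fun i => ?_)
  fin_cases i
  · have : Complex.normSq (u 0) = 0 := by linarith
    exact Complex.normSq_eq_zero.mp this
  · have : Complex.normSq (u 1) = 0 := by linarith
    exact Complex.normSq_eq_zero.mp this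

theorem diagonal_halfPhase_ne_zero {θ : ℝ} (hθ : |θ| < Real.pi) {u : Fin 2 → ℂ} (hu : u ≠ 0) :
    star u ⬝ᵥ diagonal ![halfPhase θ, star (halfPhase θ)] *ᵥ u ≠ 0 := by
  have := star_dotProduct_diag_ne_zero hθ hu
  intro h
  refine this ?_
  rw [← h]
  simp [dotProduct, mulVec_diagonal, Fin.sum_univ_two, mul_left_comm]

theorem diagonal_star_halfPhase_ne_zero {θ : ℝ} (hθ : |θ| < Real.pi) {u : Fin 2 → ℂ}
    (hu : u ≠ 0) : star u ⬝ᵥ diagonal ![star (halfPhase θ), halfPhase θ] *ᵥ u ≠ 0 := by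
  intro h
  refine diagonal_halfPhase_ne_zero hθ hu ?_
  have := congrArg star h
  simp only [dotProduct, mulVec_diagonal, Fin.sum_univ_two, star_add, star_mul', star_zero] at this ⊢
  simp only [Pi.star_apply, star_star, cons_val_zero, cons_val_one] at this ⊢
  linear_combination this

/-- The conditions imposed on a pair of vectors by the diagonal blocks of `𝔑_θ`. -/
theorem graphN_pair_diag {θ : ℝ} {φ ψ : Fin 4 → ℂ}
    (h : ∀ A ∈ graphN θ, star φ ⬝ᵥ A *ᵥ ψ = 0 ∧ star φ ⬝ᵥ A *ᵥ φ = star ψ ⬝ᵥ A *ᵥ ψ) :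
    (∀ i j, ![ψ 0, ψ 1] i * star (![φ 0, φ 1] j) + ![ψ 2, ψ 3] i * star (![φ 2, φ 3] j) = 0) ∧
    (∀ i j, ![φ 0, φ 1] i * star (![φ 0, φ 1] j) + ![φ 2, φ 3] i * star (![φ 2, φ 3] j) =
      ![ψ 0, ψ 1] i * star (![ψ 0, ψ 1] j) + ![ψ 2, ψ 3] i * star (![ψ 2, ψ 3] j)) := by
  have ha := h _ (mem_graphN_of_halfPhase θ 1 0 0 0 0 0 0 0)
  have hb := h _ (mem_graphN_of_halfPhase θ 0 1 0 0 0 0 0 0)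
  have hc := h _ (mem_graphN_of_halfPhase θ 0 0 1 0 0 0 0 0)
  have hd := h _ (mem_graphN_of_halfPhase θ 0 0 0 1 0 0 0 0)
  simp [dotProduct, mulVec, Fin.sum_univ_four] at ha hb hc hd
  obtain ⟨ha1, ha2⟩ := ha
  obtain ⟨hb1, hb2⟩ := hb
  obtain ⟨hc1, hc2⟩ := hc
  obtain ⟨hd1, hd2⟩ := hd
  constructor
  · intro i j
    fin_cases i <;> fin_cases j <;> simp
    · linear_combination ha1
    · linear_combination hc1
    · linear_combination hb1
    · linear_combination hd1
  · intro i j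
    fin_cases i <;> fin_cases j <;> simp
    · linear_combination ha2
    · linear_combination hc2
    · linear_combination hb2
    · linear_combination hd2

theorem graphN_pair_nonzero {φ : Fin 4 → ℂ} (h : star φ ⬝ᵥ φ = 1) :
    ![φ 0, φ 1] ≠ 0 ∨ ![φ 2, φ 3] ≠ 0 := by
  by_contra! h0
  have h1 := congrFun h0.1 0
  have h2 := congrFun h0.1 1
  have h3 := congrFun h0.2 0
  have h4 := congrFun h0.2 1
  simp at h1 h2 h3 h4
  simp [dotProduct, Fin.sum_univ_four, h1, h2, h3, h4] at h

theorem graphN_no_pair {θ : ℝ} (hθ : |θ| < Real.pi) {φ ψ : Fin 4 → ℂ} (hφ : star φ ⬝ᵥ φ = 1)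
    (h : ∀ A ∈ graphN θ, star φ ⬝ᵥ A *ᵥ ψ = 0 ∧ star φ ⬝ᵥ A *ᵥ φ = star ψ ⬝ᵥ A *ᵥ ψ) :
    False := by
  obtain ⟨h1, h2⟩ := graphN_pair_diag h
  have he := (h _ (mem_graphN_of_halfPhase θ 0 0 0 0 1 0 0 0)).1
  have hg := (h _ (mem_graphN_of_halfPhase θ 0 0 0 0 0 0 1 0)).1
  refine no_code_of_offDiag h1 h2 (graphN_pair_nonzero hφ)
    (fun u hu => diagonal_halfPhase_ne_zero hθ hu)
    (fun u hu => diagonal_star_halfPhase_ne_zero hθ hu) ?_ ?_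
  · rw [← he]
    simp [dotProduct, mulVec, Fin.sum_univ_four, Fin.sum_univ_two, diagonal]
  · rw [← hg]
    simp [dotProduct, mulVec, Fin.sum_univ_four, Fin.sum_univ_two, diagonal]

/-- Both pairs share φ = (p, q) ⊗ u, so ψ and χ both lie on the line of (-q̄, p̄) ⊗ u and cannot be
orthogonal. Only the diagonal blocks of the graph are used, whence no restriction on θ. -/
theorem graphN_no_triple {θ : ℝ} {φ ψ χ : Fin 4 → ℂ} (hφ : star φ ⬝ᵥ φ = 1)
    (hψχ : star ψ ⬝ᵥ χ = 0)
    (h : ∀ A ∈ graphN θ, star φ ⬝ᵥ A *ᵥ ψ = 0 ∧ star φ ⬝ᵥ A *ᵥ φ = star ψ ⬝ᵥ A *ᵥ ψ)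
    (h' : ∀ A ∈ graphN θ, star φ ⬝ᵥ A *ᵥ χ = 0 ∧ star φ ⬝ᵥ A *ᵥ φ = star χ ⬝ᵥ A *ᵥ χ) :
    False := by
  obtain ⟨h1, h2⟩ := graphN_pair_diag h
  obtain ⟨h1', h2'⟩ := graphN_pair_diag h'
  obtain ⟨p, q, ω, u, hpq, hu, hω, hx, hy, hz, hw⟩ :=
    exists_product_form h1 h2 (graphN_pair_nonzero hφ)
  obtain ⟨p', q', ω', u', hpq', hu', hω', hx', hy', hz', hw'⟩ :=
    exists_product_form h1' h2' (graphN_pair_nonzero hφ)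
  rw [hx] at hx'
  rw [hy] at hy'
  have hdot : star ψ ⬝ᵥ χ = star ![ψ 0, ψ 1] ⬝ᵥ ![χ 0, χ 1] + star ![ψ 2, ψ 3] ⬝ᵥ ![χ 2, χ 3] := by
    simp [dotProduct, Fin.sum_univ_four, Fin.sum_univ_two]
    ring
  have huu : star u ⬝ᵥ u ≠ 0 := fun h => hu (eq_zero_of_star_dotProduct_self h)
  obtain ⟨s, hs⟩ : ∃ s : ℂ, u' = s • u := by
    rcases hpq' with h0 | h0
    · exact ⟨p'⁻¹ * p, by rw [mul_smul, hx', smul_smul, inv_mul_cancel₀ h0, one_smul]⟩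
    · exact ⟨q'⁻¹ * q, by rw [mul_smul, hy', smul_smul, inv_mul_cancel₀ h0, one_smul]⟩
  have hs0 : s ≠ 0 := by
    rintro rfl
    exact hu' (by simpa using hs)
  have hscal : ∀ t t' : ℂ, t • u = t' • u → t = t' := fun t t' h =>
    smul_left_injective ℂ hu h
  rw [hs, smul_smul] at hx' hy'
  have hp := hscal _ _ hx'
  have hq := hscal _ _ hy'
  rw [hdot, hz, hw, hz', hw', hs] at hψχ
  simp only [star_smul, smul_dotProduct, dotProduct_smul, smul_eq_mul, star_mul', star_neg,
    star_star] at hψχ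
  have e : (p' * star p' + q' * star q') * (star ω * ω' * s * s * (star u ⬝ᵥ u)) = 0 := by
    rw [hp, hq] at hψχ
    linear_combination hψχ
  have hN : p' * star p' + q' * star q' ≠ 0 := mul_star_add_mul_star_ne_zero hpq'
  refine mul_ne_zero hN ?_ e
  exact mul_ne_zero (mul_ne_zero (mul_ne_zero (mul_ne_zero (star_ne_zero.mpr hω) hω') hs0) hs0) huu

end GraphN

/-! ### Superpositions of two basis vectors with relative phase i -/

section PairVec

open Matrix

variable {a : Type*} [Fintype a] [DecidableEq a]

/-- The vector `(|x⟩ + i |y⟩) / √2`. -/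
noncomputable def pairVec (x y : a) : a → ℂ :=
  (1 / (Real.sqrt 2 : ℂ)) • (Pi.single x (1 : ℂ) + Complex.I • Pi.single y (1 : ℂ))

/-- The cross terms carry the opposite factors i and -i, so they cancel whenever `M x y'` and `M y
x'` agree, as the entries `f` and `h` of the graph do. -/
theorem pairVec_sesq (M : Matrix a a ℂ) (x y x' y' : a) :
    star (pairVec x y) ⬝ᵥ M *ᵥ pairVec x' y' =
      (M x x' + Complex.I * M x y' - Complex.I * M y x' + M y y') / 2 := by
  have hs : ((1 / (Real.sqrt 2 : ℂ)) * (1 / (Real.sqrt 2 : ℂ))) = 1 / 2 := by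
    rw [div_mul_div_comm, one_mul, ← Complex.ofReal_mul, Real.mul_self_sqrt (by norm_num)]
    norm_num
  have hst : star (1 / (Real.sqrt 2 : ℂ)) = 1 / (Real.sqrt 2 : ℂ) := by
    simp
  have hsing : ∀ z : a, star (Pi.single z (1 : ℂ) : a → ℂ) = Pi.single z (1 : ℂ) := by
    intro z
    ext w
    simp [Pi.single_apply, apply_ite]
  simp only [pairVec, star_smul, star_add, hsing, hst, mulVec_smul, mulVec_add,
    mulVec_single_one, smul_dotProduct, dotProduct_smul, add_dotProduct, dotProduct_add,
    single_one_dotProduct, smul_eq_mul, Complex.star_def, Complex.conj_I, col_apply]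
  linear_combination (M x x' + Complex.I * M x y' - Complex.I * M y x' -
    Complex.I * Complex.I * M y y') * hs - (1 / 2 * M y y') * Complex.I_mul_I

theorem pairVec_self {x y : a} (h : x ≠ y) : star (pairVec x y) ⬝ᵥ pairVec x y = 1 := by
  have := pairVec_sesq (1 : Matrix a a ℂ) x y x y
  rw [one_mulVec] at this
  rw [this]
  simp [one_apply, h, h.symm]

theorem pairVec_orthogonal {x y x' y' : a} (h1 : x ≠ x') (h2 : x ≠ y') (h3 : y ≠ x')
    (h4 : y ≠ y') : star (pairVec x y) ⬝ᵥ pairVec x' y' = 0 := by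
  have := pairVec_sesq (1 : Matrix a a ℂ) x y x' y'
  rw [one_mulVec] at this
  rw [this]
  simp [one_apply, h1, h2, h3, h4]

end PairVec

/-! ### The capacity of one channel -/

section PartA

open Matrix

theorem graphN_pi_conj {A : Matrix (Fin 4) (Fin 4) ℂ} (hA : A ∈ graphN Real.pi) :
    ∃ c : ℂ, (pairMatrix (pairVec (0 : Fin 4) 1) (pairVec 2 3))ᴴ * A *
      pairMatrix (pairVec (0 : Fin 4) 1) (pairVec 2 3) = c • 1 := by
  obtain ⟨a, b, c, d, e, f, g, h, rfl⟩ := hA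
  refine ⟨_, pairMatrix_conj_eq ?_ ?_ ?_⟩
  · rw [pairVec_sesq]
    simp [Complex.exp_pi_mul_I]
  · rw [pairVec_sesq]
    simp [Complex.exp_pi_mul_I]
  · rw [pairVec_sesq, pairVec_sesq]
    simp

theorem capacity_single {b : Type*} [Fintype b] [DecidableEq b]
    {Φ : Matrix (Fin 4) (Fin 4) ℂ →ₗ[ℂ] Matrix b b ℂ} {θ : ℝ}
    (hθ : θ ∈ Set.Ioc (-Real.pi) Real.pi) (hΦ : ncGraph Φ = graphN θ) :
    (0 < capacity Φ ↔ θ = Real.pi) ∧ (θ = Real.pi → capacity Φ = 1) := by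
  have hV := exists_isKraus_of_ncGraph_ne_bot (Φ := Φ) (by rw [hΦ]; exact graphN_ne_bot θ)
  obtain ⟨r, V, hV⟩ := hV
  have key : ∀ H₀, IsCode Φ H₀ → ∀ φ ∈ H₀, ∀ ψ ∈ H₀, star φ ⬝ᵥ φ = 1 → star ψ ⬝ᵥ ψ = 1 →
      star φ ⬝ᵥ ψ = 0 → ∀ A ∈ graphN θ,
        star φ ⬝ᵥ A *ᵥ ψ = 0 ∧ star φ ⬝ᵥ A *ᵥ φ = star ψ ⬝ᵥ A *ᵥ ψ := by
    intro H₀ hH φ hφ ψ hψ h1 h2 h3 A hA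
    obtain ⟨e1, -, e2⟩ := klSpace_pair (hH.ncGraph_le (hΦ ▸ hA)) hφ hψ h1 h2 h3
    exact ⟨e1, e2⟩
  have h1 : θ = Real.pi → capacity Φ = 1 := by
    rintro rfl
    have ho1 : star (pairVec (0 : Fin 4) 1) ⬝ᵥ pairVec 0 1 = 1 := pairVec_self (by decide)
    have ho2 : star (pairVec (2 : Fin 4) 3) ⬝ᵥ pairVec 2 3 = 1 := pairVec_self (by decide)
    have ho3 : star (pairVec (0 : Fin 4) 1) ⬝ᵥ pairVec 2 3 = 0 :=
      pairVec_orthogonal (by decide) (by decide) (by decide) (by decide)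
    have hcode : IsCode Φ (Submodule.span ℂ {pairVec (0 : Fin 4) 1, pairVec 2 3}) :=
      hV.isKrausFamily.isCode (pairMatrix_isometry ho1 ho2 ho3)
        (fun v hv => exists_mulVec_pairMatrix hv)
        fun k l => graphN_pi_conj (hΦ ▸ mem_ncGraph hV k l)
    have hrank := finrank_span_pair ho1 ho2 ho3
    have hlog : (Real.logb 2 ((2 : ℕ) : ℝ)) = 1 := by norm_num
    refine le_antisymm ?_ ?_
    · have := capacity_le (Φ := Φ) (m := 2) ?_
      · rw [hlog] at this
        exact_mod_cast this
      intro H₀ hH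
      by_contra! hlt
      obtain ⟨v, hv, ho⟩ := exists_orthonormal_of_le_finrank (m := 3) hlt
      exact graphN_no_triple (φ := v 0) (ψ := v 1) (χ := v 2) (by simp [ho]) (by simp [ho])
        (key H₀ hH _ (hv 0) _ (hv 1) (by simp [ho]) (by simp [ho]) (by simp [ho]))
        (key H₀ hH _ (hv 0) _ (hv 2) (by simp [ho]) (by simp [ho]) (by simp [ho]))
    · have := le_capacity hcode (by
        intro h
        rw [h] at hrank
        simp at hrank)
      rw [hrank, hlog] at this
      exact_mod_cast this
  refine ⟨⟨fun hpos => ?_, fun h => ?_⟩, h1⟩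
  · by_contra hne
    have habs : |θ| < Real.pi := abs_lt.mpr ⟨hθ.1, lt_of_le_of_ne hθ.2 hne⟩
    refine absurd hpos (not_lt.mpr (capacity_nonpos fun H₀ hH => ?_))
    by_contra! hlt
    obtain ⟨v, hv, ho⟩ := exists_orthonormal_of_le_finrank (m := 2) hlt
    exact graphN_no_pair habs (φ := v 0) (ψ := v 1) (by simp [ho])
      (key H₀ hH _ (hv 0) _ (hv 1) (by simp [ho]) (by simp [ho]) (by simp [ho]))
  · rw [h1 h]
    exact zero_lt_one

end PartA

/-! ### The entangled code for phases with product -1 -/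

section PartB

open Matrix

theorem codeVec_eq_pairVec (n : ℕ) (j k : Fin 4) :
    codeVec n j k = pairVec (fun _ => j) fun _ => k := rfl

/-- The Knill–Laflamme conditions for the code spanned by `codeVec n 0 1` and `codeVec n 2 3`. -/
theorem tens_graphN_conj {n : ℕ} {θ : Fin n → ℝ}
    (hθ : ∃ k : ℤ, ∑ i, θ i = Real.pi + k * (2 * Real.pi))
    {A : Fin n → Matrix (Fin 4) (Fin 4) ℂ} (hA : ∀ i, A i ∈ graphN (θ i)) :
    ∃ c : ℂ, (pairMatrix (codeVec n 0 1) (codeVec n 2 3))ᴴ * tens A *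
      pairMatrix (codeVec n 0 1) (codeVec n 2 3) = c • 1 := by
  choose a b c d e f g h hA using hA
  -- The off-diagonal elements reduce to `∏ e i` plus the product of the `star γ i * e i`, and
  -- likewise for `g`; each sum vanishes exactly because the phases multiply to -1.
  have hprod : ∏ i, Complex.exp (θ i * Complex.I) = -1 := by
    obtain ⟨k, hk⟩ := hθ
    rw [← Complex.exp_sum, ← Finset.sum_mul, ← Complex.ofReal_sum, hk]
    push_cast
    rw [add_mul, Complex.exp_add, Complex.exp_pi_mul_I]
    have : (k : ℂ) * (2 * Real.pi) * Complex.I = k * (2 * Real.pi * Complex.I) := by ring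
    rw [this, Complex.exp_int_mul_two_pi_mul_I, mul_one]
  have hprod' : ∏ i, star (Complex.exp (θ i * Complex.I)) = -1 := by
    rw [← star_prod, hprod]
    simp
  refine ⟨_, pairMatrix_conj_eq ?_ ?_ ?_⟩
  · rw [codeVec_eq_pairVec, codeVec_eq_pairVec, pairVec_sesq]
    simp only [tens_apply, hA]
    simp only [of_apply, cons_val, Finset.prod_mul_distrib, hprod']
    ring
  · rw [codeVec_eq_pairVec, codeVec_eq_pairVec, pairVec_sesq]
    simp only [tens_apply, hA]
    simp only [of_apply, cons_val, Finset.prod_mul_distrib, hprod]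
    ring
  · rw [codeVec_eq_pairVec, codeVec_eq_pairVec, pairVec_sesq, pairVec_sesq]
    simp only [tens_apply, hA]
    simp only [of_apply, cons_val]

theorem isCode_codeVec {n : ℕ} {θ : Fin n → ℝ} {b : Fin n → Type*} [∀ i, Fintype (b i)]
    [∀ i, DecidableEq (b i)] {Φ : ∀ i, Matrix (Fin 4) (Fin 4) ℂ →ₗ[ℂ] Matrix (b i) (b i) ℂ}
    (hΦ : ∀ i, ncGraph (Φ i) = graphN (θ i))
    (hθ : ∃ k : ℤ, ∑ i, θ i = Real.pi + k * (2 * Real.pi)) :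
    0 < capacity (tensor Φ) ∧
      IsCode (tensor Φ) (Submodule.span ℂ {codeVec n 0 1, codeVec n 2 3}) ∧
      Module.finrank ℂ (Submodule.span ℂ {codeVec n 0 1, codeVec n 2 3}) = 2 := by
  -- The case `n = 0` contradicts `hθ`: an empty sum is not an odd multiple of π. With a factor
  -- present the four constant indices are distinct.
  have hn : Nonempty (Fin n) := by
    by_contra hn
    rw [not_nonempty_iff] at hn
    obtain ⟨k, hk⟩ := hθ
    rw [Finset.univ_eq_empty, Finset.sum_empty] at hk
    have h1 : Real.pi * (1 + 2 * k) = 0 := by linarith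
    have h2 := (mul_eq_zero.mp h1).resolve_left Real.pi_ne_zero
    have h3 : (1 + 2 * k : ℤ) = 0 := by exact_mod_cast h2
    omega
  have hc : ∀ j k : Fin 4, j ≠ k → (fun _ : Fin n => j) ≠ fun _ => k := fun j k hjk h =>
    hjk (congrFun h hn.some)
  have ho1 : star (codeVec n 0 1) ⬝ᵥ codeVec n 0 1 = 1 := pairVec_self (hc _ _ (by decide))
  have ho2 : star (codeVec n 2 3) ⬝ᵥ codeVec n 2 3 = 1 := pairVec_self (hc _ _ (by decide))
  have ho3 : star (codeVec n 0 1) ⬝ᵥ codeVec n 2 3 = 0 :=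
    pairVec_orthogonal (hc _ _ (by decide)) (hc _ _ (by decide)) (hc _ _ (by decide))
      (hc _ _ (by decide))
  have hcode : IsCode (tensor Φ) (Submodule.span ℂ {codeVec n 0 1, codeVec n 2 3}) :=
    isCode_tensor_of_isometry (fun i => by rw [hΦ]; exact graphN_ne_bot _)
      (pairMatrix_isometry ho1 ho2 ho3) (fun v hv => exists_mulVec_pairMatrix hv)
      fun A hA => tens_graphN_conj hθ fun i => hΦ i ▸ hA i
  have hrank := finrank_span_pair ho1 ho2 ho3
  exact ⟨capacity_pos hcode (by rw [hrank]; norm_num), hcode, hrank⟩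

end PartB

/-! ### Reduction of vanishing capacity to orthonormal pairs -/

section NoCode

open Matrix

/-- If no orthonormal pair satisfies the Knill–Laflamme conditions for tensor products of elements
of the graphs, then the capacity vanishes. -/
theorem capacity_tensor_eq_zero {n : ℕ} {θ : Fin n → ℝ} {b : Fin n → Type*} [∀ i, Fintype (b i)]
    [∀ i, DecidableEq (b i)] {Φ : ∀ i, Matrix (Fin 4) (Fin 4) ℂ →ₗ[ℂ] Matrix (b i) (b i) ℂ}
    (hΦ : ∀ i, ncGraph (Φ i) = graphN (θ i))
    (h : ∀ φ ψ : (Fin n → Fin 4) → ℂ, star φ ⬝ᵥ φ = 1 → star ψ ⬝ᵥ ψ = 1 →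
      (∀ A : Fin n → Matrix (Fin 4) (Fin 4) ℂ, (∀ i, A i ∈ graphN (θ i)) →
        star φ ⬝ᵥ tens A *ᵥ ψ = 0 ∧ star ψ ⬝ᵥ tens A *ᵥ φ = 0 ∧
          star φ ⬝ᵥ tens A *ᵥ φ = star ψ ⬝ᵥ tens A *ᵥ ψ) → False) :
    capacity (tensor Φ) = 0 := by
  choose r V hV using fun i => exists_isKraus_of_ncGraph_ne_bot (Φ := Φ i)
    (by rw [hΦ]; exact graphN_ne_bot _)
  refine capacity_eq_zero (isKrausFamily_tensor fun i => (hV i).isKrausFamily) fun H₀ hH => ?_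
  by_contra! hlt
  obtain ⟨v, hv, ho⟩ := exists_orthonormal_of_le_finrank (m := 2) hlt
  refine h (v 0) (v 1) (by simp [ho]) (by simp [ho]) fun A hA => ?_
  exact klSpace_pair (hH.tens_mem_klSpace fun i => (hΦ i).symm ▸ hA i) (hv 0) (hv 1)
    (by simp [ho]) (by simp [ho]) (by simp [ho])

end NoCode

/-! ### Many channels: perturbation of a basis of projections -/

section Perturbation

open Matrix
open scoped Matrix.Norms.L2Operator

/-- The Hadamard matrix of two qubits. -/
noncomputable def had : Matrix (Fin 4) (Fin 4) ℂ :=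
  !![1 / 2, 1 / 2, 1 / 2, 1 / 2; 1 / 2, -1 / 2, 1 / 2, -1 / 2;
     1 / 2, 1 / 2, -1 / 2, -1 / 2; 1 / 2, -1 / 2, -1 / 2, 1 / 2]

theorem star_had (k p : Fin 4) : star (had k p) = had k p := by
  fin_cases k <;> fin_cases p <;> simp [had]

theorem had_conj_mul : hadᴴ * had = 1 := by
  ext p q
  simp only [Matrix.mul_apply, conjTranspose_apply, star_had, Fin.sum_univ_four]
  fin_cases p <;> fin_cases q <;> simp [had] <;> norm_num

/-- The projections onto the rows of the Hadamard matrix. -/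
noncomputable def hadProj (k : Fin 4) : Matrix (Fin 4) (Fin 4) ℂ :=
  Matrix.of fun p q => had k p * had k q

theorem sum_hadProj : ∑ k, hadProj k = 1 := by
  rw [← had_conj_mul]
  ext p q
  simp only [Matrix.sum_apply, hadProj, of_apply, Matrix.mul_apply, conjTranspose_apply, star_had]

/-- One quarter of the eigenvalues of `σₓ ⊗ 1` on the rows of the Hadamard matrix. -/
noncomputable def flipCoeff (k : Fin 4) : ℂ := ![1 / 4, 1 / 4, -1 / 4, -1 / 4] k

theorem norm_flipCoeff (k : Fin 4) : ‖flipCoeff k‖ = 1 / 4 := by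
  fin_cases k <;> simp [flipCoeff]

/-- The difference of the rotated flip and the flip of the first qubit. -/
noncomputable def flipDiff (θ : ℝ) : Matrix (Fin 4) (Fin 4) ℂ :=
  !![0, 0, halfPhase θ - 1, 0; 0, 0, 0, star (halfPhase θ - 1);
     star (halfPhase θ - 1), 0, 0, 0; 0, halfPhase θ - 1, 0, 0]

/-- Each row and each column has a single nonzero entry, of modulus |δ - 1| unless δ = 1. The matrix
is thus a multiple of a unitary, also after tensoring with identities. -/
theorem flipDiff_conj_mul (θ : ℝ) :
    (flipDiff θ)ᴴ * flipDiff θ = ((‖halfPhase θ - 1‖ ^ 2 : ℝ) : ℂ) • 1 := by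
  have h : star (halfPhase θ - 1) * (halfPhase θ - 1) = ((‖halfPhase θ - 1‖ ^ 2 : ℝ) : ℂ) := by
    rw [← Complex.normSq_eq_norm_sq, mul_comm, ← Complex.mul_conj]
    rfl
  rw [← h]
  ext p q
  simp only [Matrix.mul_apply, conjTranspose_apply, Fin.sum_univ_four, Matrix.smul_apply,
    one_apply, flipDiff]
  generalize halfPhase θ - 1 = w
  fin_cases p <;> fin_cases q <;> simp [mul_comm]

/-- The projection is ¼(1 + εX) ⊗ (1 + tX) with signs ε, t. Of its four terms only ¼ε X ⊗ 1 can
leave the graph, and the correction turns X ⊗ 1 into e₀₁ ⊗ D + e₁₀ ⊗ D̄. -/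
theorem hadProj_add_mem (θ : ℝ) (k : Fin 4) :
    hadProj k + flipCoeff k • flipDiff θ ∈ graphN θ := by
  -- The eigenvalues of 1 ⊗ σₓ on the Hadamard rows.
  let t : Fin 4 → ℂ := ![1, -1, 1, -1]
  convert mem_graphN_of_halfPhase θ (1 / 4) (t k / 4) (t k / 4) (1 / 4) (flipCoeff k)
    (flipCoeff k * t k) (flipCoeff k) (flipCoeff k * t k) using 1
  ext p q
  fin_cases k <;> fin_cases p <;> fin_cases q <;>
    simp [hadProj, had, flipCoeff, flipDiff, t] <;> ring

variable {n : ℕ}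

/-- The operator acting as `E` on the factor `j` and trivially on the others. -/
noncomputable def site (j : Fin n) (E : Matrix (Fin 4) (Fin 4) ℂ) :
    Matrix (Fin n → Fin 4) (Fin n → Fin 4) ℂ :=
  tens (Function.update (fun _ => 1) j E)

theorem tens_update_eq_site_mul (X : Fin n → Matrix (Fin 4) (Fin 4) ℂ) (j : Fin n)
    (E : Matrix (Fin 4) (Fin 4) ℂ) :
    tens (Function.update X j E) = site j E * tens (Function.update X j 1) := by
  rw [site, tens_mul]
  congr 1
  funext i
  by_cases h : i = j
  · subst h
    simp
  · simp [Function.update_of_ne h]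

theorem tens_update_sum (X : Fin n → Matrix (Fin 4) (Fin 4) ℂ) (j : Fin n) {κ : Type*}
    (s : Finset κ) (A : κ → Matrix (Fin 4) (Fin 4) ℂ) :
    tens (Function.update X j (∑ l ∈ s, A l)) = ∑ l ∈ s, tens (Function.update X j (A l)) := by
  ext p q
  simp only [tens_update_apply, Matrix.sum_apply, Finset.sum_mul]

theorem l2_opNorm_one_le {m : Type*} [Fintype m] [DecidableEq m] :
    ‖(1 : Matrix m m ℂ)‖ ≤ 1 := by
  rw [← diagonal_one, l2_opNorm_diagonal]
  exact (pi_norm_le_iff_of_nonneg zero_le_one).mpr fun i => by simp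

theorem l2_opNorm_le_of_conj_mul {m : Type*} [Fintype m] [DecidableEq m] {A : Matrix m m ℂ}
    {r : ℝ} (hr : 0 ≤ r) (h : Aᴴ * A = ((r ^ 2 : ℝ) : ℂ) • 1) : ‖A‖ ≤ r := by
  have h1 := l2_opNorm_conjTranspose_mul_self A
  rw [h, norm_smul, Complex.norm_real, Real.norm_of_nonneg (by positivity)] at h1
  have h2 : ‖A‖ * ‖A‖ ≤ r ^ 2 := by
    rw [← h1]
    exact mul_le_of_le_one_right (by positivity) l2_opNorm_one_le
  exact abs_le_of_sq_le_sq' (by rwa [← sq] at h2) hr |>.2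

theorem norm_site_flipDiff_le (j : Fin n) (θ : ℝ) :
    ‖site j (flipDiff θ)‖ ≤ ‖halfPhase θ - 1‖ := by
  refine l2_opNorm_le_of_conj_mul (norm_nonneg _) ?_
  rw [site, tens_conjTranspose, tens_mul, ← tens_one, ← Function.update_eq_self j
    (fun _ : Fin n => (1 : Matrix (Fin 4) (Fin 4) ℂ)), ← tens_update_smul]
  simp only [Function.update_idem]
  congr 1
  funext i
  by_cases h : i = j
  · subst h
    simp [flipDiff_conj_mul]
  · simp [Function.update_of_ne h]

/-- The operator with weights `z` over a product of families of matrices. -/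
noncomputable def weighted (X : Fin n → Fin 4 → Matrix (Fin 4) (Fin 4) ℂ)
    (z : (Fin n → Fin 4) → ℂ) : Matrix (Fin n → Fin 4) (Fin n → Fin 4) ℂ :=
  ∑ k, z k • tens fun i => X i (k i)

theorem weighted_hadProj (z : (Fin n → Fin 4) → ℂ) :
    weighted (fun _ => hadProj) z =
      (tens fun _ : Fin n => had)ᴴ * diagonal z * tens fun _ : Fin n => had := by
  ext p q
  rw [Matrix.mul_apply]
  simp only [weighted, Matrix.sum_apply, Matrix.smul_apply, tens_apply, hadProj, of_apply,
    mul_diagonal, conjTranspose_apply, star_prod, star_had,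
    Finset.prod_mul_distrib, smul_eq_mul]
  exact Finset.sum_congr rfl fun k _ => by ring

theorem tens_had_conj_mul : (tens fun _ : Fin n => had)ᴴ * (tens fun _ : Fin n => had) = 1 := by
  rw [tens_conjTranspose, tens_mul]
  simp only [had_conj_mul, tens_one]

theorem norm_tens_had_le : ‖tens fun _ : Fin n => had‖ ≤ 1 :=
  l2_opNorm_le_of_conj_mul zero_le_one (by simp [tens_had_conj_mul])

theorem norm_weighted_hadProj_le {z : (Fin n → Fin 4) → ℂ} (hz : ∀ k, ‖z k‖ ≤ 1) :
    ‖weighted (fun _ : Fin n => hadProj) z‖ ≤ 1 := by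
  rw [weighted_hadProj]
  have h1 := norm_tens_had_le (n := n)
  have h2 : ‖(diagonal z : Matrix (Fin n → Fin 4) (Fin n → Fin 4) ℂ)‖ ≤ 1 := by
    rw [l2_opNorm_diagonal]
    exact (pi_norm_le_iff_of_nonneg zero_le_one).mpr hz
  calc _ ≤ ‖(tens fun _ : Fin n => had)ᴴ‖ * ‖(diagonal z : Matrix _ _ ℂ)‖ *
        ‖tens fun _ : Fin n => had‖ :=
      (norm_mul_le _ _).trans (mul_le_mul_of_nonneg_right (norm_mul_le _ _) (norm_nonneg _))
    _ ≤ 1 * 1 * 1 := by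
      rw [l2_opNorm_conjTranspose]
      gcongr
    _ = 1 := by norm_num

/-- The average of the weights over one index against the coefficients of the flip. -/
noncomputable def flipAverage (j : Fin n) (z : (Fin n → Fin 4) → ℂ) : (Fin n → Fin 4) → ℂ :=
  fun k => ∑ l, flipCoeff l * z (Function.update k j l)

theorem norm_flipAverage_le (j : Fin n) {z : (Fin n → Fin 4) → ℂ} (hz : ∀ k, ‖z k‖ ≤ 1)
    (k : Fin n → Fin 4) : ‖flipAverage j z k‖ ≤ 1 := by
  calc _ ≤ ∑ l : Fin 4, (1 / 4 : ℝ) := norm_sum_le_of_le _ fun l _ => by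
        rw [norm_mul, norm_flipCoeff]
        exact mul_le_of_le_one_right (by norm_num) (hz _)
    _ = 1 := by simp

/-- In the correction term the operator at site `j` is the same for all values of the index there,
so the weights may be summed over that index. Inserting 1 as the sum of the `hadProj l` at the site
restores a weighted sum of the same kind. Its weights stay bounded by 1 since the moduli of
`flipCoeff` add up to 1, which keeps the induction in `norm_weighted_le` going. -/
theorem weighted_update (X : Fin n → Fin 4 → Matrix (Fin 4) (Fin 4) ℂ) (j : Fin n)
    (E : Matrix (Fin 4) (Fin 4) ℂ) (z : (Fin n → Fin 4) → ℂ) :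
    weighted (Function.update X j fun k => hadProj k + flipCoeff k • E) z =
      weighted (Function.update X j hadProj) z +
        site j E * weighted (Function.update X j hadProj) (flipAverage j z) := by
  have hup : ∀ (Y : Fin 4 → Matrix (Fin 4) (Fin 4) ℂ) (k : Fin n → Fin 4),
      (fun i => (Function.update X j Y) i (k i)) =
        Function.update (fun i => X i (k i)) j (Y (k j)) := by
    intro Y k
    funext i
    by_cases h : i = j
    · subst h
      simp
    · simp [Function.update_of_ne h]
  simp only [weighted, hup, tens_update_add, smul_add, Finset.sum_add_distrib]
  congr 1
  -- The involution that exchanges the old index at site `j` with the summation index of the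
  -- inserted identity.
  let e : (Fin n → Fin 4) × Fin 4 ≃ (Fin n → Fin 4) × Fin 4 :=
    { toFun := fun x => (Function.update x.1 j x.2, x.1 j)
      invFun := fun x => (Function.update x.1 j x.2, x.1 j)
      left_inv := fun x => by simp
      right_inv := fun x => by simp }
  calc _ = ∑ k : Fin n → Fin 4, ∑ l : Fin 4, (z k * flipCoeff (k j)) •
        (site j E * tens (Function.update (fun i => X i (k i)) j (hadProj l))) := by
        refine Finset.sum_congr rfl fun k _ => ?_
        rw [tens_update_smul, tens_update_eq_site_mul, ← sum_hadProj, tens_update_sum,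
          Matrix.mul_sum, smul_smul, Finset.smul_sum]
    _ = ∑ x : (Fin n → Fin 4) × Fin 4, (z x.1 * flipCoeff (x.1 j)) •
        (site j E * tens (Function.update (fun i => X i (x.1 i)) j (hadProj x.2))) := by
        rw [Fintype.sum_prod_type]
    _ = ∑ x : (Fin n → Fin 4) × Fin 4, (z (Function.update x.1 j x.2) * flipCoeff x.2) •
        (site j E * tens (Function.update (fun i => X i (x.1 i)) j (hadProj (x.1 j)))) := by
        refine Fintype.sum_equiv e _ _ fun x => ?_
        simp only [e, Equiv.coe_fn_mk, Function.update_idem, Function.update_eq_self,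
          Function.update_self]
        congr 3
        funext i
        by_cases h : i = j
        · subst h
          simp
        · simp [Function.update_of_ne h]
    _ = _ := by
        rw [Fintype.sum_prod_type, Matrix.mul_sum]
        refine Finset.sum_congr rfl fun k _ => ?_
        dsimp only
        rw [← Finset.sum_smul, Matrix.mul_smul]
        congr 1
        exact Finset.sum_congr rfl fun l _ => mul_comm _ _

/-- The perturbed projections, which lie in the graph. -/
noncomputable def graphProj (θ : ℝ) (k : Fin 4) : Matrix (Fin 4) (Fin 4) ℂ :=
  hadProj k + flipCoeff k • flipDiff θ

theorem graphProj_mem (θ : ℝ) (k : Fin 4) : graphProj θ k ∈ graphN θ := hadProj_add_mem θ k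

theorem norm_weighted_le (θ : Fin n → ℝ) (T : Finset (Fin n)) :
    ∀ z : (Fin n → Fin 4) → ℂ, (∀ k, ‖z k‖ ≤ 1) →
      ‖weighted (fun i => if i ∈ T then graphProj (θ i) else hadProj) z‖ ≤
        ∏ i ∈ T, (1 + ‖halfPhase (θ i) - 1‖) ∧
      ‖weighted (fun i => if i ∈ T then graphProj (θ i) else hadProj) z -
        weighted (fun _ => hadProj) z‖ ≤ ∏ i ∈ T, (1 + ‖halfPhase (θ i) - 1‖) - 1 := by
  induction T using Finset.induction_on with
  | empty =>
    intro z hz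
    simpa using norm_weighted_hadProj_le hz
  | insert j T hj ih =>
    intro z hz
    let X : Fin n → Fin 4 → Matrix (Fin 4) (Fin 4) ℂ :=
      fun i => if i ∈ T then graphProj (θ i) else hadProj
    have hX : Function.update X j hadProj = X := by
      rw [Function.update_eq_self_iff]
      simp [X, hj]
    have hX' : (fun i => if i ∈ insert j T then graphProj (θ i) else hadProj) =
        Function.update X j (graphProj (θ j)) := by
      funext i
      by_cases h : i = j
      · subst h
        simp
      · simp [h, X]
    have hw := weighted_update X j (flipDiff (θ j)) z
    rw [hX] at hw
    obtain ⟨h1, h2⟩ := ih z hz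
    obtain ⟨h3, -⟩ := ih _ (norm_flipAverage_le j hz)
    have h4 : ‖site j (flipDiff (θ j)) * weighted X (flipAverage j z)‖ ≤
        ‖halfPhase (θ j) - 1‖ * ∏ i ∈ T, (1 + ‖halfPhase (θ i) - 1‖) :=
      (norm_mul_le _ _).trans (mul_le_mul (norm_site_flipDiff_le j (θ j)) h3 (norm_nonneg _)
        (norm_nonneg _))
    rw [hX', Finset.prod_insert hj]
    change ‖weighted (Function.update X j fun k => hadProj k + flipCoeff k • flipDiff (θ j)) z‖ ≤ _ ∧
      ‖weighted (Function.update X j fun k => hadProj k + flipCoeff k • flipDiff (θ j)) z - _‖ ≤ _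
    rw [hw]
    constructor
    · refine (norm_add_le _ _).trans ?_
      linarith
    · rw [add_sub_right_comm]
      refine (norm_add_le _ _).trans ?_
      linarith

theorem norm_sesq_le {m : Type*} [Fintype m] [DecidableEq m] {φ ψ : m → ℂ}
    (hφ : star φ ⬝ᵥ φ = 1) (hψ : star ψ ⬝ᵥ ψ = 1) (A : Matrix m m ℂ) :
    ‖star φ ⬝ᵥ A *ᵥ ψ‖ ≤ ‖A‖ := by
  have hn : ∀ x : m → ℂ, star x ⬝ᵥ x = 1 → ‖(WithLp.toLp 2 x : EuclideanSpace ℂ m)‖ = 1 := by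
    intro x hx
    have h1 : inner ℂ (WithLp.toLp 2 x : EuclideanSpace ℂ m) (WithLp.toLp 2 x) = (1 : ℂ) := by
      rw [EuclideanSpace.inner_toLp_toLp, dotProduct_comm, hx]
    have h2 := inner_self_eq_norm_sq (𝕜 := ℂ) (WithLp.toLp 2 x : EuclideanSpace ℂ m)
    rw [h1, RCLike.one_re] at h2
    exact (pow_eq_one_iff_of_nonneg (norm_nonneg _) two_ne_zero).mp h2.symm
  have h1 : star φ ⬝ᵥ A *ᵥ ψ =
      inner ℂ (WithLp.toLp 2 φ : EuclideanSpace ℂ m) (WithLp.toLp 2 (A *ᵥ ψ)) := by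
    rw [EuclideanSpace.inner_toLp_toLp, dotProduct_comm]
  rw [h1]
  refine (norm_inner_le_norm _ _).trans ?_
  rw [hn φ hφ, one_mul]
  have := l2_opNorm_mulVec A (WithLp.toLp 2 ψ : EuclideanSpace ℂ m)
  rw [hn ψ hψ, mul_one] at this
  exact this

theorem norm_halfPhase_sub_one_le (θ : ℝ) : ‖halfPhase θ - 1‖ ≤ |θ| / 2 := by
  have := Real.norm_exp_I_mul_ofReal_sub_one_le (x := θ / 2)
  rw [halfPhase, mul_comm]
  refine this.trans_eq ?_
  rw [Real.norm_eq_abs, abs_div, abs_of_pos (by norm_num : (0 : ℝ) < 2)]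

/-- Each factor is at most exp(|θᵢ|/2), so the bound on the angles gives 3/2. The estimate is strict
at any nonzero angle, and if all angles vanish the product is 1. -/
theorem prod_halfPhase_lt {θ : Fin n → ℝ} (hθ : ∑ i, |θ i| ≤ 2 * Real.log (3 / 2)) :
    ∏ i, (1 + ‖halfPhase (θ i) - 1‖) < 3 / 2 := by
  by_cases h0 : ∀ i, θ i = 0
  · have : ∀ i, ‖halfPhase (θ i) - 1‖ = 0 := fun i => by simp [h0 i, halfPhase]
    simp only [this]
    norm_num
  push Not at h0
  obtain ⟨j, hj⟩ := h0
  have hle : ∀ i, 1 + ‖halfPhase (θ i) - 1‖ ≤ Real.exp (|θ i| / 2) := fun i => by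
    have := norm_halfPhase_sub_one_le (θ i)
    have := Real.add_one_le_exp (|θ i| / 2)
    linarith
  calc ∏ i, (1 + ‖halfPhase (θ i) - 1‖) < ∏ i, Real.exp (|θ i| / 2) := by
        refine Finset.prod_lt_prod (fun i _ => by positivity) (fun i _ => hle i)
          ⟨j, Finset.mem_univ j, ?_⟩
        have := norm_halfPhase_sub_one_le (θ j)
        have := Real.add_one_lt_exp (x := |θ j| / 2) (by positivity)
        linarith
    _ = Real.exp ((∑ i, |θ i|) / 2) := by rw [← Real.exp_sum, Finset.sum_div]
    _ ≤ Real.exp (Real.log (3 / 2)) := Real.exp_le_exp.mpr (by linarith)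
    _ = 3 / 2 := Real.exp_log (by norm_num)

theorem tens_graphN_no_pair {θ : Fin n → ℝ} (hθ : ∑ i, |θ i| ≤ 2 * Real.log (3 / 2))
    {φ ψ : (Fin n → Fin 4) → ℂ} (hφ : star φ ⬝ᵥ φ = 1) (hψ : star ψ ⬝ᵥ ψ = 1)
    (h : ∀ A : Fin n → Matrix (Fin 4) (Fin 4) ℂ, (∀ i, A i ∈ graphN (θ i)) →
      star φ ⬝ᵥ tens A *ᵥ ψ = 0 ∧ star φ ⬝ᵥ tens A *ᵥ φ = star ψ ⬝ᵥ tens A *ᵥ ψ) :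
    False := by
  have hε := prod_halfPhase_lt hθ
  set O : Matrix (Fin n → Fin 4) (Fin n → Fin 4) ℂ := tens fun _ => had with hO
  have hOO : Oᴴ * O = 1 := tens_had_conj_mul
  let G := weighted fun i => graphProj (θ i)
  have hG : ∀ z, (∀ k, ‖z k‖ ≤ 1) → ‖G z - Oᴴ * diagonal z * O‖ < 1 / 2 := by
    intro z hz
    have := (norm_weighted_le θ Finset.univ z hz).2
    simp only [Finset.mem_univ, if_true, weighted_hadProj] at this
    refine this.trans_lt ?_
    linarith
  have hG0 : ∀ z, star φ ⬝ᵥ G z *ᵥ ψ = 0 := by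
    intro z
    simp only [G, weighted, sum_mulVec, dotProduct_sum, smul_mulVec, dotProduct_smul]
    exact Finset.sum_eq_zero fun k _ => by
      rw [(h (fun i => graphProj (θ i) (k i)) fun i => graphProj_mem (θ i) (k i)).1, smul_zero]
  have hG1 : ∀ z, star φ ⬝ᵥ G z *ᵥ φ = star ψ ⬝ᵥ G z *ᵥ ψ := by
    intro z
    simp only [G, weighted, sum_mulVec, dotProduct_sum, smul_mulVec, dotProduct_smul]
    exact Finset.sum_congr rfl fun k _ => by
      rw [(h (fun i => graphProj (θ i) (k i)) fun i => graphProj_mem (θ i) (k i)).2]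
  have hO2 : ∀ (x y : (Fin n → Fin 4) → ℂ) z, star x ⬝ᵥ (Oᴴ * diagonal z * O) *ᵥ y =
      ∑ k, star ((O *ᵥ x) k) * z k * (O *ᵥ y) k := by
    intro x y z
    rw [Matrix.mul_assoc, ← mulVec_mulVec, dotProduct_mulVec, ← star_mulVec, ← mulVec_mulVec]
    simp only [dotProduct, mulVec_diagonal, Pi.star_apply, mul_assoc]
  have hnorm : ∀ x : (Fin n → Fin 4) → ℂ, star x ⬝ᵥ x = 1 → ∑ k, ‖(O *ᵥ x) k‖ ^ 2 = 1 := by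
    intro x hx
    have h1 := hO2 x x fun _ => 1
    rw [diagonal_one, Matrix.mul_one, hOO, one_mulVec, hx] at h1
    have h2 : ((∑ k, ‖(O *ᵥ x) k‖ ^ 2 : ℝ) : ℂ) = 1 := by
      rw [h1]
      push_cast
      exact Finset.sum_congr rfl fun k _ => by
        rw [mul_one, Complex.star_def, Complex.conj_mul']
    exact_mod_cast h2
  have hp := hnorm φ hφ
  have hq := hnorm ψ hψ
  set s := fun k => ‖(O *ᵥ φ) k‖ with hs
  set t := fun k => ‖(O *ᵥ ψ) k‖ with ht
  -- The weights are chosen to align the phases of all terms of the off-diagonal element, which is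
  -- zero for `G z`. Where `w k = 0` the weight is 0 by the convention for division.
  have hst : ∑ k, s k * t k < 1 / 2 := by
    let w : (Fin n → Fin 4) → ℂ := fun k => star ((O *ᵥ φ) k) * (O *ᵥ ψ) k
    let z : (Fin n → Fin 4) → ℂ := fun k => star (w k) / ‖w k‖
    have hz : ∀ k, ‖z k‖ ≤ 1 := by
      intro k
      simp only [z, norm_div, norm_star, Complex.norm_real, norm_norm]
      exact div_self_le_one _
    have h1 : star φ ⬝ᵥ (G z - Oᴴ * diagonal z * O) *ᵥ ψ = -((∑ k, s k * t k : ℝ) : ℂ) := by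
      rw [sub_mulVec, dotProduct_sub, hG0, hO2, zero_sub]
      push_cast
      congr 1
      refine Finset.sum_congr rfl fun k _ => ?_
      have e1 : star ((O *ᵥ φ) k) * z k * (O *ᵥ ψ) k = (star (w k) * w k) / ‖w k‖ := by
        simp only [z, w]
        ring
      have e2 : s k * t k = ‖w k‖ := by
        simp only [w, norm_mul, norm_star, s, t]
      rw [e1, ← Complex.ofReal_mul, e2, Complex.star_def, Complex.conj_mul']
      by_cases hw : (‖w k‖ : ℂ) = 0
      · simp [hw]
      · field_simp
    have h2 := (norm_sesq_le hφ hψ (G z - Oᴴ * diagonal z * O)).trans_lt (hG z hz)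
    rw [h1, norm_neg, Complex.norm_real] at h2
    exact (le_abs_self _).trans_lt h2
  -- Weights equal to the signs turn the difference of the two expectations into the sum of absolute
  -- values. `G z` contributes nothing, and each of the two errors is below 1/2.
  have hsub : ∑ k, |s k ^ 2 - t k ^ 2| < 1 := by
    let z : (Fin n → Fin 4) → ℂ := fun k => ((SignType.sign (s k ^ 2 - t k ^ 2) : ℝ) : ℂ)
    have hz : ∀ k, ‖z k‖ ≤ 1 := by
      intro k
      simp only [z, Complex.norm_real]
      rcases SignType.sign (s k ^ 2 - t k ^ 2) with _ | _ | _ <;> simp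
    have h1 : star φ ⬝ᵥ (G z - Oᴴ * diagonal z * O) *ᵥ φ -
        star ψ ⬝ᵥ (G z - Oᴴ * diagonal z * O) *ᵥ ψ =
          -((∑ k, |s k ^ 2 - t k ^ 2| : ℝ) : ℂ) := by
      rw [sub_mulVec, dotProduct_sub, sub_mulVec, dotProduct_sub, hG1, hO2, hO2,
        sub_sub_sub_cancel_left, ← Finset.sum_sub_distrib]
      push_cast
      rw [← Finset.sum_neg_distrib]
      refine Finset.sum_congr rfl fun k _ => ?_
      have e : ∀ x : ℂ, star x * z k * x = z k * (‖x‖ : ℂ) ^ 2 := fun x => by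
        rw [← Complex.conj_mul', Complex.star_def]
        ring
      rw [e, e, ← mul_sub, ← sign_mul_self (s k ^ 2 - t k ^ 2)]
      simp only [z, s, t]
      push_cast
      ring
    have h2 := (norm_sesq_le hφ hφ (G z - Oᴴ * diagonal z * O)).trans_lt (hG z hz)
    have h3 := (norm_sesq_le hψ hψ (G z - Oᴴ * diagonal z * O)).trans_lt (hG z hz)
    have h4 := norm_sub_le (star φ ⬝ᵥ (G z - Oᴴ * diagonal z * O) *ᵥ φ)
      (star ψ ⬝ᵥ (G z - Oᴴ * diagonal z * O) *ᵥ ψ)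
    rw [h1, norm_neg, Complex.norm_real] at h4
    have := le_abs_self (∑ k, |s k ^ 2 - t k ^ 2|)
    rw [Real.norm_eq_abs] at h4
    linarith
  -- Termwise (s - t)² ≤ |s² - t²| for s, t ≥ 0. The left side is 2 - 2∑st > 1 by `hst`, against the
  -- bound 1 of `hsub`.
  have hfin : ∑ k, (s k ^ 2 + t k ^ 2 - 2 * (s k * t k)) ≤ ∑ k, |s k ^ 2 - t k ^ 2| := by
    refine Finset.sum_le_sum fun k _ => ?_
    have h1 : 0 ≤ s k := norm_nonneg _
    have h2 : 0 ≤ t k := norm_nonneg _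
    rcases le_total (s k) (t k) with h3 | h3
    · refine le_trans ?_ (neg_le_abs _)
      nlinarith
    · refine le_trans ?_ (le_abs_self _)
      nlinarith
  rw [Finset.sum_sub_distrib, Finset.sum_add_distrib, hp, hq, ← Finset.mul_sum] at hfin
  linarith

end Perturbation

/-! ### Knill–Laflamme conditions for a pair in T ⊗ S -/

section PairSpace

open Matrix Kronecker

variable {m k : Type*} [Fintype m] [Fintype k]

/-- The matrices that satisfy the Knill–Laflamme conditions for the pair `φ, ψ`. -/
def pairSpace (φ ψ : m → ℂ) : Submodule ℂ (Matrix m m ℂ) where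
  carrier := {A | star φ ⬝ᵥ A *ᵥ ψ = 0 ∧ star ψ ⬝ᵥ A *ᵥ φ = 0 ∧
    star φ ⬝ᵥ A *ᵥ φ = star ψ ⬝ᵥ A *ᵥ ψ}
  add_mem' := by
    rintro A B ⟨h1, h2, h3⟩ ⟨h1', h2', h3'⟩
    simp [add_mulVec, dotProduct_add, *]
  zero_mem' := by simp
  smul_mem' := by
    rintro c A ⟨h1, h2, h3⟩
    simp [smul_mulVec, *]

theorem mem_pairSpace {φ ψ : m → ℂ} {A : Matrix m m ℂ} :
    A ∈ pairSpace φ ψ ↔ star φ ⬝ᵥ A *ᵥ ψ = 0 ∧ star ψ ⬝ᵥ A *ᵥ φ = 0 ∧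
      star φ ⬝ᵥ A *ᵥ φ = star ψ ⬝ᵥ A *ᵥ ψ := Iff.rfl

theorem mem_pairSpace_mulVec {φ ψ : k → ℂ} {A : Matrix m m ℂ} (W : Matrix m k ℂ) :
    A ∈ pairSpace (W *ᵥ φ) (W *ᵥ ψ) ↔ Wᴴ * A * W ∈ pairSpace φ ψ := by
  simp only [mem_pairSpace, star_mulVec, dotProduct_mulVec, vecMul_vecMul]

theorem mem_pairSpace_comp {φ ψ : m → ℂ} {A : Matrix m m ℂ} (e : k ≃ m) :
    A.submatrix e e ∈ pairSpace (φ ∘ e) (ψ ∘ e) ↔ A ∈ pairSpace φ ψ := by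
  have key : ∀ x y : m → ℂ, star (x ∘ e) ⬝ᵥ A.submatrix e e *ᵥ (y ∘ e) = star x ⬝ᵥ A *ᵥ y := by
    intro x y
    rw [submatrix_mulVec_equiv, Function.comp_assoc, Equiv.self_comp_symm, Function.comp_id]
    exact comp_equiv_dotProduct_comp_equiv (star x) (A *ᵥ y) e
  simp only [mem_pairSpace, key]

/-- The matrices `C` for which `C ⊗ σ` satisfies the Knill–Laflamme conditions. -/
def pairSpaceLeft {S ι : Type*} [Fintype S] [Fintype ι] (φ ψ : ι × S → ℂ) (σ : Matrix S S ℂ) :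
    Submodule ℂ (Matrix ι ι ℂ) where
  carrier := {C | C ⊗ₖ σ ∈ pairSpace φ ψ}
  add_mem' := by
    intro A B hA hB
    change (A + B) ⊗ₖ σ ∈ pairSpace φ ψ
    rw [add_kronecker]
    exact add_mem hA hB
  zero_mem' := by
    change (0 : Matrix ι ι ℂ) ⊗ₖ σ ∈ pairSpace φ ψ
    rw [zero_kronecker]
    exact zero_mem _
  smul_mem' := by
    intro c A hA
    change (c • A) ⊗ₖ σ ∈ pairSpace φ ψ
    rw [smul_kronecker]
    exact Submodule.smul_mem _ _ hA

theorem mem_pairSpaceLeft {S ι : Type*} [Fintype S] [Fintype ι] {φ ψ : ι × S → ℂ}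
    {σ : Matrix S S ℂ} {C : Matrix ι ι ℂ} :
    C ∈ pairSpaceLeft φ ψ σ ↔ C ⊗ₖ σ ∈ pairSpace φ ψ := Iff.rfl

theorem mem_pairSpaceLeft_mulVec {T S ι : Type*} [Fintype T] [Fintype S] [DecidableEq S]
    [Fintype ι] {φ ψ : ι × S → ℂ} {σ : Matrix S S ℂ} {D : Matrix T T ℂ} (K : Matrix T ι ℂ) :
    D ∈ pairSpaceLeft ((K ⊗ₖ (1 : Matrix S S ℂ)) *ᵥ φ) ((K ⊗ₖ (1 : Matrix S S ℂ)) *ᵥ ψ) σ ↔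
      Kᴴ * D * K ∈ pairSpaceLeft φ ψ σ := by
  rw [mem_pairSpaceLeft, mem_pairSpaceLeft, mem_pairSpace_mulVec, conjTranspose_kronecker,
    ← mul_kronecker_mul, ← mul_kronecker_mul, conjTranspose_one, Matrix.one_mul, Matrix.mul_one]

/-- The basis `1, e₀₁, e₁₀` of the operator system of `2 × 2` matrices with constant diagonal. -/
def sig : Fin 3 → Matrix (Fin 2) (Fin 2) ℂ := ![1, single 0 1 1, single 1 0 1]

/-- The span contains the rank-one matrices of the four vectors v = (1, ±1) ⊗ (1, ±1). For each of
them ⟨x, v⟩⟨v, y⟩ = 0 and |⟨v, x⟩| = |⟨v, y⟩|, so x is orthogonal to a basis. -/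
theorem eq_zero_of_sig_mem {x y : Fin 2 × Fin 2 → ℂ}
    (h : ∀ α β : Fin 3, sig α ⊗ₖ sig β ∈ pairSpace x y) : x = 0 := by
  have key : ∀ ε η : ℂ, star ε = ε → star η = η → ε * ε = 1 → η * η = 1 →
      x (0, 0) + η * x (0, 1) + ε * x (1, 0) + ε * η * x (1, 1) = 0 := by
    intro ε η hε hη hε1 hη1
    obtain ⟨v, hv⟩ : ∃ v : Fin 2 × Fin 2 → ℂ,
        v = fun p => (![1, ε] p.1) * (![1, η] p.2) := ⟨_, rfl⟩
    have hmem : vecMulVec v (star v) ∈ pairSpace x y := by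
      have e : vecMulVec v (star v) = (sig 0 + ε • (sig 1 + sig 2)) ⊗ₖ
          (sig 0 + η • (sig 1 + sig 2)) := by
        ext ⟨i, j⟩ ⟨i', j'⟩
        rw [hv]
        fin_cases i <;> fin_cases j <;> fin_cases i' <;> fin_cases j' <;>
          simp [vecMulVec_apply, sig, hε, hη, hε1, hη1] <;> ring_nf <;>
          simp only [pow_two, hε1, hη1, mul_one, one_mul]
      rw [e]
      simp only [add_kronecker, kronecker_add, smul_kronecker, kronecker_smul, smul_add]
      repeat' first
        | apply Submodule.add_mem
        | apply Submodule.smul_mem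
        | exact h _ _
    obtain ⟨h1, -, h3⟩ := mem_pairSpace.mp hmem
    have hs : ∀ z : Fin 2 × Fin 2 → ℂ, star z ⬝ᵥ v = star (star v ⬝ᵥ z) := fun z => by
      rw [star_dotProduct]
    simp only [vecMulVec_mulVec, dotProduct_smul, hs, op_smul_eq_smul, smul_eq_mul] at h1 h3
    have hx : star v ⬝ᵥ x = 0 := by
      rcases mul_eq_zero.mp h1 with h0 | h0
      · rw [h0, zero_mul] at h3
        rcases mul_eq_zero.mp h3 with h' | h'
        · exact h'
        · simpa using h'
      · simpa using h0
    rw [← hx, hv]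
    simp [dotProduct, Fintype.sum_prod_type, Fin.sum_univ_two]
    simp only [Complex.star_def] at hε hη
    rw [hε, hη]
    ring
  have h1 := key 1 1 (by simp) (by simp) (by simp) (by simp)
  have h2 := key 1 (-1) (by simp) (by simp) (by simp) (by simp)
  have h3 := key (-1) 1 (by simp) (by simp) (by simp) (by simp)
  have h4 := key (-1) (-1) (by simp) (by simp) (by simp) (by simp)
  ext ⟨i, j⟩
  fin_cases i <;> fin_cases j <;> simp
  · linear_combination (h1 + h2 + h3 + h4) / 4
  · linear_combination (h1 - h2 + h3 - h4) / 4
  · linear_combination (h1 + h2 - h3 - h4) / 4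
  · linear_combination (h1 - h2 - h3 + h4) / 4

/-- The vectors `φ (i, ·)` and `ψ (i, ·)` as the columns of a matrix. -/
def stack {S ι : Type*} (φ ψ : ι × S → ℂ) : Matrix S (Fin 2 × ι) ℂ :=
  of fun s p => ![φ, ψ] p.1 (p.2, s)

section Stack

variable {S ι : Type*} [Fintype S] [DecidableEq S] [Fintype ι] [DecidableEq ι] {φ ψ : ι × S → ℂ}

theorem stack_mul_apply (σ : Matrix S S ℂ) (a b : Fin 2) (i j : ι) :
    ((stack φ ψ)ᴴ * σ * stack φ ψ) (a, i) (b, j) =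
      star (![φ, ψ] a) ⬝ᵥ (single i j 1 ⊗ₖ σ) *ᵥ (![φ, ψ] b) := by
  simp only [mul_apply, conjTranspose_apply, stack, of_apply, dotProduct, mulVec,
    kroneckerMap_apply, Fintype.sum_prod_type, single_apply, Pi.star_apply, Finset.sum_mul]
  rw [Finset.sum_comm, Finset.sum_eq_single i]
  · refine Finset.sum_congr rfl fun s _ => ?_
    rw [Finset.sum_eq_single j, Finset.mul_sum]
    · simp [mul_assoc]
    · intro j' _ hj
      simp [hj.symm]
    · simp
  · intro i' _ hi
    simp [hi.symm]
  · simp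

theorem pairSpaceLeft_eq_top_iff {σ : Matrix S S ℂ} :
    pairSpaceLeft φ ψ σ = ⊤ ↔
      ∃ H : Matrix ι ι ℂ, (stack φ ψ)ᴴ * σ * stack φ ψ = (1 : Matrix (Fin 2) (Fin 2) ℂ) ⊗ₖ H := by
  constructor
  · intro h
    refine ⟨of fun i j => ((stack φ ψ)ᴴ * σ * stack φ ψ) (0, i) (0, j), ?_⟩
    ext ⟨a, i⟩ ⟨b, j⟩
    obtain ⟨h1, h2, h3⟩ := mem_pairSpace.mp (mem_pairSpaceLeft.mp
      (h ▸ Submodule.mem_top : single i j 1 ∈ pairSpaceLeft φ ψ σ))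
    rw [kroneckerMap_apply, of_apply, stack_mul_apply, stack_mul_apply]
    fin_cases a <;> fin_cases b <;> simp [h1, h2, h3]
  · rintro ⟨H, hH⟩
    rw [eq_top_iff]
    rintro C -
    rw [matrix_eq_sum_single C]
    refine Submodule.sum_mem _ fun i _ => Submodule.sum_mem _ fun j _ => ?_
    have e : single i j (C i j) = C i j • single i j (1 : ℂ) := by simp
    rw [e]
    refine Submodule.smul_mem _ _ (mem_pairSpaceLeft.mpr (mem_pairSpace.mpr ?_))
    have key : ∀ a b, star (![φ, ψ] a) ⬝ᵥ (single i j 1 ⊗ₖ σ) *ᵥ (![φ, ψ] b) =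
        (1 : Matrix (Fin 2) (Fin 2) ℂ) a b * H i j := fun a b => by
      rw [← stack_mul_apply, hH, kroneckerMap_apply]
    have h1 := key 0 1
    have h2 := key 1 0
    have h3 := key 0 0
    have h4 := key 1 1
    simp at h1 h2 h3 h4
    exact ⟨h1, h2, h3.trans h4.symm⟩

/-- Here the stacked matrix U is invertible with inverse (1 ⊗ G⁻¹)Uᴴ. Inserting U times this inverse
between σ and τ gives a product of matrices of the form 1 ⊗ H. -/
theorem pairSpaceLeft_mul {G : Matrix ι ι ℂ} (hG : IsUnit G.det)
    (hcard : Fintype.card S = Fintype.card (Fin 2 × ι))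
    (h : (stack φ ψ)ᴴ * stack φ ψ = (1 : Matrix (Fin 2) (Fin 2) ℂ) ⊗ₖ G) {σ τ : Matrix S S ℂ}
    (hσ : pairSpaceLeft φ ψ σ = ⊤) (hτ : pairSpaceLeft φ ψ τ = ⊤) :
    pairSpaceLeft φ ψ (σ * τ) = ⊤ := by
  rw [pairSpaceLeft_eq_top_iff] at *
  obtain ⟨H, hH⟩ := hσ
  obtain ⟨H', hH'⟩ := hτ
  set U := stack φ ψ
  have h1 : ((1 : Matrix (Fin 2) (Fin 2) ℂ) ⊗ₖ G⁻¹ * Uᴴ) * U = 1 := by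
    rw [Matrix.mul_assoc, h, ← mul_kronecker_mul, nonsing_inv_mul _ hG, Matrix.one_mul,
      one_kronecker_one]
  have h2 : U * ((1 : Matrix (Fin 2) (Fin 2) ℂ) ⊗ₖ G⁻¹ * Uᴴ) = 1 :=
    (mul_eq_one_comm_of_equiv (Fintype.equivOfCardEq hcard.symm)).mp h1
  refine ⟨H * G⁻¹ * H', ?_⟩
  calc Uᴴ * (σ * τ) * U = (Uᴴ * σ) * (1 : Matrix S S ℂ) * (τ * U) := by
        simp only [Matrix.mul_assoc, Matrix.one_mul]
    _ = (Uᴴ * σ * U) * ((1 : Matrix (Fin 2) (Fin 2) ℂ) ⊗ₖ G⁻¹) * (Uᴴ * τ * U) := by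
        rw [← h2]
        simp only [Matrix.mul_assoc]
    _ = _ := by
        rw [hH, hH', ← mul_kronecker_mul, ← mul_kronecker_mul, Matrix.one_mul, Matrix.one_mul]

/-- The matrix with the rows `φ (i, ·)`. -/
def rowMatrix {T S : Type*} (φ : T × S → ℂ) : Matrix T S ℂ := of fun t s => φ (t, s)

theorem kronecker_one_mulVec {T : Type*} [Fintype T] (K : Matrix T ι ℂ) (φ : ι × S → ℂ) :
    rowMatrix ((K ⊗ₖ (1 : Matrix S S ℂ)) *ᵥ φ) = K * rowMatrix φ := by
  ext t s
  simp only [rowMatrix, of_apply, mulVec, dotProduct, Fintype.sum_prod_type, kroneckerMap_apply,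
    one_apply, mul_apply]
  refine Finset.sum_congr rfl fun i _ => ?_
  simp

theorem isUnit_det_of_card_le_rank {A : Matrix ι ι ℂ} (h : Fintype.card ι ≤ A.rank) :
    IsUnit A.det := by
  rw [← isUnit_iff_isUnit_det, ← mulVec_surjective_iff_isUnit]
  have : LinearMap.range A.mulVecLin = ⊤ := by
    refine Submodule.eq_top_of_finrank_eq (le_antisymm (Submodule.finrank_le _) ?_)
    rwa [Module.finrank_fintype_fun_eq_card]
  exact LinearMap.range_eq_top.mp this

theorem rowMatrix_gram (h : pairSpaceLeft φ ψ (1 : Matrix S S ℂ) = ⊤) :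
    rowMatrix φ * (rowMatrix φ)ᴴ = rowMatrix ψ * (rowMatrix ψ)ᴴ := by
  obtain ⟨H, hH⟩ := pairSpaceLeft_eq_top_iff.mp h
  rw [Matrix.mul_one] at hH
  ext i j
  have h0 := congrFun (congrFun hH (0, j)) (0, i)
  have h1 := congrFun (congrFun hH (1, j)) (1, i)
  simp only [mul_apply, stack, conjTranspose_apply, of_apply, kroneckerMap_apply, rowMatrix,
    one_apply_eq, cons_val_zero, cons_val_one] at h0 h1 ⊢
  simp only [mul_comm (star _)] at h0 h1
  rw [h0, h1]

open scoped ComplexOrder in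
/-- A pair of vectors that satisfies the Knill–Laflamme conditions for all `C ⊗ 1` factors through
any `K` whose range contains the support of the first tensor factor. -/
theorem exists_factor {T : Type*} [Fintype T] [DecidableEq T] {φ ψ : T × S → ℂ}
    (h : pairSpaceLeft φ ψ (1 : Matrix S S ℂ) = ⊤) (K : Matrix T ι ℂ)
    (hK : LinearMap.range (rowMatrix φ).mulVecLin ≤ LinearMap.range K.mulVecLin)
    (hcard : Fintype.card ι ≤ (rowMatrix φ).rank) :
    ∃ φ' ψ' : ι × S → ℂ, φ = (K ⊗ₖ (1 : Matrix S S ℂ)) *ᵥ φ' ∧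
      ψ = (K ⊗ₖ (1 : Matrix S S ℂ)) *ᵥ ψ' ∧ pairSpaceLeft φ' ψ' (1 : Matrix S S ℂ) = ⊤ ∧
      ∃ G : Matrix ι ι ℂ, IsUnit G.det ∧
        (stack φ' ψ')ᴴ * stack φ' ψ' = (1 : Matrix (Fin 2) (Fin 2) ℂ) ⊗ₖ G := by
  have hrange : ∀ A : Matrix T S ℂ, LinearMap.range A.mulVecLin =
      LinearMap.range (A * Aᴴ).mulVecLin := by
    intro A
    symm
    refine Submodule.eq_of_le_of_finrank_eq ?_ (rank_self_mul_conjTranspose A)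
    rw [mulVecLin_mul]
    exact LinearMap.range_comp_le_range _ _
  -- A and A Aᴴ have the same range, and the two Gram matrices coincide, so ψ has the same support
  -- as φ.
  have hKψ : LinearMap.range (rowMatrix ψ).mulVecLin ≤ LinearMap.range K.mulVecLin := by
    rwa [hrange, ← rowMatrix_gram h, ← hrange]
  have hfac : ∀ x : T × S → ℂ, LinearMap.range (rowMatrix x).mulVecLin ≤
      LinearMap.range K.mulVecLin → ∃ x' : ι × S → ℂ, x = (K ⊗ₖ (1 : Matrix S S ℂ)) *ᵥ x' := by
    intro x hx
    have : ∀ s, ∃ c : ι → ℂ, K *ᵥ c = fun t => x (t, s) := by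
      intro s
      obtain ⟨c, hc⟩ := hx ⟨Pi.single s 1, rfl⟩
      refine ⟨c, ?_⟩
      rw [mulVecLin_apply, mulVecLin_apply] at hc
      rw [hc, mulVec_single_one]
      rfl
    choose c hc using this
    refine ⟨fun p => c p.2 p.1, ?_⟩
    ext ⟨t, s⟩
    have := congrFun (congrFun (kronecker_one_mulVec K fun p => c p.2 p.1) t) s
    refine (Eq.trans this ?_).symm
    exact congrFun (hc s) t
  obtain ⟨φ', hφ'⟩ := hfac φ hK
  obtain ⟨ψ', hψ'⟩ := hfac ψ hKψ
  have hmul : rowMatrix φ = K * rowMatrix φ' := by rw [hφ', kronecker_one_mulVec]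
  -- The rank of K is at least that of the rows of φ, so K is injective by `hcard`. Hence every
  -- matrix is a compression by K and no condition is lost.
  have hKu : IsUnit (Kᴴ * K).det := by
    refine isUnit_det_of_card_le_rank ?_
    rw [rank_conjTranspose_mul_self]
    exact hcard.trans (hmul ▸ rank_mul_le_left _ _)
  have htop : pairSpaceLeft φ' ψ' (1 : Matrix S S ℂ) = ⊤ := by
    rw [eq_top_iff]
    rintro C -
    have e : C = Kᴴ * (K * ((Kᴴ * K)⁻¹ * C * (Kᴴ * K)⁻¹) * Kᴴ) * K := by
      calc C = ((Kᴴ * K) * (Kᴴ * K)⁻¹) * C * ((Kᴴ * K)⁻¹ * (Kᴴ * K)) := by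
            rw [mul_nonsing_inv _ hKu, nonsing_inv_mul _ hKu, Matrix.one_mul, Matrix.mul_one]
        _ = _ := by simp only [Matrix.mul_assoc]
    rw [e, ← mem_pairSpaceLeft_mulVec, ← hφ', ← hψ', h]
    trivial
  refine ⟨φ', ψ', hφ', hψ', htop, ?_⟩
  obtain ⟨G, hG⟩ := pairSpaceLeft_eq_top_iff.mp htop
  rw [Matrix.mul_one] at hG
  refine ⟨G, ?_, hG⟩
  have e : G = (rowMatrix φ' * (rowMatrix φ')ᴴ)ᵀ := by
    ext i j
    have h0 := congrFun (congrFun hG (0, i)) (0, j)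
    simp only [mul_apply, stack, conjTranspose_apply, of_apply, kroneckerMap_apply, rowMatrix,
      one_apply_eq, cons_val_zero, transpose_apply, one_mul] at h0 ⊢
    rw [← h0]
    exact Finset.sum_congr rfl fun s _ => mul_comm _ _
  rw [e, det_transpose]
  refine isUnit_det_of_card_le_rank ?_
  rw [rank_self_mul_conjTranspose]
  exact hcard.trans (hmul ▸ rank_mul_le_right _ _)

/-- The `2 * card ι` columns of the stacked matrix are linearly independent because their Gram
matrix 1 ⊗ G is invertible. -/
theorem card_le_of_stack {G : Matrix ι ι ℂ} (hG : IsUnit G.det)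
    (h : (stack φ ψ)ᴴ * stack φ ψ = (1 : Matrix (Fin 2) (Fin 2) ℂ) ⊗ₖ G) :
    2 * Fintype.card ι ≤ Fintype.card S := by
  have h1 : IsUnit ((1 : Matrix (Fin 2) (Fin 2) ℂ) ⊗ₖ G).det := by
    rw [det_kronecker, det_one, one_pow, one_mul]
    exact hG.pow _
  have h2 := rank_of_isUnit _ ((isUnit_iff_isUnit_det _).mpr h1)
  rw [Fintype.card_prod, Fintype.card_fin] at h2
  rw [← h2, ← h]
  exact (rank_mul_le_right _ _).trans (rank_le_card_height _)

theorem row_ne_zero_of_stack {G : Matrix ι ι ℂ} (hG : IsUnit G.det)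
    (h : (stack φ ψ)ᴴ * stack φ ψ = (1 : Matrix (Fin 2) (Fin 2) ℂ) ⊗ₖ G) (i : ι) :
    (fun s => φ (i, s)) ≠ 0 := by
  intro h0
  refine hG.ne_zero (det_eq_zero_of_column_eq_zero i fun j => ?_)
  have h1 := congrFun (congrFun h (0, j)) (0, i)
  rw [kroneckerMap_apply, one_apply_eq, one_mul] at h1
  rw [← h1, mul_apply]
  refine Finset.sum_eq_zero fun s _ => ?_
  have := congrFun h0 s
  simp only [Pi.zero_apply] at this
  simp [stack, this]

end Stack

theorem eq_zero_of_row {ι : Type*} [Fintype ι] [DecidableEq ι]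
    {φ ψ : ι × (Fin 2 × Fin 2) → ℂ} (i : ι)
    (h : ∀ α β : Fin 3, single i i 1 ∈ pairSpaceLeft φ ψ (sig α ⊗ₖ sig β)) :
    (fun s => φ (i, s)) = 0 := by
  refine eq_zero_of_sig_mem (y := fun s => ψ (i, s)) fun α β => ?_
  have key : ∀ x y : ι × (Fin 2 × Fin 2) → ℂ, ∀ σ : Matrix (Fin 2 × Fin 2) (Fin 2 × Fin 2) ℂ,
      star x ⬝ᵥ (single i i 1 ⊗ₖ σ) *ᵥ y =
        star (fun s => x (i, s)) ⬝ᵥ σ *ᵥ (fun s => y (i, s)) := by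
    intro x y σ
    have := stack_mul_apply (φ := x) (ψ := y) σ 0 1 i i
    simp only [cons_val_zero, cons_val_one] at this
    rw [← this, Matrix.mul_assoc, mul_apply]
    rfl
  have := mem_pairSpace.mp (mem_pairSpaceLeft.mp (h α β))
  rw [key, key, key, key] at this
  exact this

/-- A pair of vectors of `ℂ² ⊗ ℂ^E` that satisfies the Knill–Laflamme conditions for `1 ⊗ M` with all
`M` and for `e₀₁ ⊗ B`, `e₁₀ ⊗ C` without isotropic vectors for `B` and `C` vanishes. -/
theorem eq_zero_of_offDiag_mem {E : Type*} [Fintype E] [DecidableEq E] {φ ψ : Fin 2 × E → ℂ}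
    (h : ∀ i j : E, (1 : Matrix (Fin 2) (Fin 2) ℂ) ⊗ₖ single i j 1 ∈ pairSpace φ ψ)
    {B C : Matrix E E ℂ} (hB : ∀ u, u ≠ 0 → star u ⬝ᵥ B *ᵥ u ≠ 0)
    (hC : ∀ u, u ≠ 0 → star u ⬝ᵥ C *ᵥ u ≠ 0) (hBm : sig 1 ⊗ₖ B ∈ pairSpace φ ψ)
    (hCm : sig 2 ⊗ₖ C ∈ pairSpace φ ψ) : φ = 0 := by
  have key1 : ∀ (x y : Fin 2 × E → ℂ) (i j : E),
      star x ⬝ᵥ ((1 : Matrix (Fin 2) (Fin 2) ℂ) ⊗ₖ single i j 1) *ᵥ y =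
        y (0, j) * star (x (0, i)) + y (1, j) * star (x (1, i)) := by
    intro x y i j
    simp only [dotProduct, mulVec, Fintype.sum_prod_type, Fin.sum_univ_two, kroneckerMap_apply]
    simp [single_apply, ite_and, mul_comm]
  have key2 : ∀ (x y : Fin 2 × E → ℂ) (p q : Fin 2) (M : Matrix E E ℂ),
      star x ⬝ᵥ (single p q 1 ⊗ₖ M) *ᵥ y =
        star (fun e => x (p, e)) ⬝ᵥ M *ᵥ (fun e => y (q, e)) := by
    intro x y p q M
    simp only [dotProduct, mulVec, Fintype.sum_prod_type, Fin.sum_univ_two, kroneckerMap_apply]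
    fin_cases p <;> fin_cases q <;> simp
  by_contra hne
  refine no_code_of_offDiag (x := fun e => φ (0, e)) (y := fun e => φ (1, e))
    (z := fun e => ψ (0, e)) (w := fun e => ψ (1, e)) (fun i j => ?_) (fun i j => ?_) ?_ hB hC ?_ ?_
  · rw [← (mem_pairSpace.mp (h j i)).1, key1]
  · have := (mem_pairSpace.mp (h j i)).2.2
    rwa [key1, key1] at this
  · by_contra! h0
    refine hne (funext fun ⟨p, e⟩ => ?_)
    fin_cases p
    · exact congrFun h0.1 e
    · exact congrFun h0.2 e
  · rw [← key2]
    exact (mem_pairSpace.mp hBm).1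
  · rw [← key2]
    exact (mem_pairSpace.mp hCm).1

theorem diagonal_form_re_pos {E : Type*} [Fintype E] [DecidableEq E] {d : E → ℂ}
    (hd : ∀ i, 0 < (d i).re) {u : E → ℂ} (hu : u ≠ 0) :
    0 < (star u ⬝ᵥ diagonal d *ᵥ u).re := by
  have e : (star u ⬝ᵥ diagonal d *ᵥ u).re = ∑ i, (d i).re * Complex.normSq (u i) := by
    simp only [dotProduct, mulVec_diagonal, Complex.re_sum]
    refine Finset.sum_congr rfl fun i _ => ?_
    rw [Pi.star_apply, Complex.star_def, mul_left_comm, ← Complex.normSq_eq_conj_mul_self,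
      Complex.re_mul_ofReal]
  rw [e]
  obtain ⟨i, hi⟩ := Function.ne_iff.mp hu
  exact Finset.sum_pos' (fun j _ => mul_nonneg (hd j).le (Complex.normSq_nonneg _))
    ⟨i, Finset.mem_univ _, mul_pos (hd i) (Complex.normSq_pos.mpr hi)⟩


end PairSpace

/-! ### Two-dimensional subspaces of ℂ² ⊗ ℂ² and compressions to them -/

section NormalForm

open Matrix Kronecker

/-- Two `2 × 2` matrices as the columns of a matrix. -/
def colMat (A B : Matrix (Fin 2) (Fin 2) ℂ) : Matrix (Fin 2 × Fin 2) (Fin 2) ℂ :=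
  of fun p j => ![A, B] j p.1 p.2

/-- The determinant restricts to a binary quadratic form on the subspace and has a nontrivial zero
over ℂ. -/
theorem exists_product_vector {R : Submodule ℂ (Fin 2 × Fin 2 → ℂ)}
    (hR : Module.finrank ℂ R = 2) :
    ∃ v ∈ R, v ≠ 0 ∧ v (0, 0) * v (1, 1) = v (0, 1) * v (1, 0) := by
  let b := Module.finBasisOfFinrankEq ℂ R hR
  have hb0 : (b 0 : Fin 2 × Fin 2 → ℂ) ≠ 0 := fun h => b.ne_zero 0 (Subtype.ext h)
  set k : Fin 2 × Fin 2 → ℂ := (b 0).1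
  set l : Fin 2 × Fin 2 → ℂ := (b 1).1
  by_cases hdet : k (0, 0) * k (1, 1) - k (0, 1) * k (1, 0) = 0
  · exact ⟨k, (b 0).2, hb0, by linear_combination hdet⟩
  set B := k (0, 0) * l (1, 1) + l (0, 0) * k (1, 1) - k (0, 1) * l (1, 0) - l (0, 1) * k (1, 0)
  set C := l (0, 0) * l (1, 1) - l (0, 1) * l (1, 0)
  obtain ⟨s, hs⟩ := IsAlgClosed.exists_eq_mul_self
    (discrim (k (0, 0) * k (1, 1) - k (0, 1) * k (1, 0)) B C)
  obtain ⟨p, hp⟩ := exists_quadratic_eq_zero hdet ⟨s, hs⟩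
  refine ⟨p • k + l, R.add_mem (R.smul_mem p (b 0).2) (b 1).2, fun h0 => ?_, ?_⟩
  · have h1 : p • b 0 + (1 : ℂ) • b 1 = 0 := by
      rw [one_smul]
      exact Subtype.ext h0
    have h2 := b.linearIndependent
    rw [Fintype.linearIndependent_iff] at h2
    have h3 := h2 ![p, 1] (by simpa [Fin.sum_univ_two] using h1) 1
    simp at h3
  · simp only [Pi.add_apply, Pi.smul_apply, smul_eq_mul]
    simp only [B, C] at hp
    linear_combination hp

theorem exists_det_ne_zero_col {a : Fin 2 → ℂ} (ha : a ≠ 0) :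
    ∃ M : Matrix (Fin 2) (Fin 2) ℂ, IsUnit M.det ∧ ∀ p, M p 0 = a p := by
  refine ⟨!![a 0, -star (a 1); a 1, star (a 0)], ?_, fun p => by fin_cases p <;> simp⟩
  have h := mul_star_add_mul_star_ne_zero (s := a 0) (t := a 1) (by
    by_contra! h
    exact ha (funext fun i => by fin_cases i <;> simp [h.1, h.2]))
  rw [isUnit_iff_ne_zero, det_fin_two_of]
  convert h using 1
  ring

theorem exists_product {v : Fin 2 × Fin 2 → ℂ} (hv : v ≠ 0)
    (h : v (0, 0) * v (1, 1) = v (0, 1) * v (1, 0)) :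
    ∃ a b : Fin 2 → ℂ, a ≠ 0 ∧ b ≠ 0 ∧ ∀ p, v p = a p.1 * b p.2 := by
  have key : ∃ a b : Fin 2 → ℂ, ∀ p, v p = a p.1 * b p.2 := by
    by_cases h0 : v (0, 0) = 0
    · by_cases h1 : v (0, 1) = 0
      · refine ⟨![0, 1], ![v (1, 0), v (1, 1)], ?_⟩
        rintro ⟨i, j⟩
        fin_cases i <;> fin_cases j <;> simp [h0, h1]
      · have h2 : v (1, 0) = 0 := by simpa [h0, h1] using h.symm
        refine ⟨![v (0, 1), v (1, 1)], ![0, 1], ?_⟩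
        rintro ⟨i, j⟩
        fin_cases i <;> fin_cases j <;> simp [h0, h2]
    · refine ⟨![1, v (1, 0) / v (0, 0)], ![v (0, 0), v (0, 1)], ?_⟩
      rintro ⟨i, j⟩
      fin_cases i <;> fin_cases j <;> simp <;> field_simp
      linear_combination h
  obtain ⟨a, b, hab⟩ := key
  refine ⟨a, b, ?_, ?_, hab⟩
  · rintro rfl
    exact hv (funext fun p => by simp [hab])
  · rintro rfl
    exact hv (funext fun p => by simp [hab])

/-- Normal forms of the two-dimensional subspaces of `ℂ² ⊗ ℂ²` under local basis changes. -/
theorem exists_normal_form {R : Submodule ℂ (Fin 2 × Fin 2 → ℂ)}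
    (hR : Module.finrank ℂ R = 2) :
    ∃ M N : Matrix (Fin 2) (Fin 2) ℂ, IsUnit M.det ∧ IsUnit N.det ∧
      ∃ K : Matrix (Fin 2 × Fin 2) (Fin 2) ℂ, R ≤ LinearMap.range ((M ⊗ₖ N) * K).mulVecLin ∧
        ((∃ y, K = colMat !![1, 0; 0, 0] !![0, y; 1, 0]) ∨
          (∃ x, K = colMat !![1, 0; 0, 0] !![0, 1; x, 0]) ∨
          K = colMat !![1, 0; 0, 0] !![0, 0; 0, 1]) := by
  obtain ⟨v, hvR, hv, hdet⟩ := exists_product_vector hR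
  obtain ⟨a, b, ha, hb, hab⟩ := exists_product hv hdet
  obtain ⟨M, hM, hMa⟩ := exists_det_ne_zero_col ha
  obtain ⟨N, hN, hNb⟩ := exists_det_ne_zero_col hb
  obtain ⟨w, hwR, hw⟩ : ∃ w ∈ R, w ∉ Submodule.span ℂ {v} := by
    by_contra! h
    have h1 := Submodule.finrank_mono (show R ≤ Submodule.span ℂ {v} from h)
    rw [hR, finrank_span_singleton hv] at h1
    omega
  have hspan : R ≤ Submodule.span ℂ {v, w} := by
    have hle : Submodule.span ℂ {v, w} ≤ R := by
      rw [Submodule.span_le]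
      rintro x (rfl | rfl)
      · exact hvR
      · exact hwR
    refine (Submodule.eq_of_le_of_finrank_le hle ?_).ge
    have hlt : Submodule.span ℂ {v} < Submodule.span ℂ {v, w} := by
      refine lt_of_le_of_ne (Submodule.span_mono (by simp)) fun h => hw ?_
      rw [h]
      exact Submodule.subset_span (by simp)
    have := Submodule.finrank_lt_finrank_of_lt hlt
    rw [finrank_span_singleton hv] at this
    omega
  have hMN : IsUnit (M ⊗ₖ N).det := by
    rw [det_kronecker]
    exact (hM.pow _).mul (hN.pow _)
  obtain ⟨c, hc⟩ : ∃ c : Fin 2 × Fin 2 → ℂ, w = (M ⊗ₖ N) *ᵥ c :=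
    ⟨(M ⊗ₖ N)⁻¹ *ᵥ w, by rw [mulVec_mulVec, mul_nonsing_inv _ hMN, one_mulVec]⟩
  have hve : v = (M ⊗ₖ N) *ᵥ Pi.single (0, 0) 1 := by
    ext p
    rw [mulVec_single_one, hab, col_apply, kroneckerMap_apply, hMa, hNb]
  have hnot : ¬(c (0, 1) = 0 ∧ c (1, 0) = 0 ∧ c (1, 1) = 0) := by
    rintro ⟨h1, h2, h3⟩
    refine hw (Submodule.mem_span_singleton.mpr ⟨c (0, 0), ?_⟩)
    rw [hve, hc, ← mulVec_smul]
    congr 1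
    ext ⟨i, j⟩
    fin_cases i <;> fin_cases j <;> simp [h1, h2, h3]
  have hsuff : ∀ (P Q : Matrix (Fin 2) (Fin 2) ℂ) (K : Matrix (Fin 2 × Fin 2) (Fin 2) ℂ)
      (p q : Fin 2 → ℂ), (P ⊗ₖ Q) *ᵥ (K *ᵥ p) = Pi.single (0, 0) 1 →
      (P ⊗ₖ Q) *ᵥ (K *ᵥ q) = c →
        R ≤ LinearMap.range (((M * P) ⊗ₖ (N * Q)) * K).mulVecLin := by
    intro P Q K p q hp hq
    refine hspan.trans (Submodule.span_le.mpr ?_)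
    rintro x (rfl | rfl)
    · refine ⟨p, ?_⟩
      rw [mulVecLin_apply, mul_kronecker_mul, ← mulVec_mulVec, ← mulVec_mulVec, hp, hve]
    · refine ⟨q, ?_⟩
      rw [mulVecLin_apply, mul_kronecker_mul, ← mulVec_mulVec, ← mulVec_mulVec, hq, hc]
  have hone : ∀ (K : Matrix (Fin 2 × Fin 2) (Fin 2) ℂ) (p q : Fin 2 → ℂ),
      K *ᵥ p = Pi.single (0, 0) 1 → K *ᵥ q = c →
        R ≤ LinearMap.range ((M ⊗ₖ N) * K).mulVecLin := by
    intro K p q hp hq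
    have := hsuff 1 1 K p q (by rw [one_kronecker_one, one_mulVec, hp])
      (by rw [one_kronecker_one, one_mulVec, hq])
    rwa [Matrix.mul_one, Matrix.mul_one] at this
  by_cases hz : c (1, 1) = 0
  · by_cases hy : c (1, 0) = 0
    · have hx : c (0, 1) ≠ 0 := fun hx => hnot ⟨hx, hy, hz⟩
      refine ⟨M, N, hM, hN, _, hone _ ![1, 0] ![c (0, 0), c (0, 1)] ?_ ?_, Or.inr (Or.inl ⟨0, rfl⟩)⟩
      · ext ⟨i, j⟩
        fin_cases i <;> fin_cases j <;> simp [mulVec, dotProduct, colMat]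
      · ext ⟨i, j⟩
        fin_cases i <;> fin_cases j <;> simp [mulVec, dotProduct, colMat, hy, hz]
    · refine ⟨M, N, hM, hN, _, hone _ ![1, 0] ![c (0, 0), c (1, 0)] ?_ ?_,
        Or.inl ⟨c (0, 1) / c (1, 0), rfl⟩⟩
      · ext ⟨i, j⟩
        fin_cases i <;> fin_cases j <;> simp [mulVec, dotProduct, colMat]
      · ext ⟨i, j⟩
        fin_cases i <;> fin_cases j <;> simp [mulVec, dotProduct, colMat, hy, hz]
  -- The local shears fix the direction e₀₀ and send e₁₁ to (c₀₁/c₁₁, 1) ⊗ (c₁₀, c₁₁), which differs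
  -- from c only in the entry (0, 0); a multiple of the first column corrects it.
  · refine ⟨M * !![1, c (0, 1) / c (1, 1); 0, 1], N * !![1, c (1, 0); 0, c (1, 1)], ?_, ?_, _,
      hsuff _ _ _ ![1, 0] ![c (0, 0) - c (0, 1) / c (1, 1) * c (1, 0), 1] ?_ ?_,
      Or.inr (Or.inr rfl)⟩
    · rw [det_mul]
      exact hM.mul (by simp)
    · rw [det_mul]
      exact hN.mul (by simpa using hz)
    · ext ⟨i, j⟩
      fin_cases i <;> fin_cases j <;>
        simp [mulVec, dotProduct, colMat, Fintype.sum_prod_type]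
    · ext ⟨i, j⟩
      fin_cases i <;> fin_cases j <;>
        simp [mulVec, dotProduct, colMat, Fintype.sum_prod_type, hz]

theorem eq_top_of_single_mem {V : Submodule ℂ (Matrix (Fin 2) (Fin 2) ℂ)}
    (h : ∀ i j, single i j 1 ∈ V) : V = ⊤ := by
  rw [eq_top_iff]
  rintro C -
  rw [matrix_eq_sum_single C]
  refine Submodule.sum_mem _ fun i _ => Submodule.sum_mem _ fun j _ => ?_
  have e : single i j (C i j) = C i j • single i j (1 : ℂ) := by simp
  rw [e]
  exact Submodule.smul_mem _ _ (h i j)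

/-- The compressions of the matrix units in the first factor are triangular: each is `D 0 0` times
the unit plus units obtained before it, in the order e₁₁, e₀₁, e₁₀, e₀₀. -/
theorem eq_top_of_colMat_left {V : Submodule ℂ (Matrix (Fin 2) (Fin 2) ℂ)} {y : ℂ}
    {D : Matrix (Fin 2) (Fin 2) ℂ} (hD : D 0 0 ≠ 0)
    (hV : ∀ A : Matrix (Fin 2) (Fin 2) ℂ, (colMat !![1, 0; 0, 0] !![0, y; 1, 0])ᴴ * (A ⊗ₖ D) *
      colMat !![1, 0; 0, 0] !![0, y; 1, 0] ∈ V) : V = ⊤ := by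
  have key : ∀ A : Matrix (Fin 2) (Fin 2) ℂ, (colMat !![1, 0; 0, 0] !![0, y; 1, 0])ᴴ * (A ⊗ₖ D) *
      colMat !![1, 0; 0, 0] !![0, y; 1, 0] =
      !![A 0 0 * D 0 0, A 0 0 * D 0 1 * y + A 0 1 * D 0 0;
        star y * A 0 0 * D 1 0 + A 1 0 * D 0 0,
        star y * A 0 0 * D 1 1 * y + star y * A 0 1 * D 1 0 + A 1 0 * D 0 1 * y +
          A 1 1 * D 0 0] := by
    intro A
    ext i j
    fin_cases i <;> fin_cases j <;>
      simp [mul_apply, Fintype.sum_prod_type, colMat] <;> ring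
  simp only [key] at hV
  have hs : ∀ {B : Matrix (Fin 2) (Fin 2) ℂ}, D 0 0 • B ∈ V → B ∈ V := fun h =>
    (Submodule.smul_mem_iff _ hD).mp h
  have h11 : single 1 1 1 ∈ V := by
    refine hs ?_
    convert hV (single 1 1 1) using 1
    ext i j
    fin_cases i <;> fin_cases j <;> simp
  have h01 : single 0 1 1 ∈ V := by
    refine hs ?_
    convert V.sub_mem (hV (single 0 1 1)) (V.smul_mem (star y * D 1 0) h11) using 1
    ext i j
    fin_cases i <;> fin_cases j <;> simp
  have h10 : single 1 0 1 ∈ V := by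
    refine hs ?_
    convert V.sub_mem (hV (single 1 0 1)) (V.smul_mem (D 0 1 * y) h11) using 1
    ext i j
    fin_cases i <;> fin_cases j <;> simp
  have h00 : single 0 0 1 ∈ V := by
    refine hs ?_
    convert V.sub_mem (V.sub_mem (V.sub_mem (hV (single 0 0 1))
      (V.smul_mem (star y * D 1 1 * y) h11)) (V.smul_mem (D 0 1 * y) h01))
      (V.smul_mem (star y * D 1 0) h10) using 1
    ext i j
    fin_cases i <;> fin_cases j <;> simp
  refine eq_top_of_single_mem fun i j => ?_
  fin_cases i <;> fin_cases j
  exacts [h00, h01, h10, h11]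

theorem eq_top_of_colMat_right {V : Submodule ℂ (Matrix (Fin 2) (Fin 2) ℂ)} {x : ℂ}
    {D : Matrix (Fin 2) (Fin 2) ℂ} (hD : D 0 0 ≠ 0)
    (hV : ∀ A : Matrix (Fin 2) (Fin 2) ℂ, (colMat !![1, 0; 0, 0] !![0, 1; x, 0])ᴴ * (D ⊗ₖ A) *
      colMat !![1, 0; 0, 0] !![0, 1; x, 0] ∈ V) : V = ⊤ := by
  refine eq_top_of_colMat_left hD (y := x) fun A => ?_
  convert hV A using 1
  ext i j
  fin_cases i <;> fin_cases j <;>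
    simp [mul_apply, Fintype.sum_prod_type, colMat] <;> ring

theorem colMat_diag_mul (A B : Matrix (Fin 2) (Fin 2) ℂ) :
    (colMat !![1, 0; 0, 0] !![0, 0; 0, 1])ᴴ * (A ⊗ₖ B) * colMat !![1, 0; 0, 0] !![0, 0; 0, 1] =
      A ⊙ B := by
  ext i j
  fin_cases i <;> fin_cases j <;> simp [mul_apply, Fintype.sum_prod_type, colMat]

theorem diag_conj_re_pos {d : Fin 2 → ℂ} (hd : ∀ i, 0 < (d i).re) {M : Matrix (Fin 2) (Fin 2) ℂ}
    (hM : IsUnit M.det) (i : Fin 2) : 0 < ((Mᴴ * diagonal d * M) i i).re := by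
  have h : (fun p => M p i) ≠ 0 := fun h0 =>
    hM.ne_zero (det_eq_zero_of_column_eq_zero i fun p => congrFun h0 p)
  have := diagonal_form_re_pos hd h
  rw [Matrix.mul_assoc, mul_apply]
  exact this

/-- The Pauli matrix `σₓ`. -/
def flipMat : Matrix (Fin 2) (Fin 2) ℂ := !![0, 1; 1, 0]

/-- Let (a, b) and (c, d) be the columns i and j. Eliminating d from the two equations gives b̄ =
±δā, so Re(āb) = ±cos(θ/2)|a|² is nonzero. The relation ād = -b̄c then gives |a|² Re(c̄d) = -|c|²
Re(āb), the opposite sign. -/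
theorem flip_form {θ : ℝ} (hθ : |θ| < Real.pi) {M : Matrix (Fin 2) (Fin 2) ℂ} (hM : IsUnit M.det)
    {i j : Fin 2} (hij : i ≠ j) (hX : (Mᴴ * flipMat * M) i j = 0)
    (hD : (Mᴴ * diagonal ![halfPhase θ, star (halfPhase θ)] * M) i j = 0) :
    (Mᴴ * flipMat * M) j i = 0 ∧ ∃ x y : ℝ, (Mᴴ * flipMat * M) i i = x ∧
      (Mᴴ * flipMat * M) j j = y ∧ x * y < 0 := by
  have hX' : ∀ i j, (Mᴴ * flipMat * M) i j =
      star (M 0 i) * M 1 j + star (M 1 i) * M 0 j := by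
    intro i j
    simp [mul_apply, Fin.sum_univ_two, flipMat]
    ring
  have hD' : (Mᴴ * diagonal ![halfPhase θ, star (halfPhase θ)] * M) i j =
      halfPhase θ * star (M 0 i) * M 0 j + star (halfPhase θ) * star (M 1 i) * M 1 j := by
    simp [mul_apply, Fin.sum_univ_two, diagonal]
    ring
  have hdet : M 0 i * M 1 j - M 1 i * M 0 j ≠ 0 := by
    intro h
    refine hM.ne_zero ?_
    rw [det_fin_two]
    fin_cases i <;> fin_cases j <;> simp at hij h ⊢
    · linear_combination h
    · linear_combination -h
  rw [hX'] at hX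
  rw [hD'] at hD
  simp only [hX']
  generalize M 0 i = a at *
  generalize M 1 i = b at *
  generalize M 0 j = c at *
  generalize M 1 j = d at *
  have hδ := halfPhase_mul_star θ
  have hre := halfPhase_re θ
  have hcos : 0 < Real.cos (θ / 2) := by
    have := abs_lt.mp hθ
    exact Real.cos_pos_of_mem_Ioo ⟨by linarith, by linarith⟩
  generalize halfPhase θ = δ at *
  have hδ0 : δ ≠ 0 := left_ne_zero_of_mul_eq_one hδ
  have hδ1 : star δ ≠ 0 := right_ne_zero_of_mul_eq_one hδ
  have ha : a ≠ 0 := by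
    rintro rfl
    simp only [star_zero, zero_mul, mul_zero, zero_add, zero_sub, mul_eq_zero, star_eq_zero,
      neg_ne_zero] at hX hD hdet
    have := star_ne_zero.mpr hδ0
    simp_all
  have hc : c ≠ 0 := by
    rintro rfl
    simp only [mul_zero, zero_add, add_zero, sub_zero, mul_eq_zero, star_eq_zero] at hX hD hdet
    simp_all
  refine ⟨?_, 2 * (star a * b).re, 2 * (star c * d).re, ?_, ?_, ?_⟩
  · have := congrArg star hX
    simp only [star_add, star_mul', star_star, star_zero] at this
    linear_combination this
  · have := Complex.add_conj (star a * b)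
    rw [map_mul, Complex.star_def, Complex.conj_conj] at this
    rw [Complex.star_def]
    push_cast at this ⊢
    linear_combination this
  · have := Complex.add_conj (star c * d)
    rw [map_mul, Complex.star_def, Complex.conj_conj] at this
    rw [Complex.star_def]
    push_cast at this ⊢
    linear_combination this
  · have hna := Complex.normSq_pos.mpr ha
    have hnc := Complex.normSq_pos.mpr hc
    have hN : ∀ z : ℂ, star z * z = (Complex.normSq z : ℂ) := fun z =>
      (Complex.normSq_eq_conj_mul_self).symm
    have e1 : Complex.normSq a * (star c * d).re = -(Complex.normSq c * (star a * b).re) := by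
      have : (Complex.normSq a : ℂ) * (star c * d) = -((Complex.normSq c : ℂ) * star (star a * b)) := by
        rw [← hN, ← hN, star_mul', star_star]
        linear_combination (a * star c) * hX
      have := congrArg Complex.re this
      rwa [Complex.re_ofReal_mul, Complex.neg_re, Complex.re_ofReal_mul, Complex.star_def,
        Complex.conj_re] at this
    have e2 : (star a * b).re ≠ 0 := by
      have h1 : (δ * star a) * (δ * star a) = star b * star b := by
        have h2 : star a * (δ * star a * c + star δ * star b * d) = 0 := by rw [hD, mul_zero]
        have h3 : c * (δ * (star a * star a) - star δ * (star b * star b)) = 0 := by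
          linear_combination h2 - star δ * star b * hX
        have h4 := (mul_eq_zero.mp h3).resolve_left hc
        linear_combination δ * h4 + (star b * star b) * hδ
      have h5 : (star a * b).re = (star b * a).re := by
        rw [← Complex.conj_re, ← Complex.star_def, star_mul', star_star, mul_comm]
      rw [h5]
      rcases mul_self_eq_mul_self_iff.mp h1.symm with h6 | h6
      · rw [h6, mul_assoc, hN, Complex.re_mul_ofReal, hre]
        positivity
      · rw [h6, neg_mul, mul_assoc, hN, Complex.neg_re, Complex.re_mul_ofReal, hre]
        have : 0 < Real.cos (θ / 2) * Complex.normSq a := by positivity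
        exact neg_ne_zero.mpr this.ne'
    have e3 : (star c * d).re = -(Complex.normSq c / Complex.normSq a) * (star a * b).re := by
      field_simp
      linarith
    rw [e3]
    have : 0 < (star a * b).re ^ 2 := by positivity
    have : 0 < Complex.normSq c / Complex.normSq a * (star a * b).re ^ 2 := by positivity
    nlinarith

end NormalForm

/-! ### Two channels: exclusion by the rank of the support -/

section TwoFactors

open Matrix Kronecker

/-- The diagonal matrices that may stand next to the elements of `sig` in `𝔑_θ`. -/
noncomputable def phaseDiag (θ : ℝ) : Fin 3 → Fin 2 → ℂ :=
  ![fun _ => 1, ![halfPhase θ, star (halfPhase θ)], ![star (halfPhase θ), halfPhase θ]]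

/-- `σ ⊗ D` lies in `𝔑_θ`. -/
def SiteMem (θ : ℝ) (D σ : Matrix (Fin 2) (Fin 2) ℂ) : Prop :=
  (σ ⊗ₖ D).submatrix finProdFinEquiv.symm finProdFinEquiv.symm ∈ graphN θ

theorem siteMem_one (θ : ℝ) (D : Matrix (Fin 2) (Fin 2) ℂ) : SiteMem θ D (sig 0) := by
  have := mem_graphN_of_halfPhase θ (D 0 0) (D 0 1) (D 1 0) (D 1 1) 0 0 0 0
  rw [SiteMem]
  convert this using 1
  ext i j
  fin_cases i <;> fin_cases j <;>
    simp [finProdFinEquiv, Fin.divNat, Fin.modNat, sig, one_apply]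

theorem siteMem_phaseDiag (θ : ℝ) (α : Fin 3) :
    SiteMem θ (diagonal (phaseDiag θ α)) (sig α) := by
  fin_cases α
  · exact siteMem_one θ _
  · have := mem_graphN_of_halfPhase θ 0 0 0 0 1 0 0 0
    rw [SiteMem]
    convert this using 1
    ext i j
    fin_cases i <;> fin_cases j <;>
      simp [finProdFinEquiv, Fin.divNat, Fin.modNat, sig, phaseDiag]
  · have := mem_graphN_of_halfPhase θ 0 0 0 0 0 0 1 0
    rw [SiteMem]
    convert this using 1
    ext i j
    fin_cases i <;> fin_cases j <;>
      simp [finProdFinEquiv, Fin.divNat, Fin.modNat, sig, phaseDiag]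

theorem siteMem_flipMat (θ : ℝ) (α : Fin 3) : SiteMem θ flipMat (sig α) := by
  fin_cases α
  · exact siteMem_one θ _
  · have := mem_graphN_of_halfPhase θ 0 0 0 0 0 1 0 0
    rw [SiteMem]
    convert this using 1
    ext i j
    fin_cases i <;> fin_cases j <;>
      simp [finProdFinEquiv, Fin.divNat, Fin.modNat, sig, flipMat]
  · have := mem_graphN_of_halfPhase θ 0 0 0 0 0 0 0 1
    rw [SiteMem]
    convert this using 1
    ext i j
    fin_cases i <;> fin_cases j <;>
      simp [finProdFinEquiv, Fin.divNat, Fin.modNat, sig, flipMat]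

theorem phaseDiag_re_pos {θ : ℝ} (hθ : |θ| < Real.pi) (α : Fin 3) (t : Fin 2) :
    0 < (phaseDiag θ α t).re := by
  have hc : 0 < Real.cos (θ / 2) := by
    have := abs_lt.mp hθ
    exact Real.cos_pos_of_mem_Ioo ⟨by linarith, by linarith⟩
  fin_cases α <;> fin_cases t <;> simp [phaseDiag, halfPhase_re, hc]

theorem phaseDiag_eq_exp (θ : ℝ) (α : Fin 3) (t : Fin 2) :
    ∃ x : ℝ, |x| ≤ |θ| / 2 ∧ phaseDiag θ α t = Complex.exp (x * Complex.I) := by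
  have h1 : |θ / 2| = |θ| / 2 := by rw [abs_div, abs_two]
  have hp : ∃ x : ℝ, |x| ≤ |θ| / 2 ∧ halfPhase θ = Complex.exp (x * Complex.I) :=
    ⟨θ / 2, h1.le, rfl⟩
  have hm : ∃ x : ℝ, |x| ≤ |θ| / 2 ∧ star (halfPhase θ) = Complex.exp (x * Complex.I) := by
    refine ⟨-(θ / 2), by rw [abs_neg, h1], ?_⟩
    rw [star_halfPhase]
    congr 1
    push_cast
    ring
  have h0 : ∃ x : ℝ, |x| ≤ |θ| / 2 ∧ (1 : ℂ) = Complex.exp (x * Complex.I) :=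
    ⟨0, by rw [abs_zero]; positivity, by simp⟩
  fin_cases α <;> fin_cases t <;> simp only [phaseDiag]
  exacts [h0, h0, hp, hm, hm, hp]

/-- The arguments are at most |θ|/2 and |η|/2, so their sum stays below π/2. Only support of rank
one needs this bound on the sum; for rank two |θ| < π and |η| < π suffice. -/
theorem phaseDiag_mul_re_pos {θ η : ℝ} (h : |θ| + |η| < Real.pi) (α β : Fin 3) (s t : Fin 2) :
    0 < (phaseDiag θ α s * phaseDiag η β t).re := by
  obtain ⟨x, hx, ex⟩ := phaseDiag_eq_exp θ α s
  obtain ⟨y, hy, ey⟩ := phaseDiag_eq_exp η β t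
  rw [ex, ey, ← Complex.exp_add, ← add_mul, ← Complex.ofReal_add, Complex.exp_ofReal_mul_I_re]
  have := abs_le.mp hx
  have := abs_le.mp hy
  exact Real.cos_pos_of_mem_Ioo ⟨by linarith, by linarith⟩

section Full

variable {T : Type*} [Fintype T] [DecidableEq T] {φ ψ : T × (Fin 2 × Fin 2) → ℂ}

/-- With T and the second qubit of S unrestricted, they act as the environment E = T × ℂ² of the
first qubit, and the one-channel argument `eq_zero_of_offDiag_mem` applies with diagonal blocks of
positive real part. -/
theorem eq_zero_of_full_right
    (hfull : ∀ (D : Matrix T T ℂ) (σ : Matrix (Fin 2) (Fin 2) ℂ),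
      D ∈ pairSpaceLeft φ ψ ((1 : Matrix (Fin 2) (Fin 2) ℂ) ⊗ₖ σ))
    {d d' : T → ℂ} (hd : ∀ t, 0 < (d t).re) (hd' : ∀ t, 0 < (d' t).re)
    (h1 : diagonal d ∈ pairSpaceLeft φ ψ (sig 1 ⊗ₖ (1 : Matrix (Fin 2) (Fin 2) ℂ)))
    (h2 : diagonal d' ∈ pairSpaceLeft φ ψ (sig 2 ⊗ₖ (1 : Matrix (Fin 2) (Fin 2) ℂ))) : φ = 0 := by
  let e : Fin 2 × (T × Fin 2) ≃ T × (Fin 2 × Fin 2) :=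
    { toFun := fun p => (p.2.1, (p.1, p.2.2))
      invFun := fun p => (p.2.1, (p.1, p.2.2)) }
  have key : ∀ (D : Matrix T T ℂ) (σ τ : Matrix (Fin 2) (Fin 2) ℂ),
      D ∈ pairSpaceLeft φ ψ (σ ⊗ₖ τ) → σ ⊗ₖ (D ⊗ₖ τ) ∈ pairSpace (φ ∘ e) (ψ ∘ e) := by
    intro D σ τ h
    rw [mem_pairSpaceLeft, ← mem_pairSpace_comp e] at h
    convert h using 1
    ext p q
    simp only [kroneckerMap_apply, submatrix_apply, e, Equiv.coe_fn_mk]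
    ring
  have hdiag : ∀ d : T → ℂ, diagonal d ⊗ₖ (1 : Matrix (Fin 2) (Fin 2) ℂ) =
      diagonal fun p : T × Fin 2 => d p.1 := by
    intro d
    rw [← diagonal_one, diagonal_kronecker_diagonal]
    simp
  have hz : φ ∘ e = 0 := by
    refine eq_zero_of_offDiag_mem (ψ := ψ ∘ e) (B := diagonal fun p => d p.1)
      (C := diagonal fun p => d' p.1) (fun i j => ?_) (fun u hu h0 => ?_) (fun u hu h0 => ?_) ?_ ?_
    · have := key _ _ _ (hfull (single i.1 j.1 1) (single i.2 j.2 1))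
      rwa [single_kronecker_single, one_mul] at this
    · have := diagonal_form_re_pos (d := fun p : T × Fin 2 => d p.1) (fun p => hd p.1) hu
      rw [h0] at this
      exact lt_irrefl _ this
    · have := diagonal_form_re_pos (d := fun p : T × Fin 2 => d' p.1) (fun p => hd' p.1) hu
      rw [h0] at this
      exact lt_irrefl _ this
    · rw [← hdiag]
      exact key _ _ _ h1
    · rw [← hdiag]
      exact key _ _ _ h2
  ext p
  have := congrFun hz (e.symm p)
  simpa using this

theorem eq_zero_of_full_left
    (hfull : ∀ (D : Matrix T T ℂ) (σ : Matrix (Fin 2) (Fin 2) ℂ),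
      D ∈ pairSpaceLeft φ ψ (σ ⊗ₖ (1 : Matrix (Fin 2) (Fin 2) ℂ)))
    {d d' : T → ℂ} (hd : ∀ t, 0 < (d t).re) (hd' : ∀ t, 0 < (d' t).re)
    (h1 : diagonal d ∈ pairSpaceLeft φ ψ ((1 : Matrix (Fin 2) (Fin 2) ℂ) ⊗ₖ sig 1))
    (h2 : diagonal d' ∈ pairSpaceLeft φ ψ ((1 : Matrix (Fin 2) (Fin 2) ℂ) ⊗ₖ sig 2)) : φ = 0 := by
  let e : T × (Fin 2 × Fin 2) ≃ T × (Fin 2 × Fin 2) :=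
    (Equiv.refl T).prodCongr (Equiv.prodComm _ _)
  have key : ∀ (D : Matrix T T ℂ) (σ τ : Matrix (Fin 2) (Fin 2) ℂ),
      D ∈ pairSpaceLeft φ ψ (σ ⊗ₖ τ) → D ∈ pairSpaceLeft (φ ∘ e) (ψ ∘ e) (τ ⊗ₖ σ) := by
    intro D σ τ h
    rw [mem_pairSpaceLeft, ← mem_pairSpace_comp e] at h
    rw [mem_pairSpaceLeft]
    convert h using 1
    ext p q
    simp [kroneckerMap_apply, e, mul_comm (τ _ _)]
  have hz := eq_zero_of_full_right (φ := φ ∘ e) (ψ := ψ ∘ e) (fun D σ => key _ _ _ (hfull D σ))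
    hd hd' (key _ _ _ h1) (key _ _ _ h2)
  ext p
  have := congrFun hz (e.symm p)
  simpa using this

end Full

/-- The units e₀₁ and e₁₀ generate M₂ (e₀₀ = e₀₁e₁₀ and e₁₁ = e₁₀e₀₁), and `pairSpaceLeft_mul`
carries fullness over to products. -/
theorem forall_mem_of_factor {S ι T : Type*} [Fintype S] [DecidableEq S] [Fintype ι]
    [DecidableEq ι] [Fintype T] {φ ψ : ι × S → ℂ} {G : Matrix ι ι ℂ} (hG : IsUnit G.det)
    (hcard : Fintype.card S = Fintype.card (Fin 2 × ι))
    (h : (stack φ ψ)ᴴ * stack φ ψ = (1 : Matrix (Fin 2) (Fin 2) ℂ) ⊗ₖ G)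
    (f : Matrix (Fin 2) (Fin 2) ℂ →ₗ[ℂ] Matrix S S ℂ) (hf : ∀ a b, f (a * b) = f a * f b)
    (h1 : pairSpaceLeft φ ψ (f (sig 1)) = ⊤) (h2 : pairSpaceLeft φ ψ (f (sig 2)) = ⊤)
    (K : Matrix T ι ℂ) (D : Matrix T T ℂ) (σ : Matrix (Fin 2) (Fin 2) ℂ) :
    D ∈ pairSpaceLeft ((K ⊗ₖ (1 : Matrix S S ℂ)) *ᵥ φ) ((K ⊗ₖ (1 : Matrix S S ℂ)) *ᵥ ψ)
      (f σ) := by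
  rw [mem_pairSpaceLeft_mulVec]
  have e : σ = σ 0 0 • (sig 1 * sig 2) + σ 0 1 • sig 1 + σ 1 0 • sig 2 +
      σ 1 1 • (sig 2 * sig 1) := by
    ext i j
    fin_cases i <;> fin_cases j <;> simp [sig]
  have h12 := pairSpaceLeft_mul hG hcard h h1 h2
  have h21 := pairSpaceLeft_mul hG hcard h h2 h1
  rw [← hf] at h12 h21
  have hC : ∀ {τ : Matrix S S ℂ}, pairSpaceLeft φ ψ τ = ⊤ →
      (Kᴴ * D * K) ⊗ₖ τ ∈ pairSpace φ ψ := fun h0 =>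
    mem_pairSpaceLeft.mp (h0 ▸ Submodule.mem_top)
  rw [e, mem_pairSpaceLeft]
  simp only [map_add, map_smul, kronecker_add, kronecker_smul]
  exact add_mem (add_mem (add_mem (Submodule.smul_mem _ _ (hC h12)) (Submodule.smul_mem _ _ (hC h1)))
    (Submodule.smul_mem _ _ (hC h2))) (Submodule.smul_mem _ _ (hC h21))

/-- `σ ↦ 1 ⊗ σ`. -/
def oneKronecker : Matrix (Fin 2) (Fin 2) ℂ →ₗ[ℂ] Matrix (Fin 2 × Fin 2) (Fin 2 × Fin 2) ℂ where
  toFun σ := (1 : Matrix (Fin 2) (Fin 2) ℂ) ⊗ₖ σ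
  map_add' a b := kronecker_add _ a b
  map_smul' c a := kronecker_smul c _ a

/-- `σ ↦ σ ⊗ 1`. -/
def kroneckerOne : Matrix (Fin 2) (Fin 2) ℂ →ₗ[ℂ] Matrix (Fin 2 × Fin 2) (Fin 2 × Fin 2) ℂ where
  toFun σ := σ ⊗ₖ (1 : Matrix (Fin 2) (Fin 2) ℂ)
  map_add' a b := add_kronecker a b _
  map_smul' c a := smul_kronecker c a _

theorem offDiag_flip {θ : ℝ} (hθ : |θ| < Real.pi) {M : Matrix (Fin 2) (Fin 2) ℂ}
    (hM : IsUnit M.det) {α : Fin 3} (hα : α ≠ 0) {i j : Fin 2} (hij : i ≠ j)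
    (hX : (Mᴴ * flipMat * M) i j = 0) (hD : (Mᴴ * diagonal (phaseDiag θ α) * M) i j = 0) :
    (∀ i j, i ≠ j → (Mᴴ * flipMat * M) i j = 0) ∧ ∃ x₀ x₁ : ℝ, (Mᴴ * flipMat * M) 0 0 = x₀ ∧
      (Mᴴ * flipMat * M) 1 1 = x₁ ∧ x₀ * x₁ < 0 := by
  have hneg : star (halfPhase θ) = halfPhase (-θ) := by
    rw [star_halfPhase, halfPhase]
    congr 1
    push_cast
    ring
  have key : (Mᴴ * flipMat * M) j i = 0 ∧ ∃ x y : ℝ, (Mᴴ * flipMat * M) i i = x ∧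
      (Mᴴ * flipMat * M) j j = y ∧ x * y < 0 := by
    fin_cases α
    · exact absurd rfl hα
    · exact flip_form hθ hM hij hX hD
    · refine flip_form (θ := -θ) (by rwa [abs_neg]) hM hij hX ?_
      rw [← hneg, star_star]
      exact hD
  obtain ⟨hX', x, y, hx, hy, hxy⟩ := key
  fin_cases i <;> fin_cases j
  · exact absurd rfl hij
  · refine ⟨fun p q hpq => ?_, x, y, hx, hy, hxy⟩
    fin_cases p <;> fin_cases q
    exacts [absurd rfl hpq, hX, hX', absurd rfl hpq]
  · refine ⟨fun p q hpq => ?_, y, x, hy, hx, by rwa [mul_comm]⟩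
    fin_cases p <;> fin_cases q
    exacts [absurd rfl hpq, hX', hX, absurd rfl hpq]
  · exact absurd rfl hij

/-- The conditions for two factors rule out a first tensor factor of rank one. -/
theorem no_pair_of_rank_le_one {ι : Type*} [Fintype ι] [DecidableEq ι] [Unique ι] {θ η : ℝ}
    (hθ : |θ| + |η| < Real.pi) {φ' ψ' : ι × (Fin 2 × Fin 2) → ℂ}
    {K : Matrix (Fin 2 × Fin 2) ι ℂ} {φ ψ : (Fin 2 × Fin 2) × (Fin 2 × Fin 2) → ℂ}
    (hφ : φ = (K ⊗ₖ (1 : Matrix (Fin 2 × Fin 2) (Fin 2 × Fin 2) ℂ)) *ᵥ φ')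
    (hψ : ψ = (K ⊗ₖ (1 : Matrix (Fin 2 × Fin 2) (Fin 2 × Fin 2) ℂ)) *ᵥ ψ')
    (hφ0 : φ ≠ 0)
    (h : ∀ D₁ σ₁ D₂ σ₂, SiteMem θ D₁ σ₁ → SiteMem η D₂ σ₂ →
      D₁ ⊗ₖ D₂ ∈ pairSpaceLeft φ ψ (σ₁ ⊗ₖ σ₂)) : False := by
  have hK : (fun t => K t default) ≠ 0 := by
    intro h0
    have : K = 0 := by
      ext t i
      rw [Unique.eq_default i]
      exact congrFun h0 t
    rw [this, zero_kronecker, zero_mulVec] at hφ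
    exact hφ0 hφ
  have hrow : (fun s => φ' (default, s)) = 0 := by
    refine eq_zero_of_row (ψ := ψ') default fun α β => ?_
    have hm := h _ _ _ _ (siteMem_phaseDiag θ α) (siteMem_phaseDiag η β)
    rw [hφ, hψ, mem_pairSpaceLeft_mulVec, diagonal_kronecker_diagonal] at hm
    have hpos := diagonal_form_re_pos (d := fun p : Fin 2 × Fin 2 =>
      phaseDiag θ α p.1 * phaseDiag η β p.2) (fun p => phaseDiag_mul_re_pos hθ α β _ _) hK
    have e : Kᴴ * diagonal (fun p : Fin 2 × Fin 2 => phaseDiag θ α p.1 * phaseDiag η β p.2) * K =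
        (star (fun t => K t default) ⬝ᵥ
          diagonal (fun p : Fin 2 × Fin 2 => phaseDiag θ α p.1 * phaseDiag η β p.2) *ᵥ
            fun t => K t default) • single default default 1 := by
      ext i j
      rw [Unique.eq_default i, Unique.eq_default j, Matrix.smul_apply, single_apply_same, smul_eq_mul,
        mul_one, Matrix.mul_assoc, mul_apply]
      rfl
    rw [e] at hm
    refine (Submodule.smul_mem_iff _ fun h0 => ?_).mp hm
    rw [h0] at hpos
    exact lt_irrefl _ hpos
  refine hφ0 ?_
  have : φ' = 0 := by
    ext ⟨i, s⟩
    rw [Unique.eq_default i]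
    exact congrFun hrow s
  rw [hφ, this, mulVec_zero]

/-- The conditions for two factors rule out a first tensor factor of rank two. -/
theorem no_pair_of_rank_two {θ η : ℝ} (hθ : |θ| < Real.pi) (hη : |η| < Real.pi)
    {φ' ψ' : Fin 2 × (Fin 2 × Fin 2) → ℂ} {G : Matrix (Fin 2) (Fin 2) ℂ} (hG : IsUnit G.det)
    (hst : (stack φ' ψ')ᴴ * stack φ' ψ' = (1 : Matrix (Fin 2) (Fin 2) ℂ) ⊗ₖ G)
    {M N : Matrix (Fin 2) (Fin 2) ℂ} (hM : IsUnit M.det) (hN : IsUnit N.det)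
    {K : Matrix (Fin 2 × Fin 2) (Fin 2) ℂ}
    (hK : (∃ y, K = colMat !![1, 0; 0, 0] !![0, y; 1, 0]) ∨
      (∃ x, K = colMat !![1, 0; 0, 0] !![0, 1; x, 0]) ∨
      K = colMat !![1, 0; 0, 0] !![0, 0; 0, 1])
    {φ ψ : (Fin 2 × Fin 2) × (Fin 2 × Fin 2) → ℂ}
    (hφ : φ = (((M ⊗ₖ N) * K) ⊗ₖ (1 : Matrix (Fin 2 × Fin 2) (Fin 2 × Fin 2) ℂ)) *ᵥ φ')
    (hψ : ψ = (((M ⊗ₖ N) * K) ⊗ₖ (1 : Matrix (Fin 2 × Fin 2) (Fin 2 × Fin 2) ℂ)) *ᵥ ψ')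
    (hφ0 : φ ≠ 0)
    (h : ∀ D₁ σ₁ D₂ σ₂, SiteMem θ D₁ σ₁ → SiteMem η D₂ σ₂ →
      D₁ ⊗ₖ D₂ ∈ pairSpaceLeft φ ψ (σ₁ ⊗ₖ σ₂)) : False := by
  have hred : ∀ {D₁ σ₁ D₂ σ₂}, SiteMem θ D₁ σ₁ → SiteMem η D₂ σ₂ →
      Kᴴ * ((Mᴴ * D₁ * M) ⊗ₖ (Nᴴ * D₂ * N)) * K ∈ pairSpaceLeft φ' ψ' (σ₁ ⊗ₖ σ₂) := by
    intro D₁ σ₁ D₂ σ₂ h1 h2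
    have := h _ _ _ _ h1 h2
    rw [hφ, hψ, mem_pairSpaceLeft_mulVec] at this
    convert this using 1
    rw [mul_kronecker_mul, mul_kronecker_mul, conjTranspose_mul, conjTranspose_kronecker]
    simp only [Matrix.mul_assoc]
  have hconj : ∀ {P : Matrix (Fin 2) (Fin 2) ℂ}, IsUnit P.det → ∀ A : Matrix (Fin 2) (Fin 2) ℂ,
      Pᴴ * ((P⁻¹)ᴴ * A * P⁻¹) * P = A := by
    intro P hP A
    calc Pᴴ * ((P⁻¹)ᴴ * A * P⁻¹) * P = (P⁻¹ * P)ᴴ * A * (P⁻¹ * P) := by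
          rw [conjTranspose_mul]
          simp only [Matrix.mul_assoc]
      _ = A := by
          rw [nonsing_inv_mul _ hP, conjTranspose_one, Matrix.one_mul, Matrix.mul_one]
  have hredl : ∀ (A : Matrix (Fin 2) (Fin 2) ℂ) {D₂ σ₂}, SiteMem η D₂ σ₂ →
      Kᴴ * (A ⊗ₖ (Nᴴ * D₂ * N)) * K ∈ pairSpaceLeft φ' ψ' (sig 0 ⊗ₖ σ₂) := by
    intro A D₂ σ₂ h2
    have := hred (siteMem_one θ ((M⁻¹)ᴴ * A * M⁻¹)) h2
    rwa [hconj hM] at this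
  have hredr : ∀ (A : Matrix (Fin 2) (Fin 2) ℂ) {D₁ σ₁}, SiteMem θ D₁ σ₁ →
      Kᴴ * ((Mᴴ * D₁ * M) ⊗ₖ A) * K ∈ pairSpaceLeft φ' ψ' (σ₁ ⊗ₖ sig 0) := by
    intro A D₁ σ₁ h1
    have := hred h1 (siteMem_one η ((N⁻¹)ᴴ * A * N⁻¹))
    rwa [hconj hN] at this
  have hcard : Fintype.card (Fin 2 × Fin 2) = Fintype.card (Fin 2 × Fin 2) := rfl
  -- Fullness for both off-diagonal units on one block qubit would free that qubit entirely and
  -- force φ = 0. Each normal form is therefore refuted by establishing such fullness, or it must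
  -- escape it on both sides.
  have hright : ¬∀ β, β ≠ 0 → pairSpaceLeft φ' ψ' (sig 0 ⊗ₖ sig β) = ⊤ := by
    intro hf
    have hfull := forall_mem_of_factor hG hcard hst oneKronecker
      (fun a b => by simp [oneKronecker, ← mul_kronecker_mul])
      (hf 1 (by decide)) (hf 2 (by decide)) ((M ⊗ₖ N) * K)
    rw [← hφ, ← hψ] at hfull
    have hd : ∀ α, diagonal (fun p : Fin 2 × Fin 2 => phaseDiag θ α p.1) ∈
        pairSpaceLeft φ ψ (sig α ⊗ₖ (1 : Matrix (Fin 2) (Fin 2) ℂ)) := by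
      intro α
      have := h _ _ _ _ (siteMem_phaseDiag θ α) (siteMem_phaseDiag η 0)
      rw [diagonal_kronecker_diagonal] at this
      simpa [phaseDiag, sig] using this
    exact hφ0 (eq_zero_of_full_right hfull (fun _ => phaseDiag_re_pos hθ _ _)
      (fun _ => phaseDiag_re_pos hθ _ _) (hd 1) (hd 2))
  have hleft : ¬∀ α, α ≠ 0 → pairSpaceLeft φ' ψ' (sig α ⊗ₖ sig 0) = ⊤ := by
    intro hf
    have hfull := forall_mem_of_factor hG hcard hst kroneckerOne
      (fun a b => by simp [kroneckerOne, ← mul_kronecker_mul])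
      (hf 1 (by decide)) (hf 2 (by decide)) ((M ⊗ₖ N) * K)
    rw [← hφ, ← hψ] at hfull
    have hd : ∀ β, diagonal (fun p : Fin 2 × Fin 2 => phaseDiag η β p.2) ∈
        pairSpaceLeft φ ψ ((1 : Matrix (Fin 2) (Fin 2) ℂ) ⊗ₖ sig β) := by
      intro β
      have := h _ _ _ _ (siteMem_phaseDiag θ 0) (siteMem_phaseDiag η β)
      rw [diagonal_kronecker_diagonal] at this
      simpa [phaseDiag, sig] using this
    exact hφ0 (eq_zero_of_full_left hfull (fun _ => phaseDiag_re_pos hη _ _)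
      (fun _ => phaseDiag_re_pos hη _ _) (hd 1) (hd 2))
  have hPpos := fun α => diag_conj_re_pos (phaseDiag_re_pos hθ α) hM
  have hQpos := fun β => diag_conj_re_pos (phaseDiag_re_pos hη β) hN
  have hne : ∀ {z : ℂ}, 0 < z.re → z ≠ 0 := by
    rintro z hz rfl
    exact lt_irrefl _ hz
  rcases hK with ⟨y, rfl⟩ | ⟨x, rfl⟩ | rfl
  · exact hright fun β _ => eq_top_of_colMat_left (hne (hQpos β 0)) fun A =>
      hredl A (siteMem_phaseDiag η β)
  · exact hleft fun α _ => eq_top_of_colMat_right (hne (hPpos α 0)) fun A =>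
      hredr A (siteMem_phaseDiag θ α)
  -- In the remaining normal form, with columns e₀₀ and e₁₁, compression is the entrywise product.
  -- An arbitrary partner then isolates every matrix unit at which the other factor is nonzero.
  simp only [colMat_diag_mul] at hred hredl hredr
  have hsl : ∀ (A : Matrix (Fin 2) (Fin 2) ℂ) (i j : Fin 2),
      single i j 1 ⊙ A = A i j • single i j (1 : ℂ) := by
    intro A i j
    ext p q
    simp only [hadamard_apply, single_apply, Matrix.smul_apply, smul_eq_mul]
    split_ifs with h0
    · rw [h0.1, h0.2, one_mul, mul_one]
    · simp
  have hsr : ∀ (A : Matrix (Fin 2) (Fin 2) ℂ) (i j : Fin 2),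
      A ⊙ single i j 1 = A i j • single i j (1 : ℂ) := fun A i j => by
    rw [hadamard_comm, hsl]
  have hN' : ∀ {D β} (i j : Fin 2), SiteMem η D (sig β) → (Nᴴ * D * N) i j ≠ 0 →
      single i j 1 ∈ pairSpaceLeft φ' ψ' (sig 0 ⊗ₖ sig β) := by
    intro D β i j hD h0
    have := hredl (single i j 1) hD
    rw [hsl] at this
    exact (Submodule.smul_mem_iff _ h0).mp this
  have hM' : ∀ {D α} (i j : Fin 2), SiteMem θ D (sig α) → (Mᴴ * D * M) i j ≠ 0 →
      single i j 1 ∈ pairSpaceLeft φ' ψ' (sig α ⊗ₖ sig 0) := by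
    intro D α i j hD h0
    have := hredr (single i j 1) hD
    rw [hsr] at this
    exact (Submodule.smul_mem_iff _ h0).mp this
  -- Diagonal units are always available through the phase matrices. Fullness can only fail at an
  -- off-diagonal position where flip and phase matrix both vanish, which is the configuration of
  -- `flip_form`.
  obtain ⟨hNoff, y₀, y₁, hy₀, hy₁, hy⟩ : (∀ i j, i ≠ j → (Nᴴ * flipMat * N) i j = 0) ∧
      ∃ y₀ y₁ : ℝ, (Nᴴ * flipMat * N) 0 0 = y₀ ∧ (Nᴴ * flipMat * N) 1 1 = y₁ ∧ y₀ * y₁ < 0 := by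
    by_contra hc
    refine hright fun β hβ => eq_top_of_single_mem fun i j => ?_
    by_cases hij : i = j
    · subst hij
      exact hN' _ _ (siteMem_phaseDiag η β) (hne (hQpos β i))
    by_cases h1 : (Nᴴ * flipMat * N) i j = 0
    · refine hN' _ _ (siteMem_phaseDiag η β) fun h2 => hc ?_
      exact offDiag_flip hη hN hβ hij h1 h2
    · exact hN' _ _ (siteMem_flipMat η β) h1
  obtain ⟨hMoff, x₀, x₁, hx₀, hx₁, hx⟩ : (∀ i j, i ≠ j → (Mᴴ * flipMat * M) i j = 0) ∧
      ∃ y₀ y₁ : ℝ, (Mᴴ * flipMat * M) 0 0 = y₀ ∧ (Mᴴ * flipMat * M) 1 1 = y₁ ∧ y₀ * y₁ < 0 := by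
    by_contra hc
    refine hleft fun α hα => eq_top_of_single_mem fun i j => ?_
    by_cases hij : i = j
    · subst hij
      exact hM' _ _ (siteMem_phaseDiag θ α) (hne (hPpos α i))
    by_cases h1 : (Mᴴ * flipMat * M) i j = 0
    · refine hM' _ _ (siteMem_phaseDiag θ α) fun h2 => hc ?_
      exact offDiag_flip hθ hM hα hij h1 h2
    · exact hM' _ _ (siteMem_flipMat θ α) h1
  refine row_ne_zero_of_stack hG hst 0 (eq_zero_of_row (ψ := ψ') 0 fun α β => ?_)
  by_cases hα : α = 0
  · subst hα
    exact hN' _ _ (siteMem_phaseDiag η β) (hne (hQpos β 0))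
  by_cases hβ : β = 0
  · subst hβ
    exact hM' _ _ (siteMem_phaseDiag θ α) (hne (hPpos α 0))
  have h1 := hred (siteMem_flipMat θ α) (siteMem_flipMat η β)
  have h2 := hred (siteMem_flipMat θ α) (siteMem_phaseDiag η β)
  have hd0 := hQpos β 0
  have hd1 := hQpos β 1
  generalize Nᴴ * diagonal (phaseDiag η β) * N = Q at *
  -- Both entrywise products are diagonal, and this combination cancels the entry (1, 1). The
  -- surviving coefficient is nonzero because y₀ and y₁ have opposite signs while Q₀₀ and Q₁₁ have
  -- positive real parts. So e₀₀ is allowed for all α, β and the row 0 of φ' vanishes, against the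
  -- invertibility of G.
  have e : (x₀ * (y₀ * Q 1 1 - y₁ * Q 0 0) : ℂ) • single 0 0 (1 : ℂ) =
      Q 1 1 • ((Mᴴ * flipMat * M) ⊙ (Nᴴ * flipMat * N)) -
        (y₁ : ℂ) • ((Mᴴ * flipMat * M) ⊙ Q) := by
    ext i j
    fin_cases i <;> fin_cases j
    · simp [hx₀, hy₀]
      ring
    · simp [hMoff]
    · simp [hMoff]
    · simp [hx₁, hy₁]
      ring
  refine (Submodule.smul_mem_iff _ (mul_ne_zero ?_ fun h0 => ?_)).mp
    (e ▸ Submodule.sub_mem _ (Submodule.smul_mem _ _ h1) (Submodule.smul_mem _ _ h2))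
  · rw [Complex.ofReal_ne_zero]
    rintro rfl
    simp at hx
  · have h3 := congrArg Complex.re h0
    rw [Complex.sub_re, Complex.re_ofReal_mul, Complex.re_ofReal_mul, Complex.zero_re] at h3
    have h4 : y₀ * y₁ * (Q 1 1).re = y₁ ^ 2 * (Q 0 0).re := by linear_combination y₁ * h3
    have h5 : 0 ≤ y₁ ^ 2 * (Q 0 0).re := by positivity
    nlinarith

theorem no_pair_of_siteMem {θ η : ℝ} (hθ : |θ| + |η| < Real.pi)
    {φ ψ : (Fin 2 × Fin 2) × (Fin 2 × Fin 2) → ℂ} (hφ0 : φ ≠ 0)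
    (h : ∀ D₁ σ₁ D₂ σ₂, SiteMem θ D₁ σ₁ → SiteMem η D₂ σ₂ →
      D₁ ⊗ₖ D₂ ∈ pairSpaceLeft φ ψ (σ₁ ⊗ₖ σ₂)) : False := by
  have htop : pairSpaceLeft φ ψ (1 : Matrix (Fin 2 × Fin 2) (Fin 2 × Fin 2) ℂ) = ⊤ := by
    rw [eq_top_iff]
    rintro C -
    rw [matrix_eq_sum_single C]
    refine Submodule.sum_mem _ fun i _ => Submodule.sum_mem _ fun j _ => ?_
    have := h _ _ _ _ (siteMem_one θ (single i.1 j.1 (C i j))) (siteMem_one η (single i.2 j.2 1))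
    rw [single_kronecker_single, mul_one] at this
    simpa [sig] using this
  set R := LinearMap.range (rowMatrix φ).mulVecLin with hR
  have hrank : (rowMatrix φ).rank = Module.finrank ℂ R := rfl
  let b := Module.finBasis ℂ R
  obtain ⟨φ', ψ', hφ, hψ, -, G, hG, hst⟩ := exists_factor htop
    (of fun t i => (b i : Fin 2 × Fin 2 → ℂ) t) (by
      rintro v hv
      refine ⟨b.repr ⟨v, hv⟩, ?_⟩
      have := congrArg Subtype.val (b.sum_repr ⟨v, hv⟩)
      simp only [AddSubmonoidClass.coe_finsetSum, SetLike.val_smul] at this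
      refine Eq.trans ?_ this
      ext t
      simp [mulVec, dotProduct, mul_comm]) (by rw [Fintype.card_fin, hrank])
  have hle := card_le_of_stack hG hst
  rw [Fintype.card_fin, Fintype.card_prod, Fintype.card_fin] at hle
  have hr : Module.finrank ℂ R = 0 ∨ Module.finrank ℂ R = 1 ∨ Module.finrank ℂ R = 2 := by omega
  rcases hr with hr | hr | hr
  · have : IsEmpty (Fin (Module.finrank ℂ R)) := by rw [hr]; infer_instance
    refine hφ0 ?_
    rw [hφ, Subsingleton.elim φ' 0, mulVec_zero]
  · have : Unique (Fin (Module.finrank ℂ R)) := by rw [hr]; infer_instance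
    exact no_pair_of_rank_le_one hθ hφ hψ hφ0 h
  · obtain ⟨M, N, hM, hN, K, hRK, hK⟩ := exists_normal_form hr
    obtain ⟨φ', ψ', hφ, hψ, -, G, hG, hst⟩ := exists_factor htop ((M ⊗ₖ N) * K) hRK
      (by rw [Fintype.card_fin, hrank, hr])
    have h1 := abs_nonneg θ
    have h2 := abs_nonneg η
    exact no_pair_of_rank_two (by linarith) (by linarith) hG hst hM hN hK hφ hψ hφ0 h

theorem tens_graphN_no_pair_two {θ : Fin 2 → ℝ} (hθ : |θ 0| + |θ 1| < Real.pi)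
    {φ ψ : (Fin 2 → Fin 4) → ℂ} (hφ : star φ ⬝ᵥ φ = 1)
    (h : ∀ A : Fin 2 → Matrix (Fin 4) (Fin 4) ℂ, (∀ i, A i ∈ graphN (θ i)) →
      star φ ⬝ᵥ tens A *ᵥ ψ = 0 ∧ star ψ ⬝ᵥ tens A *ᵥ φ = 0 ∧
        star φ ⬝ᵥ tens A *ᵥ φ = star ψ ⬝ᵥ tens A *ᵥ ψ) : False := by
  let g : Fin 2 × Fin 2 ≃ Fin 4 := finProdFinEquiv
  -- In the identification of `Fin 4` with pairs the first component is the block index. The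
  -- positions within the blocks are collected into T and the block indices into S.
  let e : (Fin 2 × Fin 2) × (Fin 2 × Fin 2) ≃ (Fin 2 → Fin 4) :=
    { toFun := fun p => ![g (p.2.1, p.1.1), g (p.2.2, p.1.2)]
      invFun := fun f => (((g.symm (f 0)).2, (g.symm (f 1)).2), ((g.symm (f 0)).1, (g.symm (f 1)).1))
      left_inv := fun p => by simp
      right_inv := fun f => by
        ext i
        fin_cases i <;> simp }
  refine no_pair_of_siteMem hθ (φ := φ ∘ e) (ψ := ψ ∘ e) (fun h0 => ?_) ?_
  · have : φ = 0 := by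
      ext p
      simpa using congrFun h0 (e.symm p)
    simp [this] at hφ
  · intro D₁ σ₁ D₂ σ₂ h1 h2
    have hm : tens ![(σ₁ ⊗ₖ D₁).submatrix g.symm g.symm, (σ₂ ⊗ₖ D₂).submatrix g.symm g.symm] ∈ pairSpace φ ψ := by
      refine mem_pairSpace.mpr (h _ fun i => ?_)
      fin_cases i
      · exact h1
      · exact h2
    rw [← mem_pairSpace_comp e] at hm
    rw [mem_pairSpaceLeft]
    convert hm using 1
    ext p q
    simp [tens_apply, Fin.prod_univ_two, e, kroneckerMap_apply]
    ring

end TwoFactors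

end ZeroError

theorem theorem1 :
    -- A
    (∀ θ ∈ Set.Ioc (-Real.pi) Real.pi, ∀ (b : Type u) [Fintype b] [DecidableEq b]
      (Φ : Matrix (Fin 4) (Fin 4) ℂ →ₗ[ℂ] Matrix b b ℂ), IsChannel Φ → ncGraph Φ = graphN θ →
        (0 < capacity Φ ↔ θ = Real.pi) ∧ (θ = Real.pi → capacity Φ = 1)) ∧
    -- B
    (∀ (n : ℕ) (θ : Fin n → ℝ), (∀ i, θ i ∈ Set.Ioc (-Real.pi) Real.pi) →
      ∀ (b : Fin n → Type u) [∀ i, Fintype (b i)] [∀ i, DecidableEq (b i)]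
        (Φ : ∀ i, Matrix (Fin 4) (Fin 4) ℂ →ₗ[ℂ] Matrix (b i) (b i) ℂ),
        (∀ i, IsChannel (Φ i)) → (∀ i, ncGraph (Φ i) = graphN (θ i)) →
        (∃ k : ℤ, ∑ i, θ i = Real.pi + k * (2 * Real.pi)) →
          0 < capacity (tensor Φ) ∧
          IsCode (tensor Φ) (Submodule.span ℂ {codeVec n 0 1, codeVec n 2 3}) ∧
          Module.finrank ℂ (Submodule.span ℂ {codeVec n 0 1, codeVec n 2 3}) = 2) ∧
    -- C₂
    (∀ θ : Fin 2 → ℝ, (∀ i, θ i ∈ Set.Ioc (-Real.pi) Real.pi) →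
      ∀ (b : Fin 2 → Type u) [∀ i, Fintype (b i)] [∀ i, DecidableEq (b i)]
        (Φ : ∀ i, Matrix (Fin 4) (Fin 4) ℂ →ₗ[ℂ] Matrix (b i) (b i) ℂ),
        (∀ i, IsChannel (Φ i)) → (∀ i, ncGraph (Φ i) = graphN (θ i)) →
        |θ 0| + |θ 1| < Real.pi → capacity (tensor Φ) = 0) ∧
    -- Cₙ
    (∀ (n : ℕ) (θ : Fin n → ℝ), (∀ i, θ i ∈ Set.Ioc (-Real.pi) Real.pi) →
      ∀ (b : Fin n → Type u) [∀ i, Fintype (b i)] [∀ i, DecidableEq (b i)]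
        (Φ : ∀ i, Matrix (Fin 4) (Fin 4) ℂ →ₗ[ℂ] Matrix (b i) (b i) ℂ),
        (∀ i, IsChannel (Φ i)) → (∀ i, ncGraph (Φ i) = graphN (θ i)) →
        ∑ i, |θ i| ≤ 2 * Real.log (3 / 2) → capacity (tensor Φ) = 0) := by
  refine ⟨?_, ?_, ?_, ?_⟩
  · intro θ hθ b _ _ Φ _ hΦ
    exact capacity_single hθ hΦ
  · intro n θ _ b _ _ Φ _ hΦ hθ
    exact isCode_codeVec hΦ hθ
  · intro θ _ b _ _ Φ _ hΦ hθ
    exact capacity_tensor_eq_zero hΦ fun φ ψ hφ _ h =>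
      tens_graphN_no_pair_two hθ hφ fun A hA => h A hA
  · intro n θ _ b _ _ Φ _ hΦ hθ
    exact capacity_tensor_eq_zero hΦ fun φ ψ hφ hψ h =>
      tens_graphN_no_pair hθ hφ hψ fun A hA => ⟨(h A hA).1, (h A hA).2.2⟩
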